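/- **Setting.** Let $\kappa>0$, $n\in\{1,2,\dots\}$, $\tau\in\mathbb C$ with $\operatorname{Im}\tau>0$, let $\mathcal L=\sqrt{2\pi/\operatorname{Im}\tau}\,(\mathbb Z+\tau\mathbb Z)\subset\mathbb C\cong\mathbb R^2$, and let $\Omega$ be its fundamental cell centred at the origin (so $|\Omega|=2\pi$). Put $Jx=(-x_2,x_1)$, $a^n(x)=\frac n2Jx$, $\nabla_a=\nabla-ia$, $\Delta_a=\sum_j(\partial_j-ia_j)^2$, $\operatorname{curl}a=\partial_1a_2-\partial_2a_1$, $\operatorname{curl}^*f=(\partial_2f,-\partial_1f)$. The rescaled Ginzburg–Landau equations for $(\lambda,\psi,a)$ are $$(-\Delta_a-\lambda)\psi=-\kappa^2|\psi|^2\psi,\qquad \operatorname{curl}^*\operatorname{curl}a=\operatorname{Im}(\bar\psi\nabla_a\psi).$$ Let $\mathcal L^2_n$ be the complex space of even $\psi\in L^2_{loc}(\mathbb R^2,\mathbb C)$ with $\psi(x+t)=e^{i(\frac n2x\cdot Jt+\pi npq)}\psi(x)$ for all $t=\sqrt{2\pi/\operatorname{Im}\tau}\,(p+q\tau)\in\mathcal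 L$, and $\vec{\mathcal L}^2$ the real space of odd, $\mathcal L$-periodic $\alpha\in L^2_{loc}(\mathbb R^2,\mathbb R^2)$ with $\operatorname{div}\alpha=0$ (in the distributional sense) and $\int_\Omega\alpha=0$, both with the inner product of $L^2(\Omega)$. Let $\mathscr H^2_n$, $\vec{\mathscr H}^2$ be the corresponding Sobolev spaces of order two (for $\mathscr H^2_n$ with the covariant derivatives $\nabla_{a^n}$). Let $L^n=-\Delta_{a^n}$, $M=\operatorname{curl}^*\operatorname{curl}$, let $P'$ be the orthogonal projection onto the divergence free, mean zero periodic vector fields, and $$F(\lambda,\psi,\alpha)=\big((L^n-\lambda)\psi+2i\alpha\cdot\nabla_{a^n}\psi+|\alpha|^2\psi+\kappa^2|\psi|^2\psi,\ M\alpha-P'\operatorname{Im}(\bar\psi\nabla_{a^n+\alpha}\psi)\big).$$ **Theorem.** Let $X=X'\times X''$ and $Y=Y'\times Y''$ be closed subspaces of $\mathscr H^2_n\times\vec{\mathscr H}^2$ and of $\mathcal L^2_n\times\vec{\mathcal L}^2$ respectively ($X',Y'$ complex, $X'',Y''$ real) such that $X\subset Y$ densely, $F$ maps $\mathbb R\times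 X$ into $Y$ and is of class $C^2$, and $L^n$ with domain $X'$ and $M$ with domain $X''$ are self-adjoint operators in $Y'$ and $Y''$. Assume that $\dim_{\mathbb C}\operatorname{Null}_{X'}(L^n-n)=1$, and let $\psi_0\in X'$ satisfy $L^n\psi_0=n\psi_0$, $\frac1{|\Omega|}\int_\Omega|\psi_0|^2=1$. Then there are $\epsilon>0$ and real-analytic functions $g_\lambda:[0,\epsilon)\to\mathbb R$, $g_\psi:[0,\epsilon)\to X'$, $g_\alpha:[0,\epsilon)\to X''$, all vanishing at $0$, with $g_\psi$ orthogonal in $L^2(\Omega)$ to $\operatorname{Null}(L^n-n)\subset\mathscr H^2_n$, such that, for every $s\in[0,\sqrt\epsilon)$, $$\lambda_s=n+g_\lambda(s^2),\qquad \psi_s=s\psi_0+s\,g_\psi(s^2),\qquad a_s=a^n+g_\alpha(s^2)$$ solve the rescaled Ginzburg–Landau equations on $\mathbb R^2$, and $\psi_s\ne0$ for $s>0$. Moreover, in a sufficiently small neighbourhood of $(n,0,0)$ in $\mathbb R\times X$, every $(\lambda,\psi,\alpha)$ such that $(\lambda,\psi,a^n+\alpha)$ solves these equations either is trivial, $(\psi,\alpha)=(0,0)$,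 or equals $(\lambda_s,e^{i\delta}\psi_s,g_\alpha(s^2))$ for some $s\in(0,\sqrt\epsilon)$ and $\delta\in\mathbb R$. -/

import Mathlib

open MeasureTheory Set Filter Topology
open scoped ContDiff ComplexConjugate InnerProductSpace

noncomputable section

namespace GinzburgLandau

/-- The plane `ℝ²` with its Euclidean structure. -/
abbrev Plane := EuclideanSpace ℝ (Fin 2)

/-- `J x = (-x₂, x₁)`. -/
def J (x : Plane) : Plane := !₂[-x 1, x 0]

/-- The `j`-th coordinate vector. -/
def coordVec (j : Fin 2) : Plane := EuclideanSpace.single j 1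

/-- The point `√(2π / Im τ) (s + t τ)` of the plane, under `ℂ ≃ ℝ²`. -/
def latticePoint (τ : UpperHalfPlane) (s t : ℝ) : Plane :=
  √(2 * Real.pi / τ.im) • !₂[s + t * τ.re, t * τ.im]

/-- The elements of the normalized lattice `√(2π / Im τ) (ℤ + τ ℤ)`. -/
def latticeVec (τ : UpperHalfPlane) (p q : ℤ) : Plane := latticePoint τ p q

/-- The fundamental cell centred at the origin; it has area `2π`. -/
def cell (τ : UpperHalfPlane) : Set Plane :=
  {x | ∃ s ∈ Ico (-(1 / 2) : ℝ) (1 / 2), ∃ t ∈ Ico (-(1 / 2) : ℝ) (1 / 2), x = latticePoint τ s t}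

theorem cell_cover (τ : UpperHalfPlane) (x : Plane) :
    ∃ p q : ℤ, x - latticeVec τ p q ∈ cell τ := by
  have him : 0 < τ.im := τ.im_pos
  have hr : 0 < √(2 * Real.pi / τ.im) := Real.sqrt_pos.2 (by positivity)
  set r := √(2 * Real.pi / τ.im) with hr_def
  set t : ℝ := x 1 / (r * τ.im) with ht
  set s : ℝ := x 0 / r - t * τ.re with hs
  have key : ∀ u : ℝ, u - ⌊u + 1 / 2⌋ ∈ Ico (-(1 / 2) : ℝ) (1 / 2) := by
    intro u
    constructor
    · have := Int.floor_le (u + 1 / 2)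
      linarith
    · have := Int.lt_floor_add_one (u + 1 / 2)
      linarith
  refine ⟨⌊s + 1 / 2⌋, ⌊t + 1 / 2⌋, s - ⌊s + 1 / 2⌋, key s, t - ⌊t + 1 / 2⌋, key t, ?_⟩
  ext i
  fin_cases i
  · simp [latticeVec, latticePoint, ← hr_def]
    rw [hs]
    field_simp
    ring
  · simp [latticeVec, latticePoint, ← hr_def]
    rw [ht]
    field_simp

theorem cell_subset_ball (τ : UpperHalfPlane) :
    ∃ K : Set Plane, IsCompact K ∧ cell τ ⊆ K := by
  have hc : Continuous fun z : ℝ × ℝ => latticePoint τ z.1 z.2 := by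
    have h1 : Continuous fun z : ℝ × ℝ => (![z.1 + z.2 * τ.re, z.2 * τ.im] : Fin 2 → ℝ) := by
      refine continuous_pi fun i => ?_
      fin_cases i
      · change Continuous fun z : ℝ × ℝ => z.1 + z.2 * τ.re
        fun_prop
      · change Continuous fun z : ℝ × ℝ => z.2 * τ.im
        fun_prop
    exact ((PiLp.continuous_toLp 2 (fun _ : Fin 2 => ℝ)).comp h1).const_smul
      (√(2 * Real.pi / τ.im))
  refine ⟨(fun z : ℝ × ℝ => latticePoint τ z.1 z.2) '' (Icc (-(1 / 2)) (1 / 2) ×ˢ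
    Icc (-(1 / 2)) (1 / 2)), (isCompact_Icc.prod isCompact_Icc).image hc, ?_⟩
  rintro x ⟨s, hs, t, ht, rfl⟩
  exact ⟨(s, t), ⟨Ico_subset_Icc_self hs, Ico_subset_Icc_self ht⟩, rfl⟩

section Quasiperiodic

variable (𝕜 E : Type) [RCLike 𝕜] [NormedAddCommGroup E] [InnerProductSpace 𝕜 E]

/-- Classes (modulo equality a.e.) of locally square integrable functions on the plane with
`f (x + t) = m_t(x) f(x)` a.e. for every lattice vector `t`. -/
def quasiPeriodic (τ : UpperHalfPlane) (m : ℤ → ℤ → Plane → 𝕜) :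
    Submodule 𝕜 (Plane →ₘ[(volume : Measure Plane)] E) where
  carrier := {f | (∀ p q : ℤ, ∀ᵐ x : Plane, f (x + latticeVec τ p q) = m p q x • f x) ∧
    ∀ K : Set Plane, IsCompact K → MemLp f 2 (volume.restrict K)}
  add_mem' := by
    rintro f g ⟨hf, hf2⟩ ⟨hg, hg2⟩
    refine ⟨fun p q => ?_, fun K hK => ?_⟩
    · have h := AEEqFun.coeFn_add f g
      have h' := (measurePreserving_add_right (volume : Measure Plane)
        (latticeVec τ p q)).quasiMeasurePreserving.ae h
      filter_upwards [h, h', hf p q, hg p q] with x h1 h2 h3 h4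
      rw [h1, h2, Pi.add_apply, Pi.add_apply, h3, h4, smul_add]
    · exact ((hf2 K hK).add (hg2 K hK)).ae_eq (ae_restrict_of_ae (AEEqFun.coeFn_add f g).symm)
  zero_mem' := by
    refine ⟨fun p q => ?_, fun K hK => ?_⟩
    · have h := AEEqFun.coeFn_zero (α := Plane) (β := E) (μ := volume)
      have h' := (measurePreserving_add_right (volume : Measure Plane)
        (latticeVec τ p q)).quasiMeasurePreserving.ae h
      filter_upwards [h, h'] with x h1 h2
      rw [h1, h2]
      simp
    · exact MemLp.zero.ae_eq (ae_restrict_of_ae (AEEqFun.coeFn_zero (α := Plane) (β := E)).symm)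
  smul_mem' := by
    rintro c f ⟨hf, hf2⟩
    refine ⟨fun p q => ?_, fun K hK => ?_⟩
    · have h := AEEqFun.coeFn_smul c f
      have h' := (measurePreserving_add_right (volume : Measure Plane)
        (latticeVec τ p q)).quasiMeasurePreserving.ae h
      filter_upwards [h, h', hf p q] with x h1 h2 h3
      rw [h1, h2, Pi.smul_apply, Pi.smul_apply, h3, smul_comm]
    · exact ((hf2 K hK).const_smul c).ae_eq (ae_restrict_of_ae (AEEqFun.coeFn_smul c f).symm)

/-- The space `quasiPeriodic` as a type, to be normed by the norm of `L²` of the fundamental cell. -/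
def QP (τ : UpperHalfPlane) (m : ℤ → ℤ → Plane → 𝕜) : Type := ↥(quasiPeriodic 𝕜 E τ m)

variable {𝕜 E} {τ : UpperHalfPlane} {m : ℤ → ℤ → Plane → 𝕜}

instance : AddCommGroup (QP 𝕜 E τ m) := inferInstanceAs (AddCommGroup ↥(quasiPeriodic 𝕜 E τ m))

instance : Module 𝕜 (QP 𝕜 E τ m) := inferInstanceAs (Module 𝕜 ↥(quasiPeriodic 𝕜 E τ m))

theorem QP.memLp_cell (f : QP 𝕜 E τ m) :
    MemLp f.1 2 (volume.restrict (cell τ)) := by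
  obtain ⟨K, hK, hsub⟩ := cell_subset_ball τ
  exact (f.2.2 K hK).mono_measure (Measure.restrict_mono hsub le_rfl)

theorem QP.integrableOn_cell (f : QP 𝕜 E τ m) :
    IntegrableOn f.1 (cell τ) := by
  obtain ⟨K, hK, hsub⟩ := cell_subset_ball τ
  have : IsFiniteMeasure ((volume : Measure Plane).restrict K) :=
    ⟨by simpa using hK.measure_lt_top⟩
  exact IntegrableOn.mono_set ((f.2.2 K hK).integrable (by norm_num)) hsub

theorem QP.locallyIntegrable (f : QP 𝕜 E τ m) :
    LocallyIntegrable f.1 := by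
  rw [locallyIntegrable_iff]
  intro K hK
  have : IsFiniteMeasure ((volume : Measure Plane).restrict K) :=
    ⟨by simpa using hK.measure_lt_top⟩
  exact (f.2.2 K hK).integrable (by norm_num)

/-- Restriction to the fundamental cell. -/
def QP.toCell : QP 𝕜 E τ m →ₗ[𝕜] Lp E 2 ((volume : Measure Plane).restrict (cell τ)) where
  toFun f := (QP.memLp_cell f).toLp _
  map_add' f g := by
    rw [← MemLp.toLp_add]
    exact MemLp.toLp_congr _ _ (ae_restrict_of_ae (AEEqFun.coeFn_add f.1 g.1))
  map_smul' c f := by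
    rw [RingHom.id_apply, ← MemLp.toLp_const_smul]
    exact MemLp.toLp_congr _ _ (ae_restrict_of_ae (AEEqFun.coeFn_smul c f.1))

theorem QP.toCell_injective : Function.Injective (QP.toCell : QP 𝕜 E τ m →ₗ[𝕜] _) := by
  rw [injective_iff_map_eq_zero]
  intro f hf
  have h0 : ∀ᵐ x : Plane, x ∈ cell τ → f.1 x = 0 := by
    apply ae_imp_of_ae_restrict
    have h1 := MemLp.coeFn_toLp (QP.memLp_cell f)
    have h2 : (QP.memLp_cell f).toLp _ = 0 := hf
    rw [h2] at h1
    filter_upwards [h1, Lp.coeFn_zero E 2 ((volume : Measure Plane).restrict (cell τ))]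
      with x h3 h4
    rw [← h3, h4]
    rfl
  have h1 : ∀ᵐ x : Plane, ∀ p q : ℤ, x - latticeVec τ p q ∈ cell τ → f.1 x = 0 := by
    rw [ae_all_iff]
    intro p
    rw [ae_all_iff]
    intro q
    have h2 : ∀ᵐ x : Plane, x ∈ cell τ → f.1 (x + latticeVec τ p q) = 0 := by
      filter_upwards [h0, f.2.1 p q] with x h3 h4 h5
      rw [h4, h3 h5, smul_zero]
    have h3 := (measurePreserving_sub_right (volume : Measure Plane)
        (latticeVec τ p q)).quasiMeasurePreserving.ae h2
    filter_upwards [h3] with x h4 h5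
    simpa using h4 h5
  apply Subtype.ext
  apply AEEqFun.ext
  filter_upwards [h1, AEEqFun.coeFn_zero (α := Plane) (β := E) (μ := volume)] with x h2 h3
  obtain ⟨p, q, hpq⟩ := cell_cover τ x
  rw [h2 p q hpq]
  exact h3.symm

/-- The norm of `L²(Ω)`, with `Ω` the fundamental cell. -/
instance : NormedAddCommGroup (QP 𝕜 E τ m) :=
  NormedAddCommGroup.induced _ _ (QP.toCell : QP 𝕜 E τ m →ₗ[𝕜] _) QP.toCell_injective

/-- The inner product of `L²(Ω)`, with `Ω` the fundamental cell. -/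
instance : InnerProductSpace 𝕜 (QP 𝕜 E τ m) where
  toNormedSpace := NormedSpace.induced 𝕜 _ _ (QP.toCell : QP 𝕜 E τ m →ₗ[𝕜] _)
  inner f g := inner 𝕜 (QP.toCell f) (QP.toCell g)
  norm_sq_eq_re_inner f := norm_sq_eq_re_inner (𝕜 := 𝕜) (QP.toCell f)
  conj_inner_symm f g := inner_conj_symm (𝕜 := 𝕜) (QP.toCell f) (QP.toCell g)
  add_left f g h := by
    rw [map_add, inner_add_left]
  smul_left f g c := by
    rw [map_smul, inner_smul_left]

end Quasiperiodic

section Weak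

variable {E : Type} [NormedAddCommGroup E] [NormedSpace ℝ E]

/-- `g` is the weak (distributional) partial derivative `∂ⱼ f` on the plane. -/
def HasWeakPartial (j : Fin 2) (f g : Plane → E) : Prop :=
  LocallyIntegrable f ∧ LocallyIntegrable g ∧
    ∀ φ : Plane → ℝ, ContDiff ℝ ∞ φ → HasCompactSupport φ →
      ∫ x, fderiv ℝ φ x (coordVec j) • f x = -∫ x, φ x • g x

theorem integrable_test_smul {f : Plane → E} (hf : LocallyIntegrable f) {φ : Plane → ℝ}
    (h : Continuous φ) (hc : HasCompactSupport φ) : Integrable fun x => φ x • f x :=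
  hf.integrable_smul_left_of_hasCompactSupport h hc

theorem continuous_test_fderiv {φ : Plane → ℝ} (h : ContDiff ℝ ∞ φ) (v : Plane) :
    Continuous fun x => fderiv ℝ φ x v :=
  (h.continuous_fderiv (by simp)).clm_apply continuous_const

theorem HasWeakPartial.congr {j : Fin 2} {f g f' g' : Plane → E} (h : HasWeakPartial j f g)
    (hf : f =ᵐ[volume] f') (hg : g =ᵐ[volume] g') : HasWeakPartial j f' g' := by
  refine ⟨h.1.congr hf, h.2.1.congr hg, fun φ h1 h2 => ?_⟩
  have e1 : ∫ x, fderiv ℝ φ x (coordVec j) • f' x = ∫ x, fderiv ℝ φ x (coordVec j) • f x :=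
    integral_congr_ae (by filter_upwards [hf] with x hx; rw [hx])
  have e2 : ∫ x, φ x • g' x = ∫ x, φ x • g x :=
    integral_congr_ae (by filter_upwards [hg] with x hx; rw [hx])
  rw [e1, e2, h.2.2 φ h1 h2]

theorem HasWeakPartial.add {j : Fin 2} {f g f' g' : Plane → E} (h : HasWeakPartial j f g)
    (h' : HasWeakPartial j f' g') : HasWeakPartial j (f + f') (g + g') := by
  refine ⟨h.1.add h'.1, h.2.1.add h'.2.1, fun φ h1 h2 => ?_⟩
  have hd := continuous_test_fderiv h1 (coordVec j)
  have hs : HasCompactSupport fun x => fderiv ℝ φ x (coordVec j) := h2.fderiv_apply ℝ _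
  simp only [Pi.add_apply, smul_add]
  rw [integral_add (integrable_test_smul h.1 hd hs) (integrable_test_smul h'.1 hd hs),
    integral_add (integrable_test_smul h.2.1 h1.continuous h2)
      (integrable_test_smul h'.2.1 h1.continuous h2), h.2.2 φ h1 h2, h'.2.2 φ h1 h2, neg_add]

theorem HasWeakPartial.const_smul {𝕜 : Type} [RCLike 𝕜] [NormedSpace 𝕜 E] [SMulCommClass ℝ 𝕜 E]
    {j : Fin 2} {f g : Plane → E} (c : 𝕜) (h : HasWeakPartial j f g) :
    HasWeakPartial j (c • f) (c • g) := by
  refine ⟨h.1.smul c, h.2.1.smul c, fun φ h1 h2 => ?_⟩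
  simp only [Pi.smul_apply, smul_comm _ c]
  rw [integral_smul, integral_smul, h.2.2 φ h1 h2, smul_neg]

theorem HasWeakPartial.zero {j : Fin 2} : HasWeakPartial j (0 : Plane → E) (0 : Plane → E) :=
  ⟨locallyIntegrable_zero, locallyIntegrable_zero, fun φ _ _ => by simp⟩

end Weak

/-- Index set of the derivatives of order at most two. -/
abbrev JetIdx := Unit ⊕ Fin 2 ⊕ (Fin 2 × Fin 2)

section Sobolev

variable (𝕜 E : Type) [RCLike 𝕜] [NormedAddCommGroup E] [InnerProductSpace 𝕜 E]
  [NormedSpace ℝ E] [SMulCommClass ℝ 𝕜 E]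

theorem weakCov_add {𝕜 E : Type} [RCLike 𝕜] [NormedAddCommGroup E] [InnerProductSpace 𝕜 E]
    [NormedSpace ℝ E] {j : Fin 2} {c : Plane → 𝕜}
    {f g f' g' : Plane →ₘ[(volume : Measure Plane)] E}
    (h : HasWeakPartial j f (fun x => g x + c x • f x))
    (h' : HasWeakPartial j f' (fun x => g' x + c x • f' x)) :
    HasWeakPartial j (f + f' : Plane →ₘ[(volume : Measure Plane)] E)
      (fun x => (g + g') x + c x • (f + f') x) := by
  refine (h.add h').congr (AEEqFun.coeFn_add f f').symm ?_
  filter_upwards [AEEqFun.coeFn_add f f', AEEqFun.coeFn_add g g'] with x h1 h2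
  rw [h1, h2]
  simp only [Pi.add_apply, smul_add]
  abel

theorem weakCov_smul {𝕜 E : Type} [RCLike 𝕜] [NormedAddCommGroup E] [InnerProductSpace 𝕜 E]
    [NormedSpace ℝ E] [SMulCommClass ℝ 𝕜 E] {j : Fin 2} {c : Plane → 𝕜}
    {f g : Plane →ₘ[(volume : Measure Plane)] E} (a : 𝕜)
    (h : HasWeakPartial j f (fun x => g x + c x • f x)) :
    HasWeakPartial j (a • f : Plane →ₘ[(volume : Measure Plane)] E)
      (fun x => (a • g) x + c x • (a • f) x) := by
  refine (h.const_smul a).congr (AEEqFun.coeFn_smul a f).symm ?_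
  filter_upwards [AEEqFun.coeFn_smul a f, AEEqFun.coeFn_smul a g] with x h1 h2
  rw [h1, h2]
  simp only [Pi.smul_apply, smul_add, smul_comm _ a]

theorem weakCov_zero {𝕜 E : Type} [RCLike 𝕜] [NormedAddCommGroup E] [InnerProductSpace 𝕜 E]
    [NormedSpace ℝ E] {j : Fin 2} {c : Plane → 𝕜} :
    HasWeakPartial j (0 : Plane →ₘ[(volume : Measure Plane)] E)
      (fun x => (0 : Plane →ₘ[(volume : Measure Plane)] E) x +
        c x • (0 : Plane →ₘ[(volume : Measure Plane)] E) x) := by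
  refine HasWeakPartial.zero.congr AEEqFun.coeFn_zero.symm ?_
  filter_upwards [AEEqFun.coeFn_zero (α := Plane) (β := E) (μ := volume)] with x h1
  rw [h1]
  simp

/-- The Sobolev space of order two of quasiperiodic functions, for the covariant derivatives
`Dⱼ = ∂ⱼ - cⱼ`. An element is the tuple `(f, Dⱼ f, Dₖ Dⱼ f)` of `f` with its weak covariant
derivatives (which `f` determines), and its norm is the Hilbert norm
`(‖f‖² + ∑ ‖Dⱼ f‖² + ∑ ‖Dₖ Dⱼ f‖²)^(1/2)` with the norms of `L²(Ω)`. -/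
def sobolevJets (τ : UpperHalfPlane) (m : ℤ → ℤ → Plane → 𝕜) (c : Fin 2 → Plane → 𝕜) :
    Submodule 𝕜 (PiLp 2 fun _ : JetIdx => QP 𝕜 E τ m) where
  carrier := {u |
    (∀ j, HasWeakPartial j (u (.inl ())).1
      (fun x => (u (.inr (.inl j))).1 x + c j x • (u (.inl ())).1 x)) ∧
    ∀ k j, HasWeakPartial k (u (.inr (.inl j))).1
      (fun x => (u (.inr (.inr (k, j)))).1 x + c k x • (u (.inr (.inl j))).1 x)}
  add_mem' := by
    rintro u v ⟨h1, h2⟩ ⟨h3, h4⟩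
    exact ⟨fun j => weakCov_add (h1 j) (h3 j), fun k j => weakCov_add (h2 k j) (h4 k j)⟩
  zero_mem' := ⟨fun j => weakCov_zero, fun k j => weakCov_zero⟩
  smul_mem' := by
    rintro a u ⟨h1, h2⟩
    exact ⟨fun j => weakCov_smul a (h1 j), fun k j => weakCov_smul a (h2 k j)⟩

/-- The space `sobolevJets` as a type. -/
def Sobolev2 (τ : UpperHalfPlane) (m : ℤ → ℤ → Plane → 𝕜) (c : Fin 2 → Plane → 𝕜) : Type :=
  ↥(sobolevJets 𝕜 E τ m c)

variable {𝕜 E} {τ : UpperHalfPlane} {m : ℤ → ℤ → Plane → 𝕜} {c : Fin 2 → Plane → 𝕜}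

instance : NormedAddCommGroup (Sobolev2 𝕜 E τ m c) :=
  inferInstanceAs (NormedAddCommGroup ↥(sobolevJets 𝕜 E τ m c))

instance : InnerProductSpace 𝕜 (Sobolev2 𝕜 E τ m c) :=
  inferInstanceAs (InnerProductSpace 𝕜 ↥(sobolevJets 𝕜 E τ m c))

/-- The function `f` itself: the embedding of the Sobolev space into `L²`. -/
def Sobolev2.val : Sobolev2 𝕜 E τ m c →ₗ[𝕜] QP 𝕜 E τ m where
  toFun u := u.1 (.inl ())
  map_add' _ _ := rfl
  map_smul' _ _ := rfl

/-- The first covariant derivative `Dⱼ f`. -/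
def Sobolev2.D (j : Fin 2) : Sobolev2 𝕜 E τ m c →ₗ[𝕜] QP 𝕜 E τ m where
  toFun u := u.1 (.inr (.inl j))
  map_add' _ _ := rfl
  map_smul' _ _ := rfl

/-- The second covariant derivative `Dₖ Dⱼ f`. -/
def Sobolev2.DD (k j : Fin 2) : Sobolev2 𝕜 E τ m c →ₗ[𝕜] QP 𝕜 E τ m where
  toFun u := u.1 (.inr (.inr (k, j)))
  map_add' _ _ := rfl
  map_smul' _ _ := rfl

end Sobolev

/-- The potential `aⁿ(x) = (n/2) J x` of the constant magnetic field `n`. -/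
def bgPotential (n : ℕ) (x : Plane) : Plane := ((n : ℝ) / 2) • J x

/-- The factor `exp (i ((n/2) x · J t + c_t))`, `c_t = π n p q`, for the lattice vector `t` with
coordinates `(p, q)`. -/
def phase (n : ℕ) (τ : UpperHalfPlane) (p q : ℤ) (x : Plane) : ℂ :=
  Complex.exp (Complex.I *
    (((n : ℝ) / 2 * ⟪x, J (latticeVec τ p q)⟫_ℝ + Real.pi * n * p * q : ℝ) : ℂ))

/-- Gauge-periodic locally square integrable functions. -/
abbrev GaugeL2 (n : ℕ) (τ : UpperHalfPlane) := QP ℂ ℂ τ (phase n τ)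

/-- Lattice-periodic locally square integrable vector fields. -/
abbrev PerL2 (τ : UpperHalfPlane) := QP ℝ Plane τ (fun _ _ _ => 1)

/-- Gauge-periodic functions of Sobolev class `H²`, with derivatives `Dⱼ = ∂ⱼ - i aⁿⱼ`. -/
abbrev GaugeH2 (n : ℕ) (τ : UpperHalfPlane) :=
  Sobolev2 ℂ ℂ τ (phase n τ) (fun j x => Complex.I * (bgPotential n x j : ℂ))

/-- Lattice-periodic vector fields of Sobolev class `H²`. -/
abbrev PerH2 (τ : UpperHalfPlane) :=
  Sobolev2 ℝ Plane τ (fun _ _ _ => 1) (fun _ _ => 0)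

/-- The even gauge-periodic `L²` functions. -/
def evenFunctions (n : ℕ) (τ : UpperHalfPlane) : Submodule ℂ (GaugeL2 n τ) where
  carrier := {f | ∀ᵐ x : Plane, f.1 (-x) = f.1 x}
  add_mem' := by
    intro f g hf hg
    have h := AEEqFun.coeFn_add f.1 g.1
    have h' := (Measure.measurePreserving_neg (volume : Measure Plane)).quasiMeasurePreserving.ae h
    change ∀ᵐ x : Plane, (f.1 + g.1) (-x) = (f.1 + g.1) x
    filter_upwards [h, h', hf, hg] with x h1 h2 h3 h4
    rw [h1, h2, Pi.add_apply, Pi.add_apply, h3, h4]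
  zero_mem' := by
    have h := AEEqFun.coeFn_zero (α := Plane) (β := ℂ) (μ := volume)
    have h' := (Measure.measurePreserving_neg (volume : Measure Plane)).quasiMeasurePreserving.ae h
    filter_upwards [h, h'] with x h1 h2
    change (0 : Plane →ₘ[(volume : Measure Plane)] ℂ) (-x) =
      (0 : Plane →ₘ[(volume : Measure Plane)] ℂ) x
    rw [h1, h2]
    rfl
  smul_mem' := by
    intro c f hf
    have h := AEEqFun.coeFn_smul c f.1
    have h' := (Measure.measurePreserving_neg (volume : Measure Plane)).quasiMeasurePreserving.ae h
    change ∀ᵐ x : Plane, (c • f.1) (-x) = (c • f.1) x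
    filter_upwards [h, h', hf] with x h1 h2 h3
    rw [h1, h2, Pi.smul_apply, Pi.smul_apply, h3]

/-- The periodic `L²` vector fields with zero (distributional) divergence and zero mean. -/
def solenoidal (τ : UpperHalfPlane) : Submodule ℝ (PerL2 τ) where
  carrier := {f |
    (∀ φ : Plane → ℝ, ContDiff ℝ ∞ φ → HasCompactSupport φ →
      ∫ x, ∑ j : Fin 2, fderiv ℝ φ x (coordVec j) * f.1 x j = 0) ∧
    ∫ x in cell τ, f.1 x = 0}
  add_mem' := by
    rintro f g ⟨hf, hf2⟩ ⟨hg, hg2⟩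
    have hadd := AEEqFun.coeFn_add f.1 g.1
    constructor
    · intro φ h1 h2
      have hint : ∀ u : PerL2 τ,
          Integrable fun x => ∑ j : Fin 2, fderiv ℝ φ x (coordVec j) * u.1 x j := by
        intro u
        refine integrable_finsetSum _ fun j _ => ?_
        have h3 := integrable_test_smul (QP.locallyIntegrable u)
          (continuous_test_fderiv h1 (coordVec j)) (h2.fderiv_apply ℝ _)
        exact (EuclideanSpace.proj (𝕜 := ℝ) j).integrable_comp h3
      have e : ∫ x, ∑ j : Fin 2, fderiv ℝ φ x (coordVec j) * (f + g).1 x j =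
          ∫ x, ((∑ j : Fin 2, fderiv ℝ φ x (coordVec j) * f.1 x j) +
            ∑ j : Fin 2, fderiv ℝ φ x (coordVec j) * g.1 x j) := by
        refine integral_congr_ae ?_
        filter_upwards [hadd] with x hx
        change ∑ j : Fin 2, fderiv ℝ φ x (coordVec j) * (f.1 + g.1) x j = _
        rw [hx, ← Finset.sum_add_distrib]
        refine Finset.sum_congr rfl fun j _ => ?_
        simp only [Pi.add_apply, PiLp.add_apply]
        ring
      rw [e, integral_add (hint f) (hint g), hf φ h1 h2, hg φ h1 h2, add_zero]
    · have e : ∫ x in cell τ, (f + g).1 x = ∫ x in cell τ, (f.1 x + g.1 x) :=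
        integral_congr_ae (ae_restrict_of_ae hadd)
      rw [e, integral_add (QP.integrableOn_cell f) (QP.integrableOn_cell g), hf2, hg2, add_zero]
  zero_mem' := by
    have h0 := AEEqFun.coeFn_zero (α := Plane) (β := Plane) (μ := volume)
    constructor
    · intro φ _ _
      refine integral_eq_zero_of_ae ?_
      filter_upwards [h0] with x hx
      change ∑ j : Fin 2, fderiv ℝ φ x (coordVec j) *
        (0 : Plane →ₘ[(volume : Measure Plane)] Plane) x j = 0
      rw [hx]
      simp
    · exact integral_eq_zero_of_ae (ae_restrict_of_ae h0)
  smul_mem' := by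
    rintro c f ⟨hf, hf2⟩
    have hs := AEEqFun.coeFn_smul c f.1
    constructor
    · intro φ h1 h2
      have e : ∫ x, ∑ j : Fin 2, fderiv ℝ φ x (coordVec j) * (c • f).1 x j =
          ∫ x, c * ∑ j : Fin 2, fderiv ℝ φ x (coordVec j) * f.1 x j := by
        refine integral_congr_ae ?_
        filter_upwards [hs] with x hx
        change ∑ j : Fin 2, fderiv ℝ φ x (coordVec j) * (c • f.1) x j = _
        rw [hx, Finset.mul_sum]
        refine Finset.sum_congr rfl fun j _ => ?_
        simp only [Pi.smul_apply, PiLp.smul_apply, smul_eq_mul]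
        ring
      rw [e, integral_const_mul, hf φ h1 h2, mul_zero]
    · have e : ∫ x in cell τ, (c • f).1 x = ∫ x in cell τ, c • f.1 x :=
        integral_congr_ae (ae_restrict_of_ae hs)
      rw [e, integral_smul, hf2, smul_zero]

/-- The odd periodic vector fields. -/
def oddFields (τ : UpperHalfPlane) : Submodule ℝ (PerL2 τ) where
  carrier := {f | ∀ᵐ x : Plane, f.1 (-x) = -f.1 x}
  add_mem' := by
    intro f g hf hg
    have h := AEEqFun.coeFn_add f.1 g.1
    have h' := (Measure.measurePreserving_neg (volume : Measure Plane)).quasiMeasurePreserving.ae h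
    change ∀ᵐ x : Plane, (f.1 + g.1) (-x) = -(f.1 + g.1) x
    filter_upwards [h, h', hf, hg] with x h1 h2 h3 h4
    rw [h1, h2, Pi.add_apply, Pi.add_apply, h3, h4, neg_add]
  zero_mem' := by
    have h := AEEqFun.coeFn_zero (α := Plane) (β := Plane) (μ := volume)
    have h' := (Measure.measurePreserving_neg (volume : Measure Plane)).quasiMeasurePreserving.ae h
    filter_upwards [h, h'] with x h1 h2
    change (0 : Plane →ₘ[(volume : Measure Plane)] Plane) (-x) =
      -(0 : Plane →ₘ[(volume : Measure Plane)] Plane) x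
    rw [h1, h2]
    simp
  smul_mem' := by
    intro c f hf
    have h := AEEqFun.coeFn_smul c f.1
    have h' := (Measure.measurePreserving_neg (volume : Measure Plane)).quasiMeasurePreserving.ae h
    change ∀ᵐ x : Plane, (c • f.1) (-x) = -(c • f.1) x
    filter_upwards [h, h', hf] with x h1 h2 h3
    rw [h1, h2, Pi.smul_apply, Pi.smul_apply, h3, smul_neg]

/-- The even gauge-periodic `L²` functions, as a type. -/
def L2psi (n : ℕ) (τ : UpperHalfPlane) : Type := ↥(evenFunctions n τ)

/-- The odd, periodic, divergence free, mean zero `L²` vector fields. -/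
def L2alpha (τ : UpperHalfPlane) : Type := ↥(solenoidal τ ⊓ oddFields τ)

/-- The even gauge-periodic functions of class `H²`. -/
def H2psi (n : ℕ) (τ : UpperHalfPlane) : Type :=
  ↥((evenFunctions n τ).comap (Sobolev2.val : GaugeH2 n τ →ₗ[ℂ] GaugeL2 n τ))

/-- The odd, periodic, divergence free, mean zero vector fields of class `H²`. -/
def H2alpha (τ : UpperHalfPlane) : Type :=
  ↥((solenoidal τ ⊓ oddFields τ).comap (Sobolev2.val : PerH2 τ →ₗ[ℝ] PerL2 τ))

section Instances

variable {n : ℕ} {τ : UpperHalfPlane}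

instance : NormedAddCommGroup (L2psi n τ) :=
  inferInstanceAs (NormedAddCommGroup ↥(evenFunctions n τ))

instance : InnerProductSpace ℂ (L2psi n τ) :=
  inferInstanceAs (InnerProductSpace ℂ ↥(evenFunctions n τ))

instance : NormedAddCommGroup (L2alpha τ) :=
  inferInstanceAs (NormedAddCommGroup ↥(solenoidal τ ⊓ oddFields τ))

instance : InnerProductSpace ℝ (L2alpha τ) :=
  inferInstanceAs (InnerProductSpace ℝ ↥(solenoidal τ ⊓ oddFields τ))

instance : NormedAddCommGroup (H2psi n τ) :=
  inferInstanceAs (NormedAddCommGroup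
    ↥((evenFunctions n τ).comap (Sobolev2.val : GaugeH2 n τ →ₗ[ℂ] GaugeL2 n τ)))

instance : InnerProductSpace ℂ (H2psi n τ) :=
  inferInstanceAs (InnerProductSpace ℂ
    ↥((evenFunctions n τ).comap (Sobolev2.val : GaugeH2 n τ →ₗ[ℂ] GaugeL2 n τ)))

instance : NormedAddCommGroup (H2alpha τ) :=
  inferInstanceAs (NormedAddCommGroup
    ↥((solenoidal τ ⊓ oddFields τ).comap (Sobolev2.val : PerH2 τ →ₗ[ℝ] PerL2 τ)))

instance : InnerProductSpace ℝ (H2alpha τ) :=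
  inferInstanceAs (InnerProductSpace ℝ
    ↥((solenoidal τ ⊓ oddFields τ).comap (Sobolev2.val : PerH2 τ →ₗ[ℝ] PerL2 τ)))

end Instances

section Equations

variable {n : ℕ} {τ : UpperHalfPlane}

/-- The inclusion of `H2psi` in `L2psi`. -/
def inclPsi : H2psi n τ →ₗ[ℂ] L2psi n τ where
  toFun ψ := ⟨Sobolev2.val ψ.1, ψ.2⟩
  map_add' _ _ := rfl
  map_smul' _ _ := rfl

/-- The inclusion of `H2alpha` in `L2alpha`. -/
def inclAlpha : H2alpha τ →ₗ[ℝ] L2alpha τ where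
  toFun α := ⟨Sobolev2.val α.1, α.2⟩
  map_add' _ _ := rfl
  map_smul' _ _ := rfl

/-- A representative of `ψ`. -/
def psiFun (ψ : H2psi n τ) : Plane → ℂ := (Sobolev2.val ψ.1).1

/-- A representative of the covariant derivative `(∂ⱼ - i aⁿⱼ) ψ`. -/
def covFun (ψ : H2psi n τ) (j : Fin 2) : Plane → ℂ := (Sobolev2.D j ψ.1).1

/-- A representative of `α`. -/
def alphaFun (α : H2alpha τ) : Plane → Plane := (Sobolev2.val α.1).1

/-- The linear map that sends `ψ` in `H2psi` to itself with its weak derivatives. -/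
def jetPsi : H2psi n τ →ₗ[ℂ] GaugeH2 n τ where
  toFun ψ := ψ.1
  map_add' _ _ := rfl
  map_smul' _ _ := rfl

/-- The magnetic Laplacian `Lⁿ = -∑ⱼ (∂ⱼ - i aⁿⱼ)²`. -/
def landau (n : ℕ) (τ : UpperHalfPlane) : H2psi n τ →ₗ[ℂ] GaugeL2 n τ :=
  -(Sobolev2.DD 0 0 + Sobolev2.DD 1 1) ∘ₗ jetPsi

/-- The null space of `Lⁿ - n` in `H2psi n τ`. -/
def landauNull (n : ℕ) (τ : UpperHalfPlane) : Submodule ℂ (H2psi n τ) :=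
  LinearMap.ker (landau n τ - (n : ℂ) • (Sobolev2.val ∘ₗ jetPsi))

/-- `M α = curl* curl α`, with `curl α = ∂₁ α₂ - ∂₂ α₁` and `curl* f = (∂₂ f, -∂₁ f)`. -/
def curlCurl (α : H2alpha τ) (x : Plane) : Plane :=
  !₂[(Sobolev2.DD 1 0 α.1).1 x 1 - (Sobolev2.DD 1 1 α.1).1 x 0,
    -((Sobolev2.DD 0 0 α.1).1 x 1 - (Sobolev2.DD 0 1 α.1).1 x 0)]

/-- `h(ψ, α) = 2 i α · ∇_{aⁿ} ψ + |α|² ψ + κ² |ψ|² ψ`. -/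
def hTerm (κ : ℝ) (ψ : H2psi n τ) (α : H2alpha τ) (x : Plane) : ℂ :=
  2 * Complex.I * ∑ j : Fin 2, (alphaFun α x j : ℂ) * covFun ψ j x
    + ((‖alphaFun α x‖ ^ 2 : ℝ) : ℂ) * psiFun ψ x
    + ((κ ^ 2 * ‖psiFun ψ x‖ ^ 2 : ℝ) : ℂ) * psiFun ψ x

/-- The current `J(ψ, α) = Im (ψ̄ ∇_{aⁿ + α} ψ)`. -/
def current (ψ : H2psi n τ) (α : H2alpha τ) (x : Plane) : Plane :=
  WithLp.toLp 2 fun j : Fin 2 =>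
    (conj (psiFun ψ x) * (covFun ψ j x - Complex.I * (alphaFun α x j : ℂ) * psiFun ψ x)).im

/-- `P` is the orthogonal projection in `L²(Ω)` of the vector field `v` onto the divergence free,
mean zero fields. -/
def IsProjection (v : Plane → Plane) (P : PerL2 τ) : Prop :=
  MemLp v 2 (volume.restrict (cell τ)) ∧ P ∈ solenoidal τ ∧
    ∀ w ∈ solenoidal τ, ∫ x in cell τ, ⟪v x - P.1 x, w.1 x⟫_ℝ = 0

/-- `(y, z) = F(lam, ψ, α) = ((Lⁿ - lam) ψ + h(ψ, α), M α - P' J(ψ, α))`. -/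
def IsFValue (κ lam : ℝ) (ψ : H2psi n τ) (α : H2alpha τ) (y : L2psi n τ) (z : L2alpha τ) : Prop :=
  (∀ᵐ x : Plane, y.1.1 x = (landau n τ ψ).1 x - (lam : ℂ) * psiFun ψ x + hTerm κ ψ α x) ∧
  ∃ P : PerL2 τ, IsProjection (current ψ α) P ∧ ∀ᵐ x : Plane, z.1.1 x = curlCurl α x - P.1 x

/-- `X = X' × X''` and `Y = Y' × Y''` are closed subspaces of the `H²` and of the `L²` spaces,
`X ⊆ Y` densely, and `F` maps `ℝ × X` to `Y` and is of class `C²`. -/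
structure XYCondition (κ : ℝ) (n : ℕ) (τ : UpperHalfPlane)
    (X' : Submodule ℂ (H2psi n τ)) (X'' : Submodule ℝ (H2alpha τ))
    (Y' : Submodule ℂ (L2psi n τ)) (Y'' : Submodule ℝ (L2alpha τ)) : Prop where
  closed_X' : IsClosed (X' : Set (H2psi n τ))
  closed_X'' : IsClosed (X'' : Set (H2alpha τ))
  closed_Y' : IsClosed (Y' : Set (L2psi n τ))
  closed_Y'' : IsClosed (Y'' : Set (L2alpha τ))
  subset' : ∀ ψ ∈ X', inclPsi ψ ∈ Y'
  subset'' : ∀ α ∈ X'', inclAlpha α ∈ Y''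
  dense' : (Y' : Set (L2psi n τ)) ⊆ closure (inclPsi '' (X' : Set (H2psi n τ)))
  dense'' : (Y'' : Set (L2alpha τ)) ⊆ closure (inclAlpha '' (X'' : Set (H2alpha τ)))
  map_C2 : ∃ F : ℝ × X' × X'' → Y' × Y'', ContDiff ℝ 2 F ∧
    ∀ (lam : ℝ) (ψ : X') (α : X''),
      IsFValue κ lam ψ.1 α.1 (F (lam, ψ, α)).1.1 (F (lam, ψ, α)).2.1

/-- `Lⁿ` with domain `X'` is a self-adjoint operator in `Y'`: the graph of its adjoint,
`{(y, w) | ∀ ψ ∈ X', ⟪Lⁿ ψ, y⟫ = ⟪ψ, w⟫}`, is its own graph. -/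
def LandauSelfAdjoint (X' : Submodule ℂ (H2psi n τ)) (Y' : Submodule ℂ (L2psi n τ)) : Prop :=
  ∀ y ∈ Y', ∀ w ∈ Y',
    (∀ ψ ∈ X', ⟪landau n τ ψ, y.1⟫_ℂ = ⟪(inclPsi ψ).1, w.1⟫_ℂ) ↔
      ∃ ψ ∈ X', inclPsi ψ = y ∧ landau n τ ψ = w.1

/-- `M = curl* curl` with domain `X''` is a self-adjoint operator in `Y''`. -/
def CurlCurlSelfAdjoint (X'' : Submodule ℝ (H2alpha τ)) (Y'' : Submodule ℝ (L2alpha τ)) : Prop :=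
  ∀ y ∈ Y'', ∀ w ∈ Y'',
    (∀ α ∈ X'', ∫ x in cell τ, ⟪curlCurl α x, y.1.1 x⟫_ℝ = ⟪(inclAlpha α).1, w.1⟫_ℝ) ↔
      ∃ α ∈ X'', inclAlpha α = y ∧ curlCurl α =ᵐ[volume] w.1.1

end Equations

/-- The rescaled Ginzburg-Landau equations on the plane,
`(-Δ_a - lam) ψ = -κ² |ψ|² ψ` and `curl* curl a = Im (ψ̄ ∇_a ψ)`,
with `∇_a = ∇ - i a`, `Δ_a = ∑ⱼ (∂ⱼ - i aⱼ)²` and all derivatives in the weak sense: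
`d j = (∂ⱼ - i aⱼ) ψ`, `dd j = (∂ⱼ - i aⱼ)² ψ`, `G j = ∂ⱼ a`. -/
def IsGLSolution (κ lam : ℝ) (ψ : Plane → ℂ) (a : Plane → Plane) : Prop :=
  ∃ (d dd : Fin 2 → Plane → ℂ) (G : Fin 2 → Plane → Plane),
    (∀ j, HasWeakPartial j ψ (fun x => d j x + Complex.I * (a x j : ℂ) * ψ x)) ∧
    (∀ j, HasWeakPartial j (d j) (fun x => dd j x + Complex.I * (a x j : ℂ) * d j x)) ∧
    (∀ j, HasWeakPartial j a (G j)) ∧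
    (∀ᵐ x : Plane, -(dd 0 x + dd 1 x) - (lam : ℂ) * ψ x =
      -((κ ^ 2 * ‖ψ x‖ ^ 2 : ℝ) : ℂ) * ψ x) ∧
    HasWeakPartial 1 (fun x => G 0 x 1 - G 1 x 0) (fun x => (conj (ψ x) * d 0 x).im) ∧
    HasWeakPartial 0 (fun x => G 0 x 1 - G 1 x 0) (fun x => -(conj (ψ x) * d 1 x).im)

/-- The state with order parameter `ψ` and potential `aⁿ + α` solves the rescaled
Ginzburg-Landau equations. -/
def SolvesGL {n : ℕ} {τ : UpperHalfPlane} (κ lam : ℝ) (ψ : H2psi n τ) (α : H2alpha τ) : Prop :=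
  IsGLSolution κ lam (psiFun ψ) (fun x => bgPotential n x + alphaFun α x)

end GinzburgLandau

end

/-! Write λ = n + μ and split F into the linear parts A = Lⁿ - n and M, the terms H(ψ, α) that
contain α, the cubic term C(ψ) and the projected current K(ψ, α). H is complex linear in ψ and
vanishes at α = 0, while C(cψ) = |c|² c C(ψ) and K(cψ, α) = |c|² K(ψ, α). Hence at ψ = z(ψ₀ + w), z
≠ 0, the factor z cancels and only t = |z|² survives: with u = ψ₀ + w the equations are A u - μ u +
H(u, α) + t C(u) = 0 and M α = t K(u, α). With w orthogonal to ψ₀ and t treated as an independent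
variable, the solution branch comes from the analytic inverse function theorem at the origin
(`BifurcationData.blowUp`, `BifurcationData.bifurcation`).

The kernel and cokernel of A are complex lines but μ is a single real parameter. A second real
parameter ν, multiplying iψ₀, makes the derivative bijective. It vanishes at every solution: paired
with u, each term of the equation is real, since Lⁿ is symmetric, |α|² and |ψ|² are real
multipliers, and α · ∇ is antisymmetric when div α = 0 (`gauge_condition`). This is how the gauge
symmetry enters.

The range of A is found without compactness arguments. With Q = D₀ + iD₁ one has A = Q*Q, and the
constant commutator of D₀ and D₁ gives A² ≥ 2nA (`laplacian_gap`). A self-adjoint operator with this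
gap and a one-dimensional kernel has the orthogonal complement of the kernel as its range
(`IsGraphSelfAdjoint.exists_of_gap`). On divergence free fields M is minus the Laplacian, so the
Poincaré inequality (`poincare_inequality`) and self-adjointness make it bijective (`bijective_M`).

F is assumed to be C² only, yet the branch is analytic. By homogeneity every part of F is a linear
combination of values of F (`exists_decomposition`), hence continuous with values in Y',
respectively Y''. The nonlinear parts are moreover polynomials of degree at most three in the sense
of Fréchet, and continuous polynomials are analytic (`IsPolyDeg.analyticAt_three`). No Sobolev
embedding is needed.

Zeros of F are exactly the solutions of the Ginzburg–Landau equations (`solvesGL_iff_isSol`): the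
first equation makes the current divergence free, parity makes its mean zero, and so the projection
P' acts trivially on it.

For uniqueness, strict differentiability gives ‖Aψ‖ ≤ η‖ψ‖ for solutions near the trivial branch.
Thus either ψ = 0 or ψ = z(ψ₀ + w) with w small, and injectivity of the local inverse puts the
solution on the branch; |z| is s and arg z is δ. -/

noncomputable section

namespace GinzburgLandau

/-! ### The lattice, its fundamental cell and integrals of periodic functions. -/

section Lattice

variable (τ : UpperHalfPlane)

theorem lattice_scale_pos : 0 < √(2 * Real.pi / τ.im) :=
  Real.sqrt_pos.2 (by have := τ.im_pos; positivity)

/-- The second coordinate of a point in the basis of the lattice. -/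
def latticeCoord₁ (x : Plane) : ℝ := x 1 / (√(2 * Real.pi / τ.im) * τ.im)

/-- The first coordinate of a point in the basis of the lattice. -/
def latticeCoord₀ (x : Plane) : ℝ := x 0 / √(2 * Real.pi / τ.im) - latticeCoord₁ τ x * τ.re

theorem latticeCoord₁_latticePoint (s t : ℝ) : latticeCoord₁ τ (latticePoint τ s t) = t := by
  have h1 := (lattice_scale_pos τ).ne'
  have h2 := τ.im_pos.ne'
  simp only [latticeCoord₁, latticePoint, PiLp.smul_apply, smul_eq_mul]
  simp
  field_simp

theorem latticeCoord₀_latticePoint (s t : ℝ) : latticeCoord₀ τ (latticePoint τ s t) = s := by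
  have h1 := (lattice_scale_pos τ).ne'
  rw [latticeCoord₀, latticeCoord₁_latticePoint]
  simp only [latticePoint, PiLp.smul_apply, smul_eq_mul]
  simp
  field_simp
  ring

theorem latticePoint_latticeCoord (x : Plane) :
    latticePoint τ (latticeCoord₀ τ x) (latticeCoord₁ τ x) = x := by
  have h1 := (lattice_scale_pos τ).ne'
  have h2 := τ.im_pos.ne'
  ext i
  fin_cases i
  · simp [latticePoint, latticeCoord₀]
    field_simp
  · simp [latticePoint, latticeCoord₁]
    field_simp

theorem continuous_latticeCoord₁ : Continuous (latticeCoord₁ τ) := by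
  unfold latticeCoord₁
  fun_prop

theorem continuous_latticeCoord₀ : Continuous (latticeCoord₀ τ) := by
  have := continuous_latticeCoord₁ τ
  unfold latticeCoord₀
  fun_prop

theorem cell_eq : cell τ = {x | latticeCoord₀ τ x ∈ Ico (-(1 / 2) : ℝ) (1 / 2) ∧
    latticeCoord₁ τ x ∈ Ico (-(1 / 2) : ℝ) (1 / 2)} := by
  ext x
  constructor
  · rintro ⟨s, hs, t, ht, rfl⟩
    exact ⟨by rwa [latticeCoord₀_latticePoint], by rwa [latticeCoord₁_latticePoint]⟩
  · rintro ⟨h0, h1⟩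
    exact ⟨_, h0, _, h1, (latticePoint_latticeCoord τ x).symm⟩

theorem measurableSet_cell : MeasurableSet (cell τ) := by
  rw [cell_eq]
  exact ((continuous_latticeCoord₀ τ).measurable measurableSet_Ico).inter
    ((continuous_latticeCoord₁ τ).measurable measurableSet_Ico)

theorem latticePoint_add (s t s' t' : ℝ) :
    latticePoint τ (s + s') (t + t') = latticePoint τ s t + latticePoint τ s' t' := by
  ext i
  fin_cases i
  · simp [latticePoint]
    ring
  · simp [latticePoint]
    ring

/-- The lattice as the image of `ℤ × ℤ`. -/
def latticeHom : ℤ × ℤ →+ Plane where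
  toFun z := latticeVec τ z.1 z.2
  map_zero' := by
    ext i
    fin_cases i <;> simp [latticeVec, latticePoint]
  map_add' z w := by
    simp only [latticeVec, Prod.fst_add, Prod.snd_add, Int.cast_add]
    exact latticePoint_add τ _ _ _ _

/-- The normalized lattice as an additive group. -/
def lattice : AddSubgroup Plane := (latticeHom τ).range

instance : Countable (lattice τ) :=
  Function.Surjective.countable (latticeHom τ).rangeRestrict_surjective

/-- Two numbers in [-1/2, 1/2) that differ by an integer are equal, so the half-open cell meets
every orbit exactly once; existence is `cell_cover`. -/
theorem isAddFundamentalDomain_cell :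
    IsAddFundamentalDomain (lattice τ) (cell τ) (volume : Measure Plane) := by
  refine IsAddFundamentalDomain.mk' (measurableSet_cell τ).nullMeasurableSet fun x => ?_
  obtain ⟨p, q, hpq⟩ := cell_cover τ x
  refine ⟨-⟨latticeVec τ p q, ⟨(p, q), rfl⟩⟩, ?_, ?_⟩
  · change -latticeVec τ p q + x ∈ cell τ
    rwa [neg_add_eq_sub]
  · rintro ⟨_, ⟨⟨p', q'⟩, rfl⟩⟩ h
    change latticeVec τ p' q' + x ∈ cell τ at h
    apply Subtype.ext
    change latticeVec τ p' q' = -latticeVec τ p q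
    set u := x - latticeVec τ p q with hu
    have hx : latticeVec τ p' q' + x = u + latticeVec τ (p + p') (q + q') := by
      have : latticeVec τ (p + p') (q + q') = latticeVec τ p q + latticeVec τ p' q' :=
        (latticeHom τ).map_add (p, q) (p', q')
      rw [this, hu]
      abel
    rw [hx] at h
    obtain ⟨s, hs, t, ht, hst⟩ := hpq
    obtain ⟨s', hs', t', ht', hst'⟩ := h
    rw [hst, latticeVec, ← latticePoint_add] at hst'
    have e1 := congrArg (latticeCoord₁ τ) hst'
    have e0 := congrArg (latticeCoord₀ τ) hst'
    rw [latticeCoord₁_latticePoint, latticeCoord₁_latticePoint] at e1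
    rw [latticeCoord₀_latticePoint, latticeCoord₀_latticePoint] at e0
    have z : ∀ (a b : ℝ) (k : ℤ), a ∈ Ico (-(1 / 2) : ℝ) (1 / 2) → b ∈ Ico (-(1 / 2) : ℝ) (1 / 2) →
        a + k = b → k = 0 := by
      intro a b k ha hb hab
      have h1 : (k : ℝ) < 1 := by linarith [ha.1, hb.2]
      have h2 : (-1 : ℝ) < k := by linarith [ha.2, hb.1]
      have h3 : k < 1 := by exact_mod_cast h1
      have h4 : -1 < k := by exact_mod_cast h2
      omega
    have k0 := z _ _ _ hs hs' e0
    have k1 := z _ _ _ ht ht' e1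
    have : (p', q') = -(p, q) := by
      ext <;> simp <;> omega
    exact (congrArg (latticeHom τ) this).trans ((latticeHom τ).map_neg (p, q))

theorem isAddFundamentalDomain_preimage_add (y : Plane) :
    IsAddFundamentalDomain (lattice τ) ((fun x => x + y) ⁻¹' cell τ) (volume : Measure Plane) := by
  refine (isAddFundamentalDomain_cell τ).preimage_of_equiv
    (measurePreserving_add_right volume y).quasiMeasurePreserving (e := id) Function.bijective_id ?_
  intro g x
  change (g : Plane) + x + y = g + (x + y)
  rw [add_assoc]

theorem isAddFundamentalDomain_preimage_neg :
    IsAddFundamentalDomain (lattice τ) ((fun x => -x) ⁻¹' cell τ) (volume : Measure Plane) := by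
  refine (isAddFundamentalDomain_cell τ).preimage_of_equiv
    (Measure.measurePreserving_neg volume).quasiMeasurePreserving (e := fun g => -g)
    neg_involutive.bijective ?_
  intro g x
  change -((-g : lattice τ) + x : Plane) = g + -x
  simp [add_comm]

/-- Almost everywhere periodicity. -/
def IsPeriodic {β : Type*} (f : Plane → β) : Prop :=
  ∀ p q : ℤ, ∀ᵐ x : Plane, f (x + latticeVec τ p q) = f x

variable {τ}

/-- The lattice is countable, so the points where f is invariant under all translations form a
conull set `S`, which is itself lattice invariant. Cutting f off outside `S` gives a strictly
invariant representative, as the theorems on fundamental domains require. -/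
theorem IsPeriodic.exists_strict {β : Type*} [Zero β] {f : Plane → β} (hf : IsPeriodic τ f) :
    ∃ g : Plane → β, f =ᵐ[volume] g ∧ ∀ (t : lattice τ) (x : Plane), g (t +ᵥ x) = g x := by
  classical
  let S : Set Plane := {x | ∀ t : lattice τ, f (x + t) = f x}
  have hS : ∀ᵐ x : Plane, x ∈ S := by
    have : ∀ᵐ x : Plane, ∀ t : lattice τ, f (x + t) = f x := by
      rw [ae_all_iff]
      rintro ⟨_, ⟨⟨p, q⟩, rfl⟩⟩
      exact hf p q
    exact this
  have hinv : ∀ (t : lattice τ) (x : Plane), x ∈ S → (t : Plane) + x ∈ S := by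
    intro t x hx u
    have h1 := hx (t + u)
    have h2 := hx t
    rw [AddSubgroup.coe_add, ← add_assoc] at h1
    rw [add_comm (t : Plane) x, h1, h2]
  refine ⟨S.indicator f, ?_, fun t x => ?_⟩
  · filter_upwards [hS] with x hx
    rw [indicator_of_mem hx]
  · change S.indicator f ((t : Plane) + x) = _
    by_cases hx : x ∈ S
    · rw [indicator_of_mem hx, indicator_of_mem (hinv t x hx), add_comm]
      exact hx t
    · rw [indicator_of_notMem hx, indicator_of_notMem]
      intro h
      apply hx
      have := hinv (-t) _ h
      simpa using this

theorem IsPeriodic.setIntegral_eq {E : Type*} [NormedAddCommGroup E] [NormedSpace ℝ E]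
    {f : Plane → E} (hf : IsPeriodic τ f) {s : Set Plane}
    (hs : IsAddFundamentalDomain (lattice τ) s (volume : Measure Plane)) :
    ∫ x in s, f x = ∫ x in cell τ, f x := by
  obtain ⟨g, hg, hg'⟩ := hf.exists_strict
  rw [setIntegral_congr_ae₀ hs.nullMeasurableSet (hg.mono fun x hx _ => hx),
    setIntegral_congr_ae (measurableSet_cell τ) (hg.mono fun x hx _ => hx)]
  exact hs.setIntegral_eq (isAddFundamentalDomain_cell τ) hg'

theorem IsPeriodic.setLIntegral_eq {f : Plane → ENNReal} (hf : IsPeriodic τ f) {s : Set Plane}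
    (hs : IsAddFundamentalDomain (lattice τ) s (volume : Measure Plane)) :
    ∫⁻ x in s, f x = ∫⁻ x in cell τ, f x := by
  obtain ⟨g, hg, hg'⟩ := hf.exists_strict
  rw [lintegral_congr_ae (ae_restrict_of_ae hg),
    lintegral_congr_ae (μ := volume.restrict (cell τ)) (ae_restrict_of_ae hg)]
  exact hs.setLIntegral_eq (isAddFundamentalDomain_cell τ) g hg'

/-- A translate of the cell is again a fundamental domain. -/
theorem IsPeriodic.setIntegral_add_right {E : Type*} [NormedAddCommGroup E] [NormedSpace ℝ E]
    {f : Plane → E} (hf : IsPeriodic τ f) (y : Plane) :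
    ∫ x in cell τ, f (x + y) = ∫ x in cell τ, f x := by
  have h := (measurePreserving_add_right volume y).setIntegral_preimage_emb
    (MeasurableEquiv.addRight y).measurableEmbedding f ((fun x => x - y) ⁻¹' cell τ)
  have e : (fun x => x + y) ⁻¹' ((fun x => x - y) ⁻¹' cell τ) = cell τ := by
    ext x
    simp
  rw [e] at h
  rw [h]
  have := isAddFundamentalDomain_preimage_add τ (-y)
  simp only [← sub_eq_add_neg] at this
  exact hf.setIntegral_eq this

theorem IsPeriodic.setIntegral_neg {E : Type*} [NormedAddCommGroup E] [NormedSpace ℝ E]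
    {f : Plane → E} (hf : IsPeriodic τ f) :
    ∫ x in cell τ, f (-x) = ∫ x in cell τ, f x := by
  have h := (Measure.measurePreserving_neg (volume : Measure Plane)).setIntegral_preimage_emb
    (MeasurableEquiv.neg Plane).measurableEmbedding f ((fun x => -x) ⁻¹' cell τ)
  have e : (fun x : Plane => -x) ⁻¹' ((fun x => -x) ⁻¹' cell τ) = cell τ := by
    ext x
    simp
  rw [show Neg.neg ⁻¹' ((fun x : Plane => -x) ⁻¹' cell τ) = cell τ from e] at h
  rw [h]
  exact hf.setIntegral_eq (isAddFundamentalDomain_preimage_neg τ)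

variable (τ)

/-- A compact set meets only finitely many translates of the fundamental cell. -/
theorem exists_finset_cover {K : Set Plane} (hK : IsCompact K) :
    ∃ A : Finset (ℤ × ℤ), ∀ x ∈ K, ∃ z ∈ A, x + latticeVec τ z.1 z.2 ∈ cell τ := by
  obtain ⟨b0, hb0⟩ := (hK.image (continuous_latticeCoord₀ τ)).isBounded.exists_norm_le
  obtain ⟨b1, hb1⟩ := (hK.image (continuous_latticeCoord₁ τ)).isBounded.exists_norm_le
  obtain ⟨N, hN⟩ := exists_nat_ge (max b0 b1 + 1)
  refine ⟨Finset.Icc (-N : ℤ) N ×ˢ Finset.Icc (-N : ℤ) N, fun x hx => ?_⟩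
  obtain ⟨p, q, s, hs, t, ht, hst⟩ := cell_cover τ x
  have hx' : x = latticePoint τ (s + p) (t + q) := by
    rw [latticePoint_add, ← hst]
    simp [latticeVec]
  have h0 := hb0 _ (mem_image_of_mem _ hx)
  have h1 := hb1 _ (mem_image_of_mem _ hx)
  rw [hx', latticeCoord₀_latticePoint, Real.norm_eq_abs, abs_le] at h0
  rw [hx', latticeCoord₁_latticePoint, Real.norm_eq_abs, abs_le] at h1
  have m0 := le_max_left b0 b1
  have m1 := le_max_right b0 b1
  refine ⟨(-p, -q), ?_, ?_⟩
  · have a1 : (-(N : ℝ)) ≤ p := by linarith [hs.1, hs.2]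
    have a2 : (p : ℝ) ≤ N := by linarith [hs.1, hs.2]
    have a3 : (-(N : ℝ)) ≤ q := by linarith [ht.1, ht.2]
    have a4 : (q : ℝ) ≤ N := by linarith [ht.1, ht.2]
    have a1 : -(N : ℤ) ≤ p := by exact_mod_cast a1
    have a2 : p ≤ N := by exact_mod_cast a2
    have a3 : -(N : ℤ) ≤ q := by exact_mod_cast a3
    have a4 : q ≤ N := by exact_mod_cast a4
    simp only [Finset.mem_product, Finset.mem_Icc]
    omega
  · have : latticeVec τ (-p) (-q) = -latticeVec τ p q := (latticeHom τ).map_neg (p, q)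
    change x + latticeVec τ (-p) (-q) ∈ _
    rw [this, ← sub_eq_add_neg, hst]
    exact ⟨s, hs, t, ht, rfl⟩

/-- The integral of a nonnegative periodic function over a compact set is at most a multiple of its
integral over the fundamental cell. -/
theorem exists_setLIntegral_le {K : Set Plane} (hK : IsCompact K) :
    ∃ N : ℕ, ∀ f : Plane → ENNReal, IsPeriodic τ f →
      ∫⁻ x in K, f x ≤ N * ∫⁻ x in cell τ, f x := by
  obtain ⟨A, hA⟩ := exists_finset_cover τ hK
  refine ⟨A.card, fun f hf => ?_⟩
  calc ∫⁻ x in K, f x ≤ ∫⁻ x in ⋃ z : A, (fun x => x + latticeVec τ z.1.1 z.1.2) ⁻¹' cell τ, f x := by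
        refine lintegral_mono_set fun x hx => ?_
        obtain ⟨z, hz, h⟩ := hA x hx
        exact mem_iUnion_of_mem ⟨z, hz⟩ h
    _ ≤ ∑ z ∈ A, ∫⁻ x in (fun x => x + latticeVec τ z.1 z.2) ⁻¹' cell τ, f x := by
        refine (lintegral_iUnion_le _ _).trans (le_of_eq ?_)
        exact Finset.tsum_subtype A fun z : ℤ × ℤ =>
          ∫⁻ x in (fun x => x + latticeVec τ z.1 z.2) ⁻¹' cell τ, f x
    _ = ∑ z ∈ A, ∫⁻ x in cell τ, f x :=
        Finset.sum_congr rfl fun z _ =>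
          hf.setLIntegral_eq (isAddFundamentalDomain_preimage_add τ _)
    _ = A.card * ∫⁻ x in cell τ, f x := by
        rw [Finset.sum_const, nsmul_eq_mul]

theorem volume_cell_lt_top : volume (cell τ) < ⊤ := by
  obtain ⟨K, hK, h⟩ := cell_subset_ball τ
  exact (measure_mono h).trans_lt hK.measure_lt_top

instance : IsFiniteMeasure ((volume : Measure Plane).restrict (cell τ)) :=
  ⟨by simpa using volume_cell_lt_top τ⟩

end Lattice

/-! ### Quasiperiodic functions: passage from the cell to the plane, and completeness. -/

section QPBasics

variable {𝕜 E : Type} [RCLike 𝕜] [NormedAddCommGroup E] [InnerProductSpace 𝕜 E]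
  {τ : UpperHalfPlane} {m : ℤ → ℤ → Plane → 𝕜}

theorem QP.ext_ae {f g : QP 𝕜 E τ m} (h : f.1 =ᵐ[volume] g.1) : f = g :=
  Subtype.ext (AEEqFun.ext h)

theorem QP.coeFn_add (f g : QP 𝕜 E τ m) : ∀ᵐ x : Plane, (f + g).1 x = f.1 x + g.1 x :=
  AEEqFun.coeFn_add f.1 g.1

theorem QP.coeFn_sub (f g : QP 𝕜 E τ m) : ∀ᵐ x : Plane, (f - g).1 x = f.1 x - g.1 x :=
  AEEqFun.coeFn_sub f.1 g.1

theorem QP.coeFn_neg (f : QP 𝕜 E τ m) : ∀ᵐ x : Plane, (-f).1 x = -f.1 x :=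
  AEEqFun.coeFn_neg f.1

theorem QP.coeFn_smul (c : 𝕜) (f : QP 𝕜 E τ m) : ∀ᵐ x : Plane, (c • f).1 x = c • f.1 x :=
  AEEqFun.coeFn_smul c f.1

theorem QP.coeFn_zero : ∀ᵐ x : Plane, (0 : QP 𝕜 E τ m).1 x = 0 :=
  AEEqFun.coeFn_zero

theorem QP.inner_eq (f g : QP 𝕜 E τ m) :
    inner 𝕜 f g = ∫ x in cell τ, inner 𝕜 (f.1 x) (g.1 x) := by
  change inner 𝕜 (QP.toCell f) (QP.toCell g) = _
  rw [L2.inner_def]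
  refine integral_congr_ae ?_
  filter_upwards [MemLp.coeFn_toLp (QP.memLp_cell f), MemLp.coeFn_toLp (QP.memLp_cell g)]
    with x h1 h2
  change inner 𝕜 (((QP.memLp_cell f).toLp _ : Lp E 2 (volume.restrict (cell τ))) x)
    (((QP.memLp_cell g).toLp _ : Lp E 2 (volume.restrict (cell τ))) x) = _
  rw [h1, h2]

theorem QP.enorm_eq (f : QP 𝕜 E τ m) : ‖f‖ₑ = eLpNorm f.1 2 (volume.restrict (cell τ)) :=
  Lp.enorm_toLp (QP.memLp_cell f)

theorem isPeriodic_norm (hm : ∀ p q x, ‖m p q x‖ = 1) {f : Plane → E}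
    (hf : ∀ p q : ℤ, ∀ᵐ x : Plane, f (x + latticeVec τ p q) = m p q x • f x) :
    IsPeriodic τ fun x => ‖f x‖ₑ := by
  intro p q
  filter_upwards [hf p q] with x hx
  rw [hx, enorm_smul, ← ofReal_norm, hm, ENNReal.ofReal_one, one_mul]

theorem memLp_restrict_of_isPeriodic {f : Plane → E} (hf : AEStronglyMeasurable f volume)
    (hper : IsPeriodic τ fun x => ‖f x‖ₑ) (h : MemLp f 2 (volume.restrict (cell τ)))
    {K : Set Plane} (hK : IsCompact K) : MemLp f 2 (volume.restrict K) := by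
  obtain ⟨N, hN⟩ := exists_setLIntegral_le τ hK
  refine ⟨hf.restrict, ?_⟩
  have h2 := h.2
  rw [eLpNorm_lt_top_iff_lintegral_rpow_enorm_lt_top (by norm_num) (by norm_num)] at h2 ⊢
  refine (hN _ fun p q => ?_).trans_lt (ENNReal.mul_lt_top (by simp) h2)
  filter_upwards [hper p q] with x hx
  rw [hx]

/-- Multipliers of modulus one make |f| periodic, so square integrability on the cell spreads to
every compact set, which meets only finitely many translates of the cell. -/
theorem QP.exists_coe_eq (hm : ∀ p q x, ‖m p q x‖ = 1) {f : Plane → E}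
    (hf : AEStronglyMeasurable f volume)
    (hq : ∀ p q : ℤ, ∀ᵐ x : Plane, f (x + latticeVec τ p q) = m p q x • f x)
    (h : MemLp f 2 (volume.restrict (cell τ))) : ∃ g : QP 𝕜 E τ m, g.1 =ᵐ[volume] f := by
  have e := AEEqFun.coeFn_mk f hf
  refine ⟨⟨AEEqFun.mk f hf, fun p q => ?_, fun K hK => ?_⟩, e⟩
  · have e' := (measurePreserving_add_right (volume : Measure Plane)
        (latticeVec τ p q)).quasiMeasurePreserving.ae e
    filter_upwards [e, e', hq p q] with x h1 h2 h3
    rw [h1, h2, h3]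
  · exact (memLp_restrict_of_isPeriodic hf (isPeriodic_norm hm hq) h hK).ae_eq
      (ae_restrict_of_ae e.symm)

/-- Countably many translates of the cell cover the plane. -/
theorem ae_of_ae_cell {Q : Plane → Prop} (hQ : ∀ p q : ℤ, ∀ᵐ x : Plane, Q x →
    Q (x + latticeVec τ p q)) (h : ∀ᵐ x : Plane, x ∈ cell τ → Q x) : ∀ᵐ x : Plane, Q x := by
  have h1 : ∀ᵐ x : Plane, ∀ p q : ℤ, x - latticeVec τ p q ∈ cell τ → Q x := by
    rw [ae_all_iff]
    intro p
    rw [ae_all_iff]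
    intro q
    have h2 : ∀ᵐ x : Plane, x ∈ cell τ → Q (x + latticeVec τ p q) := by
      filter_upwards [h, hQ p q] with x h3 h4 h5
      exact h4 (h3 h5)
    have h3 := (measurePreserving_sub_right (volume : Measure Plane)
        (latticeVec τ p q)).quasiMeasurePreserving.ae h2
    filter_upwards [h3] with x h4 h5
    simpa using h4 h5
  filter_upwards [h1] with x hx
  obtain ⟨p, q, hpq⟩ := cell_cover τ x
  exact hx p q hpq

theorem QP.exists_subseq_cell {u : ℕ → QP 𝕜 E τ m} {g : Lp E 2 (volume.restrict (cell τ))}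
    (hu : Tendsto (fun k => QP.toCell (u k)) atTop (𝓝 g)) :
    ∃ ns : ℕ → ℕ, StrictMono ns ∧
      ∀ᵐ x : Plane, x ∈ cell τ → Tendsto (fun i => (u (ns i)).1 x) atTop (𝓝 (g x)) := by
  obtain ⟨ns, hns, h⟩ := (tendstoInMeasure_of_tendsto_Lp hu).exists_seq_tendsto_ae
  refine ⟨ns, hns, ae_imp_of_ae_restrict ?_⟩
  have h2 : ∀ᵐ x ∂(volume.restrict (cell τ)), ∀ k, QP.toCell (u k) x = (u k).1 x := by
    rw [ae_all_iff]
    exact fun k => MemLp.coeFn_toLp (QP.memLp_cell (u k))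
  filter_upwards [h, h2] with x h3 h4
  simpa only [h4] using h3

theorem QP.exists_subseq_ae {u : ℕ → QP 𝕜 E τ m} {f : QP 𝕜 E τ m}
    (hu : Tendsto u atTop (𝓝 f)) : ∃ ns : ℕ → ℕ, StrictMono ns ∧
      ∀ᵐ x : Plane, Tendsto (fun i => (u (ns i)).1 x) atTop (𝓝 (f.1 x)) := by
  have h1 : Tendsto (fun k => QP.toCell (u k)) atTop (𝓝 (QP.toCell f)) := by
    rw [tendsto_iff_norm_sub_tendsto_zero] at hu ⊢
    simp only [← map_sub]
    exact hu
  obtain ⟨ns, hns, h⟩ := QP.exists_subseq_cell h1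
  refine ⟨ns, hns, ae_of_ae_cell (τ := τ) (fun p q => ?_) ?_⟩
  · have h2 : ∀ᵐ x : Plane, ∀ i, (u (ns i)).1 (x + latticeVec τ p q) =
        m p q x • (u (ns i)).1 x := by
      rw [ae_all_iff]
      exact fun i => (u (ns i)).2.1 p q
    filter_upwards [h2, f.2.1 p q] with x h3 h4 h5
    simp only [h3, h4]
    exact h5.const_smul _
  · have h2 := ae_imp_of_ae_restrict (MemLp.coeFn_toLp (QP.memLp_cell f))
    filter_upwards [h, h2] with x h3 h4 h5
    rw [← h4 h5]
    exact h3 h5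

/-- A Cauchy sequence converges in L² of the cell. A subsequence converges almost everywhere there,
hence almost everywhere on the plane by quasiperiodicity, and the pointwise limit is again
quasiperiodic. -/
theorem QP.completeSpace [CompleteSpace E] (hm : ∀ p q x, ‖m p q x‖ = 1) :
    CompleteSpace (QP 𝕜 E τ m) := by
  refine Metric.complete_of_cauchySeq_tendsto fun u hu => ?_
  have hc : CauchySeq fun k => QP.toCell (u k) := by
    rw [Metric.cauchySeq_iff'] at hu ⊢
    intro ε hε
    obtain ⟨N, hN⟩ := hu ε hε
    refine ⟨N, fun k hk => ?_⟩
    have := hN k hk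
    rw [dist_eq_norm] at this ⊢
    rwa [← map_sub]
  obtain ⟨g, hg⟩ := cauchySeq_tendsto_of_complete hc
  obtain ⟨ns, hns, h⟩ := QP.exists_subseq_cell hg
  have hq : ∀ p q : ℤ, ∀ᵐ x : Plane, ∀ i, (u (ns i)).1 (x + latticeVec τ p q) =
      m p q x • (u (ns i)).1 x := by
    intro p q
    rw [ae_all_iff]
    exact fun i => (u (ns i)).2.1 p q
  have hlim : ∀ᵐ x : Plane, ∃ l, Tendsto (fun i => (u (ns i)).1 x) atTop (𝓝 l) := by
    refine ae_of_ae_cell (τ := τ) (fun p q => ?_) ?_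
    · filter_upwards [hq p q] with x h3 ⟨l, hl⟩
      simp only [h3]
      exact ⟨_, hl.const_smul _⟩
    · filter_upwards [h] with x hx hx'
      exact ⟨_, hx hx'⟩
  obtain ⟨f, hf, hf'⟩ := exists_stronglyMeasurable_limit_of_tendsto_ae
    (fun i => (u (ns i)).1.aestronglyMeasurable) hlim
  have hfg : ∀ᵐ x : Plane, x ∈ cell τ → g x = f x := by
    filter_upwards [h, hf'] with x h1 h2 h3
    exact tendsto_nhds_unique (h1 h3) h2
  have hfg' : g =ᵐ[volume.restrict (cell τ)] f :=
    (ae_restrict_iff' (measurableSet_cell τ)).2 hfg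
  obtain ⟨F, hF⟩ := QP.exists_coe_eq (τ := τ) hm hf.aestronglyMeasurable (fun p q => by
    have h' := (measurePreserving_add_right (volume : Measure Plane)
        (latticeVec τ p q)).quasiMeasurePreserving.ae hf'
    filter_upwards [hf', h', hq p q] with x h1 h2 h3
    simp only [h3] at h2
    exact tendsto_nhds_unique h2 (h1.const_smul _)) ((Lp.memLp g).ae_eq hfg')
  refine ⟨F, ?_⟩
  have hFg : QP.toCell F = g := by
    apply Lp.ext
    have h1 := MemLp.coeFn_toLp (QP.memLp_cell F)
    filter_upwards [h1, ae_restrict_of_ae hF, hfg'] with x h1 h2 h3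
    rw [h3, ← h2]
    exact h1
  rw [tendsto_iff_norm_sub_tendsto_zero] at hg ⊢
  simp only [← hFg, ← map_sub] at hg
  exact hg

/-- Integration of a periodic function over a compact set is controlled by the norm of `L²` of the
cell. -/
theorem QP.exists_setLIntegral_enorm_le (hm : ∀ p q x, ‖m p q x‖ = 1) {K : Set Plane}
    (hK : IsCompact K) :
    ∃ C : NNReal, ∀ f : QP 𝕜 E τ m, ∫⁻ x in K, ‖f.1 x‖ₑ ≤ C * ‖f‖ₑ := by
  obtain ⟨N, hN⟩ := exists_setLIntegral_le τ hK
  have hfin : (N : ENNReal) * (volume (cell τ)) ^ (1 / 2 : ℝ) ≠ ⊤ :=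
    ENNReal.mul_ne_top (by simp)
      (ENNReal.rpow_ne_top_of_nonneg (by norm_num) (volume_cell_lt_top τ).ne)
  refine ⟨((N : ENNReal) * (volume (cell τ)) ^ (1 / 2 : ℝ)).toNNReal, fun f => ?_⟩
  rw [ENNReal.coe_toNNReal hfin]
  refine (hN _ (isPeriodic_norm hm f.2.1)).trans ?_
  rw [mul_assoc]
  gcongr
  have h := eLpNorm_le_eLpNorm_mul_rpow_measure_univ (μ := volume.restrict (cell τ))
    (p := 1) (q := 2) (by norm_num) (f := f.1) f.1.aestronglyMeasurable.restrict
  rw [eLpNorm_one_eq_lintegral_enorm, ← QP.enorm_eq, Measure.restrict_apply_univ] at h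
  refine h.trans (le_of_eq ?_)
  rw [mul_comm]
  norm_num

/-- The L² norm of the cell controls the L¹ norm on compact sets. The fibre maps are only additive,
because real test functions act on `E` through a real structure that is not assumed to come from the
one over `𝕜`. -/
theorem QP.tendsto_integral {G : Type} [NormedAddCommGroup G] [NormedSpace ℝ G]
    (hm : ∀ p q x, ‖m p q x‖ = 1) {K : Set Plane} (hK : IsCompact K) {C : ℝ}
    (L : Plane → E →+ G) (hL : ∀ x v, ‖L x v‖ ≤ C * ‖v‖) (hL0 : ∀ x ∉ K, ∀ v, L x v = 0)
    (hint : ∀ f : QP 𝕜 E τ m, Integrable fun x => L x (f.1 x))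
    {u : ℕ → QP 𝕜 E τ m} {f : QP 𝕜 E τ m} (hu : Tendsto u atTop (𝓝 f)) :
    Tendsto (fun k => ∫ x, L x ((u k).1 x)) atTop (𝓝 (∫ x, L x (f.1 x))) := by
  obtain ⟨B, hB⟩ := QP.exists_setLIntegral_enorm_le (E := E) (τ := τ) hm hK
  rw [tendsto_iff_norm_sub_tendsto_zero] at hu ⊢
  obtain ⟨D, hD, hCD⟩ : ∃ D, 0 ≤ D ∧ C ≤ D := ⟨max C 0, le_max_right _ _, le_max_left _ _⟩
  have key : ∀ k, ‖(∫ x, L x ((u k).1 x)) - ∫ x, L x (f.1 x)‖ ≤ D * B * ‖u k - f‖ := by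
    intro k
    rw [← integral_sub (hint _) (hint _)]
    have e : ∫ x, (L x ((u k).1 x) - L x (f.1 x)) = ∫ x in K, L x ((u k - f).1 x) := by
      rw [setIntegral_eq_integral_of_forall_compl_eq_zero fun x hx => hL0 x hx _]
      refine integral_congr_ae ?_
      filter_upwards [QP.coeFn_sub (u k) f] with x hx
      rw [hx, map_sub]
    rw [e]
    have h1 : ‖∫ x in K, L x ((u k - f).1 x)‖ₑ ≤ ENNReal.ofReal D * (B * ‖u k - f‖ₑ) := by
      refine (enorm_integral_le_lintegral_enorm _).trans ?_
      refine (lintegral_mono (g := fun x => ENNReal.ofReal D * ‖(u k - f).1 x‖ₑ)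
        fun x => ?_).trans ?_
      · change _ ≤ ENNReal.ofReal _ * _
        rw [← ofReal_norm, ← ofReal_norm,
          ← ENNReal.ofReal_mul hD]
        exact ENNReal.ofReal_le_ofReal ((hL x _).trans
          (mul_le_mul_of_nonneg_right hCD (norm_nonneg _)))
      · rw [lintegral_const_mul' _ _ ENNReal.ofReal_ne_top]
        gcongr
        exact hB _
    have h2 := ENNReal.toReal_mono (by finiteness) h1
    simpa [ENNReal.toReal_mul, mul_assoc, hD] using h2
  refine squeeze_zero (fun k => norm_nonneg _) key ?_
  simpa using hu.const_mul (D * (B : ℝ))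

end QPBasics

/-! ### Local square integrability and mollification. -/

section WeakTheory

/-- Local square integrability. -/
def IsL2Loc {E : Type} [NormedAddCommGroup E] (f : Plane → E) : Prop :=
  ∀ K : Set Plane, IsCompact K → MemLp f 2 (volume.restrict K)

section IsL2Loc

variable {E F : Type} [NormedAddCommGroup E] [NormedAddCommGroup F]

theorem IsL2Loc.locallyIntegrable {f : Plane → E} (hf : IsL2Loc f) : LocallyIntegrable f := by
  rw [locallyIntegrable_iff]
  intro K hK
  have : IsFiniteMeasure ((volume : Measure Plane).restrict K) :=
    ⟨by simpa using hK.measure_lt_top⟩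
  exact (hf K hK).integrable (by norm_num)

theorem IsL2Loc.aestronglyMeasurable {f : Plane → E} (hf : IsL2Loc f) :
    AEStronglyMeasurable f volume :=
  hf.locallyIntegrable.aestronglyMeasurable

theorem IsL2Loc.add {f g : Plane → E} (hf : IsL2Loc f) (hg : IsL2Loc g) :
    IsL2Loc fun x => f x + g x :=
  fun K hK => (hf K hK).add (hg K hK)

theorem IsL2Loc.sub {f g : Plane → E} (hf : IsL2Loc f) (hg : IsL2Loc g) :
    IsL2Loc fun x => f x - g x :=
  fun K hK => (hf K hK).sub (hg K hK)

theorem IsL2Loc.congr {f g : Plane → E} (hf : IsL2Loc f) (h : f =ᵐ[volume] g) : IsL2Loc g :=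
  fun K hK => (hf K hK).ae_eq (ae_restrict_of_ae h)

theorem IsL2Loc.of_le {f : Plane → E} {g : Plane → F} (hf : IsL2Loc f)
    (hg : AEStronglyMeasurable g volume) (h : ∀ᵐ x, ‖g x‖ ≤ ‖f x‖) : IsL2Loc g :=
  fun K hK => (hf K hK).of_le hg.restrict (ae_restrict_of_ae h)

theorem IsL2Loc.clm_comp [NormedSpace ℝ E] [NormedSpace ℝ F] {f : Plane → E} (hf : IsL2Loc f)
    (L : E →L[ℝ] F) : IsL2Loc fun x => L (f x) :=
  fun K hK => L.comp_memLp' (hf K hK)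

theorem IsL2Loc.continuous_mul {f : Plane → ℂ} (hf : IsL2Loc f) {c : Plane → ℂ}
    (hc : Continuous c) : IsL2Loc fun x => c x * f x := by
  intro K hK
  obtain ⟨b, hb⟩ := (hK.image hc).isBounded.exists_norm_le
  refine (hf K hK).of_le_mul (c := b)
    ((hc.aestronglyMeasurable.mul hf.aestronglyMeasurable).restrict) ?_
  refine ae_restrict_of_forall_mem hK.measurableSet fun x hx => ?_
  rw [norm_mul]
  exact mul_le_mul_of_nonneg_right (hb _ (mem_image_of_mem _ hx)) (norm_nonneg _)

theorem IsL2Loc.const_mul {f : Plane → ℂ} (hf : IsL2Loc f) (c : ℂ) : IsL2Loc fun x => c * f x :=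
  fun K hK => (hf K hK).const_mul c

theorem IsL2Loc.locallyIntegrable_mul {f g : Plane → ℂ} (hf : IsL2Loc f) (hg : IsL2Loc g) :
    LocallyIntegrable fun x => f x * g x := by
  rw [locallyIntegrable_iff]
  exact fun K hK => (hf K hK).integrable_mul (hg K hK)

theorem IsL2Loc.memLp_indicator {f : Plane → E} (hf : IsL2Loc f) {K : Set Plane}
    (hK : IsCompact K) : MemLp (K.indicator f) 2 volume :=
  (memLp_indicator_iff_restrict hK.measurableSet).2 (hf K hK)

theorem memLp_test_mul {f : Plane → ℂ} (hf : IsL2Loc f) {φ : Plane → ℝ} (h : Continuous φ)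
    (hc : HasCompactSupport φ) : MemLp (fun x => (φ x : ℂ) * f x) 2 volume := by
  have h1 := (hf.continuous_mul (Complex.continuous_ofReal.comp h)).memLp_indicator hc
  convert h1 using 1
  ext x
  by_cases hx : x ∈ tsupport φ
  · rw [indicator_of_mem hx]
    rfl
  · rw [indicator_of_notMem hx, image_eq_zero_of_notMem_tsupport hx]
    simp

end IsL2Loc

theorem QP.isL2Loc {𝕜 E : Type} [RCLike 𝕜] [NormedAddCommGroup E] [InnerProductSpace 𝕜 E]
    {τ : UpperHalfPlane} {m : ℤ → ℤ → Plane → 𝕜} (f : QP 𝕜 E τ m) : IsL2Loc f.1 :=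
  f.2.2

/-- The correlation of two square integrable functions is continuous. -/
theorem continuous_correlation {k g : Plane → ℂ} (hk : MemLp k 2 volume) (hg : MemLp g 2 volume) :
    Continuous fun y => ∫ x, k x * g (x - y) := by
  let T : Plane → C(Plane, Plane) := fun y => ⟨fun x => x - y, by fun_prop⟩
  have hT : Continuous T := by
    let T2 : C(Plane × Plane, Plane) := ⟨fun p => p.2 - p.1, by fun_prop⟩
    exact T2.curry.continuous
  have hTm : ∀ y, MeasurePreserving (T y) (volume : Measure Plane) volume := fun y =>
    measurePreserving_sub_right volume y
  have h1 : Continuous fun y => Lp.compMeasurePreserving (T y) (hTm y) (hg.toLp g) :=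
    Continuous.compMeasurePreservingLp continuous_const hT hTm (by norm_num)
  have hk' : MemLp (fun x => conj (k x)) 2 volume := hk.star
  have h2 : Continuous fun y =>
      inner ℂ (hk'.toLp _) (Lp.compMeasurePreserving (T y) (hTm y) (hg.toLp g)) :=
    continuous_const.inner h1
  convert h2 using 2 with y
  rw [L2.inner_def]
  refine integral_congr_ae ?_
  have h3 := (hTm y).quasiMeasurePreserving.ae hg.coeFn_toLp
  filter_upwards [hk'.coeFn_toLp, Lp.coeFn_compMeasurePreserving (hg.toLp g) (hTm y), h3]
    with x e1 e2 e3
  rw [e1, e2, Function.comp_apply, e3, RCLike.inner_apply, Complex.conj_conj, mul_comm]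
  rfl

theorem exists_compact_sub {K B : Set Plane} (hK : IsCompact K) (hB : IsCompact B) :
    ∃ K' : Set Plane, IsCompact K' ∧ ∀ x ∈ K, ∀ y ∈ B, x - y ∈ K' :=
  ⟨(fun p : Plane × Plane => p.1 - p.2) '' (K ×ˢ B), (hK.prod hB).image (by fun_prop),
    fun x hx y hy => ⟨(x, y), ⟨hx, hy⟩, rfl⟩⟩

/-- For y near a given point only the values of g on one compact set enter, so g may be replaced by
a globally square integrable function. -/
theorem continuous_correlation_of_isL2Loc {k g : Plane → ℂ} (hk : MemLp k 2 volume)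
    {K : Set Plane} (hK : IsCompact K) (hk0 : ∀ x ∉ K, k x = 0) (hg : IsL2Loc g) :
    Continuous fun y => ∫ x, k x * g (x - y) := by
  rw [continuous_iff_continuousAt]
  intro y₀
  obtain ⟨K', hK', hsub⟩ := exists_compact_sub hK (isCompact_closedBall y₀ 1)
  refine ((continuous_correlation hk (hg.memLp_indicator hK')).continuousAt (x := y₀)).congr ?_
  filter_upwards [Metric.closedBall_mem_nhds y₀ one_pos] with y hy
  congr 1
  ext x
  by_cases hx : x ∈ K
  · rw [indicator_of_mem (hsub x hx y hy)]
  · rw [hk0 x hx, zero_mul, zero_mul]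

/-- Since |k||G| ≤ |k|² + |G|², the integrand is dominated by |k(x)|² |η(y)| + |η(y)| |G(x - y)|²,
where G is g cut off to a compact set; both terms are integrable on the product. -/
theorem integrable_mollify {k g : Plane → ℂ} (hk : MemLp k 2 volume)
    {K : Set Plane} (hK : IsCompact K) (hk0 : ∀ x ∉ K, k x = 0) (hg : IsL2Loc g)
    {η : Plane → ℝ} (hη : Continuous η) (hηc : HasCompactSupport η) :
    Integrable (fun p : Plane × Plane => (η p.2 : ℂ) * (k p.1 * g (p.1 - p.2)))
      (volume.prod volume) := by
  obtain ⟨K', hK', hsub⟩ := exists_compact_sub hK hηc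
  set G := K'.indicator g with hG
  have hGm : MemLp G 2 volume := hg.memLp_indicator hK'
  have e : (fun p : Plane × Plane => (η p.2 : ℂ) * (k p.1 * g (p.1 - p.2))) =
      fun p => (η p.2 : ℂ) * (k p.1 * G (p.1 - p.2)) := by
    ext p
    by_cases h1 : p.1 ∈ K
    · by_cases h2 : p.2 ∈ tsupport η
      · rw [hG, indicator_of_mem (hsub _ h1 _ h2)]
      · rw [image_eq_zero_of_notMem_tsupport h2]
        simp
    · rw [hk0 _ h1]
      simp
  rw [e]
  have hηi : Integrable η := hη.integrable_of_hasCompactSupport hηc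
  have hk2 : Integrable fun x => ‖k x‖ ^ 2 := hk.integrable_norm_pow (by norm_num)
  have hG2 : Integrable fun x => ‖G x‖ ^ 2 := hGm.integrable_norm_pow (by norm_num)
  have i1 : Integrable (fun p : Plane × Plane => ‖k p.1‖ ^ 2 * ‖η p.2‖) (volume.prod volume) :=
    hk2.mul_prod hηi.norm
  have i2 : Integrable (fun p : Plane × Plane => ‖η p.2‖ * ‖G (p.1 - p.2)‖ ^ 2)
      (volume.prod volume) :=
    hηi.norm.convolution_integrand (ContinuousLinearMap.mul ℝ ℝ) hG2
  refine (i1.add i2).mono' ?_ (Eventually.of_forall fun p => ?_)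
  · have m1 : AEStronglyMeasurable (fun p : Plane × Plane => (η p.2 : ℂ) * G (p.1 - p.2))
        (volume.prod volume) :=
      (hηi.ofReal (𝕜 := ℂ)).aestronglyMeasurable.convolution_integrand
        (ContinuousLinearMap.mul ℝ ℂ) hGm.aestronglyMeasurable
    have m2 : AEStronglyMeasurable (fun p : Plane × Plane => k p.1) (volume.prod volume) :=
      hk.aestronglyMeasurable.comp_fst
    refine (m2.mul m1).congr (Eventually.of_forall fun p => ?_)
    simp only [Pi.mul_apply]
    ring
  · rw [norm_mul, norm_mul, Complex.norm_real]
    simp only [Pi.add_apply]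
    have h1 := norm_nonneg (η p.2)
    have h2 : ‖k p.1‖ * ‖G (p.1 - p.2)‖ ≤ ‖k p.1‖ ^ 2 + ‖G (p.1 - p.2)‖ ^ 2 := by
      nlinarith [sq_nonneg (‖k p.1‖ - ‖G (p.1 - p.2)‖), sq_nonneg (‖k p.1‖ + ‖G (p.1 - p.2)‖)]
    nlinarith [mul_le_mul_of_nonneg_left h2 h1]

/-- An integral identity which holds for all mollifications of some of its factors holds. -/
theorem sum_integral_eq_zero_of_mollified {ι : Type} [Fintype ι] {k g : ι → Plane → ℂ}
    (hk : ∀ i, MemLp (k i) 2 volume) {K : Set Plane} (hK : IsCompact K)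
    (hk0 : ∀ i, ∀ x ∉ K, k i x = 0) (hg : ∀ i, IsL2Loc (g i))
    (h : ∀ η : Plane → ℝ, ContDiff ℝ ∞ η → HasCompactSupport η →
      ∑ i, ∫ x, k i x * ∫ y, (η y : ℂ) * g i (x - y) = 0) :
    ∑ i, ∫ x, k i x * g i x = 0 := by
  -- As a function of the shift y the sum is continuous. By Fubini its integral against a test
  -- function η is the mollified sum, which is zero; so it vanishes identically, and y = 0 is the
  -- claim.
  have hc : Continuous fun y => ∑ i, ∫ x, k i x * g i (x - y) :=
    continuous_finsetSum _ fun i _ =>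
      continuous_correlation_of_isL2Loc (hk i) hK (hk0 i) (hg i)
  have h0 : (fun y => ∑ i, ∫ x, k i x * g i (x - y)) =ᵐ[volume] fun _ => 0 := by
    refine ae_eq_zero_of_integral_contDiff_smul_eq_zero hc.locallyIntegrable fun η hη hηc => ?_
    rw [← h η hη hηc]
    have hi := fun i => integrable_mollify (hk i) hK (hk0 i) (hg i) hη.continuous hηc
    have e : ∀ i, ∫ y, (η y : ℂ) * ∫ x, k i x * g i (x - y) =
        ∫ x, k i x * ∫ y, (η y : ℂ) * g i (x - y) := by
      intro i
      simp only [← integral_const_mul]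
      rw [integral_integral_swap (f := fun y x => (η y : ℂ) * (k i x * g i (x - y))) (hi i).swap]
      refine integral_congr_ae (Eventually.of_forall fun x => ?_)
      refine integral_congr_ae (Eventually.of_forall fun y => ?_)
      dsimp only
      ring
    simp only [Complex.real_smul, Finset.mul_sum]
    rw [integral_finsetSum]
    · exact Finset.sum_congr rfl fun i _ => e i
    · intro i _
      refine (hi i).swap.integral_prod_left.congr (Eventually.of_forall fun y => ?_)
      simp [integral_const_mul]
  have h1 := congrFun ((hc.ae_eq_iff_eq volume continuous_const).1 h0) 0
  simpa using h1

section Mollify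

variable {g g' : Plane → ℝ} {j : Fin 2} {η : Plane → ℝ}

theorem contDiff_mollify (hg : LocallyIntegrable g) (hη : ContDiff ℝ ∞ η)
    (hηc : HasCompactSupport η) : ContDiff ℝ ∞ fun x => ∫ y, η y * g (x - y) :=
  hηc.contDiff_convolution_left (ContinuousLinearMap.lsmul ℝ ℝ) hη hg

theorem fderiv_comp_sub_left (hη : ContDiff ℝ ∞ η) (x y v : Plane) :
    fderiv ℝ (fun t => η (x - t)) y v = -fderiv ℝ η (x - y) v := by
  have h1 : HasFDerivAt η (fderiv ℝ η (x - y)) (x - y) :=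
    (hη.differentiable (by simp) _).hasFDerivAt
  have h2 : HasFDerivAt (fun t : Plane => x - t) (-ContinuousLinearMap.id ℝ Plane) y :=
    (hasFDerivAt_id y).const_sub x
  have h3 : HasFDerivAt (fun t => η (x - t)) _ y := h1.comp y h2
  rw [h3.fderiv]
  simp

theorem hasCompactSupport_comp_sub_left (hηc : HasCompactSupport η) (x : Plane) :
    HasCompactSupport fun t => η (x - t) :=
  hηc.comp_homeomorph (Homeomorph.subLeft x)

/-- The derivative falls on η and is then transferred to g by using t ↦ η(x - t) as a test function.
-/
theorem fderiv_mollify (hg : HasWeakPartial j g g') (hη : ContDiff ℝ ∞ η)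
    (hηc : HasCompactSupport η) (x : Plane) :
    fderiv ℝ (fun x => ∫ y, η y * g (x - y)) x (coordVec j) = ∫ y, η y * g' (x - y) := by
  have h1 := hηc.hasFDerivAt_convolution_left (μ := volume) (ContinuousLinearMap.lsmul ℝ ℝ)
    (hη.of_le (by simp)) hg.1 x
  have h1' : HasFDerivAt (fun x => ∫ y, η y * g (x - y)) _ x := h1
  have hd : HasCompactSupport (fderiv ℝ η) := hηc.fderiv ℝ
  have hdc : Continuous (fderiv ℝ η) := hη.continuous_fderiv (by simp)
  have hcex := hd.convolutionExists_left
    ((ContinuousLinearMap.lsmul ℝ ℝ).precompL Plane) hdc hg.1 x (μ := volume)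
  rw [h1'.fderiv, convolution_def, ContinuousLinearMap.integral_apply hcex]
  have e1 : ∫ t, ((ContinuousLinearMap.lsmul ℝ ℝ).precompL Plane (fderiv ℝ η t) (g (x - t)))
      (coordVec j) = ∫ t, fderiv ℝ η (x - t) (coordVec j) * g t := by
    rw [← integral_sub_left_eq_self _ volume x]
    simp [ContinuousLinearMap.precompL_apply]
  have e2 : ∫ y, η y * g' (x - y) = ∫ t, η (x - t) * g' t := by
    rw [← integral_sub_left_eq_self _ volume x]
    simp
  have h3 := hg.2.2 (fun t => η (x - t)) (hη.comp (by fun_prop))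
    (hasCompactSupport_comp_sub_left hηc x)
  simp only [fderiv_comp_sub_left hη, smul_eq_mul, neg_mul, integral_neg, neg_inj] at h3
  rw [e1, e2, h3]

end Mollify

end WeakTheory

/-! ### Calculus of weak derivatives and weak divergences; product rules. -/

section WeakPartial

variable {E F : Type} [NormedAddCommGroup E] [NormedSpace ℝ E] [NormedAddCommGroup F]
  [NormedSpace ℝ F] {j : Fin 2}

theorem HasWeakPartial.unique [CompleteSpace E] {f g g' : Plane → E} (h : HasWeakPartial j f g)
    (h' : HasWeakPartial j f g') : g =ᵐ[volume] g' :=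
  ae_eq_of_integral_contDiff_smul_eq h.2.1 h'.2.1 fun φ h1 h2 =>
    neg_injective ((h.2.2 φ h1 h2).symm.trans (h'.2.2 φ h1 h2))

theorem locallyIntegrable_clm_comp (L : E →L[ℝ] F) {f : Plane → E} (hf : LocallyIntegrable f) :
    LocallyIntegrable fun x => L (f x) := by
  rw [locallyIntegrable_iff] at hf ⊢
  exact fun K hK => L.integrable_comp (hf K hK)

theorem HasWeakPartial.clm_comp [CompleteSpace E] [CompleteSpace F] (L : E →L[ℝ] F)
    {f g : Plane → E} (h : HasWeakPartial j f g) :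
    HasWeakPartial j (fun x => L (f x)) (fun x => L (g x)) := by
  refine ⟨locallyIntegrable_clm_comp L h.1, locallyIntegrable_clm_comp L h.2.1,
    fun φ h1 h2 => ?_⟩
  have i1 := integrable_test_smul h.1 (continuous_test_fderiv h1 (coordVec j))
    (h2.fderiv_apply ℝ _)
  have i2 := integrable_test_smul h.2.1 h1.continuous h2
  simp only [← map_smul]
  rw [L.integral_comp_comm i1, L.integral_comp_comm i2, h.2.2 φ h1 h2, map_neg]

theorem locallyIntegrable_comp_neg {f : Plane → E} (hf : LocallyIntegrable f) :
    LocallyIntegrable fun x => f (-x) := by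
  rw [locallyIntegrable_iff] at hf ⊢
  intro K hK
  have := (Measure.measurePreserving_neg (volume : Measure Plane)).integrableOn_comp_preimage
    (MeasurableEquiv.neg Plane).measurableEmbedding (f := f) (s := Neg.neg ⁻¹' K)
  rw [neg_preimage, neg_preimage, neg_neg] at this
  exact this.2 (hf _ hK.neg)

theorem fderiv_comp_neg_apply {φ : Plane → ℝ} (hφ : ContDiff ℝ ∞ φ) (x v : Plane) :
    fderiv ℝ (fun t => φ (-t)) x v = -fderiv ℝ φ (-x) v := by
  simpa using fderiv_comp_sub_left hφ 0 x v

theorem HasWeakPartial.comp_neg {f g : Plane → E} (h : HasWeakPartial j f g) :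
    HasWeakPartial j (fun x => f (-x)) (fun x => -g (-x)) := by
  refine ⟨locallyIntegrable_comp_neg h.1, (locallyIntegrable_comp_neg h.2.1).neg,
    fun φ h1 h2 => ?_⟩
  have h3 := h.2.2 (fun t => φ (-t)) (h1.comp contDiff_neg) (h2.comp_homeomorph (Homeomorph.neg _))
  simp only [fderiv_comp_neg_apply h1, neg_smul, integral_neg, neg_inj] at h3
  simp only [smul_neg, integral_neg, neg_neg]
  rw [← integral_neg_eq_self]
  simp only [neg_neg]
  rw [h3, ← integral_neg_eq_self]
  simp only [neg_neg]

theorem HasWeakPartial.neg {f g : Plane → E} (h : HasWeakPartial j f g) :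
    HasWeakPartial j (fun x => -f x) (fun x => -g x) := by
  refine ⟨h.1.neg, h.2.1.neg, fun φ h1 h2 => ?_⟩
  simp only [smul_neg, integral_neg, h.2.2 φ h1 h2]

theorem HasWeakPartial.sub {f g f' g' : Plane → E} (h : HasWeakPartial j f g)
    (h' : HasWeakPartial j f' g') :
    HasWeakPartial j (fun x => f x - f' x) (fun x => g x - g' x) := by
  simpa only [sub_eq_add_neg] using! h.add h'.neg

end WeakPartial

/-- `W` is the weak divergence of the vector field `V`. -/
structure HasWeakDiv (V : Fin 2 → Plane → ℂ) (W : Plane → ℂ) : Prop where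
  left : ∀ j, LocallyIntegrable (V j)
  right : LocallyIntegrable W
  integral_eq : ∀ φ : Plane → ℝ, ContDiff ℝ ∞ φ → HasCompactSupport φ →
    ∑ j, ∫ x, fderiv ℝ φ x (coordVec j) • V j x = -∫ x, φ x • W x

namespace HasWeakDiv

variable {V V' : Fin 2 → Plane → ℂ} {W W' : Plane → ℂ}

theorem congr (h : HasWeakDiv V W) (hV : ∀ j, V j =ᵐ[volume] V' j) (hW : W =ᵐ[volume] W') :
    HasWeakDiv V' W' := by
  refine ⟨fun j => (h.left j).congr (hV j), h.right.congr hW, fun φ h1 h2 => ?_⟩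
  have e1 : ∀ j, ∫ x, fderiv ℝ φ x (coordVec j) • V' j x =
      ∫ x, fderiv ℝ φ x (coordVec j) • V j x := fun j =>
    integral_congr_ae (by filter_upwards [hV j] with x hx; rw [hx])
  have e2 : ∫ x, φ x • W' x = ∫ x, φ x • W x :=
    integral_congr_ae (by filter_upwards [hW] with x hx; rw [hx])
  simp only [e1, e2, h.integral_eq φ h1 h2]

theorem add (h : HasWeakDiv V W) (h' : HasWeakDiv V' W') :
    HasWeakDiv (fun j x => V j x + V' j x) (fun x => W x + W' x) := by
  refine ⟨fun j => (h.left j).add (h'.left j), h.right.add h'.right, fun φ h1 h2 => ?_⟩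
  have hd := fun j => continuous_test_fderiv h1 (coordVec j)
  have hs : ∀ j, HasCompactSupport fun x => fderiv ℝ φ x (coordVec j) := fun j =>
    h2.fderiv_apply ℝ _
  simp only [smul_add]
  rw [integral_add (integrable_test_smul h.right h1.continuous h2)
    (integrable_test_smul h'.right h1.continuous h2), neg_add, ← h.integral_eq φ h1 h2,
    ← h'.integral_eq φ h1 h2, ← Finset.sum_add_distrib]
  exact Finset.sum_congr rfl fun j _ =>
    integral_add (integrable_test_smul (h.left j) (hd j) (hs j))
      (integrable_test_smul (h'.left j) (hd j) (hs j))

theorem const_mul (h : HasWeakDiv V W) (c : ℂ) :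
    HasWeakDiv (fun j x => c * V j x) (fun x => c * W x) := by
  refine ⟨fun j => (h.left j).smul c, h.right.smul c, fun φ h1 h2 => ?_⟩
  simp only [← mul_smul_comm, integral_const_mul]
  rw [← Finset.mul_sum, h.integral_eq φ h1 h2, mul_neg]

theorem of_partial {U : Fin 2 → Plane → ℂ} (h : ∀ j, HasWeakPartial j (V j) (U j)) :
    HasWeakDiv V (fun x => ∑ j, U j x) := by
  refine ⟨fun j => (h j).1, ?_, fun φ h1 h2 => ?_⟩
  · simp only [Fin.sum_univ_two]
    exact (h 0).2.1.add (h 1).2.1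
  · simp only [Finset.smul_sum]
    rw [integral_finsetSum _ fun j _ => integrable_test_smul (h j).2.1 h1.continuous h2,
      ← Finset.sum_neg_distrib]
    exact Finset.sum_congr rfl fun j _ => (h j).2.2 φ h1 h2

/-- With this equivalence the product rule need only be proved for divergences. -/
theorem single_iff {j : Fin 2} {f f' : Plane → ℂ} :
    HasWeakDiv (fun i x => if i = j then f x else 0) f' ↔ HasWeakPartial j f f' := by
  have e : ∀ φ : Plane → ℝ, ∑ i, ∫ x, fderiv ℝ φ x (coordVec i) • (if i = j then f x else 0) =
      ∫ x, fderiv ℝ φ x (coordVec j) • f x := by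
    intro φ
    rw [Finset.sum_eq_single j]
    · simp
    · intro i _ hi
      simp [hi]
    · simp
  constructor
  · intro h
    refine ⟨by simpa using h.left j, h.right, fun φ h1 h2 => ?_⟩
    rw [← h.integral_eq φ h1 h2, e]
  · rintro ⟨h1, h2, h3⟩
    refine ⟨fun i => ?_, h2, fun φ h4 h5 => ?_⟩
    · by_cases hi : i = j
      · simpa [hi] using h1
      · simpa [hi] using locallyIntegrable_zero
    · rw [e, h3 φ h4 h5]

/-- If g is smooth, the rule follows by using φ g as a test function. In general g is mollified to a
smooth m, φ m is the test function, and `sum_integral_eq_zero_of_mollified` removes the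
mollification; local square integrability of all factors is enough for that. -/
theorem mul_ofReal {g : Plane → ℝ} {g' : Fin 2 → Plane → ℝ} (h : HasWeakDiv V W)
    (hV : ∀ j, IsL2Loc (V j)) (hW : IsL2Loc W) (hg : IsL2Loc g) (hg' : ∀ j, IsL2Loc (g' j))
    (hw : ∀ j, HasWeakPartial j g (g' j)) :
    HasWeakDiv (fun j x => V j x * (g x : ℂ))
      (fun x => ∑ j, V j x * (g' j x : ℂ) + W x * (g x : ℂ)) := by
  have hgc : IsL2Loc fun x => (g x : ℂ) := hg.clm_comp Complex.ofRealCLM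
  have hgc' : ∀ j, IsL2Loc fun x => (g' j x : ℂ) := fun j => (hg' j).clm_comp Complex.ofRealCLM
  have l1 : ∀ j, LocallyIntegrable fun x => V j x * (g x : ℂ) := fun j =>
    (hV j).locallyIntegrable_mul hgc
  have l2 : ∀ j, LocallyIntegrable fun x => V j x * (g' j x : ℂ) := fun j =>
    (hV j).locallyIntegrable_mul (hgc' j)
  have l3 : LocallyIntegrable fun x => W x * (g x : ℂ) := hW.locallyIntegrable_mul hgc
  have l4 : LocallyIntegrable fun x => ∑ j, V j x * (g' j x : ℂ) := by
    simp only [Fin.sum_univ_two]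
    exact (l2 0).add (l2 1)
  refine ⟨l1, l4.add l3, fun φ h1 h2 => ?_⟩
  have hd := fun j => continuous_test_fderiv h1 (coordVec j)
  have hs : ∀ j, HasCompactSupport fun x => fderiv ℝ φ x (coordVec j) := fun j =>
    h2.fderiv_apply ℝ _
  -- The five integrals of the tested identity: the products of ∂ⱼφ Vⱼ with g, of φ Vⱼ with ∂ⱼg, and
  -- of φ W with g.
  let k : Fin 2 ⊕ Fin 2 ⊕ Unit → Plane → ℂ := Sum.elim
    (fun j x => ((fderiv ℝ φ x (coordVec j) : ℝ) : ℂ) * V j x)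
    (Sum.elim (fun j x => (φ x : ℂ) * V j x) (fun _ x => (φ x : ℂ) * W x))
  let G : Fin 2 ⊕ Fin 2 ⊕ Unit → Plane → ℂ := Sum.elim (fun _ x => (g x : ℂ))
    (Sum.elim (fun j x => (g' j x : ℂ)) (fun _ x => (g x : ℂ)))
  have hk : ∀ i, MemLp (k i) 2 volume := by
    rintro (j | j | _)
    · exact memLp_test_mul (hV j) (hd j) (hs j)
    · exact memLp_test_mul (hV j) h1.continuous h2
    · exact memLp_test_mul hW h1.continuous h2
  have hk0 : ∀ i, ∀ x ∉ tsupport φ, k i x = 0 := by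
    intro i x hx
    have e1 : φ x = 0 := image_eq_zero_of_notMem_tsupport hx
    have e2 : fderiv ℝ φ x = 0 := by
      by_contra hne
      exact hx (support_fderiv_subset ℝ hne)
    rcases i with j | j | _
    · simp [k, e2]
    · simp [k, e1]
    · simp [k, e1]
  have hG : ∀ i, IsL2Loc (G i) := by
    rintro (j | j | _)
    · exact hgc
    · exact hgc' j
    · exact hgc
  have key := sum_integral_eq_zero_of_mollified hk h2 hk0 hG fun η hη hηc => by
    set m : Plane → ℝ := fun x => ∫ y, η y * g (x - y) with hm
    have hms : ContDiff ℝ ∞ m := contDiff_mollify hg.locallyIntegrable hη hηc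
    have hmd : ∀ j x, fderiv ℝ m x (coordVec j) = ∫ y, η y * g' j (x - y) := fun j x =>
      fderiv_mollify (hw j) hη hηc x
    have e1 : ∀ x, ∫ y, (η y : ℂ) * (g (x - y) : ℂ) = (m x : ℂ) := by
      intro x
      rw [hm, ← integral_complex_ofReal]
      simp
    have e2 : ∀ j x, ∫ y, (η y : ℂ) * (g' j (x - y) : ℂ) =
        ((fderiv ℝ m x (coordVec j) : ℝ) : ℂ) := by
      intro j x
      rw [hmd, ← integral_complex_ofReal]
      simp
    have hφm : ContDiff ℝ ∞ fun x => φ x * m x := h1.mul hms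
    have hφmc : HasCompactSupport fun x => φ x * m x := h2.mul_right
    have h3 := h.integral_eq _ hφm hφmc
    have e3 : ∀ x j, fderiv ℝ (fun x => φ x * m x) x (coordVec j) =
        fderiv ℝ φ x (coordVec j) * m x + φ x * fderiv ℝ m x (coordVec j) := by
      intro x j
      rw [fderiv_fun_mul (h1.differentiable (by simp) x) (hms.differentiable (by simp) x)]
      simp
      ring
    have i1 : ∀ j, Integrable fun x => (fderiv ℝ φ x (coordVec j) * m x) • V j x := fun j =>
      integrable_test_smul (h.left j) ((hd j).mul hms.continuous) (hs j).mul_right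
    have i2 : ∀ j, Integrable fun x => (φ x * fderiv ℝ m x (coordVec j)) • V j x := fun j =>
      integrable_test_smul (h.left j) (h1.continuous.mul (continuous_test_fderiv hms _))
        h2.mul_right
    simp only [e3, add_smul] at h3
    simp only [fun j => integral_add (i1 j) (i2 j), Finset.sum_add_distrib] at h3
    simp only [Fintype.sum_sum_type, Finset.univ_unique, Finset.sum_singleton, k, G, Sum.elim_inl,
      Sum.elim_inr, e1, e2]
    have r1 : ∀ j x, (((fderiv ℝ φ x (coordVec j) : ℝ) : ℂ) * V j x) * (m x : ℂ) =
        (fderiv ℝ φ x (coordVec j) * m x) • V j x := by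
      intro j x
      rw [Complex.real_smul]
      push_cast
      ring
    have r2 : ∀ j x, ((φ x : ℂ) * V j x) * ((fderiv ℝ m x (coordVec j) : ℝ) : ℂ) =
        (φ x * fderiv ℝ m x (coordVec j)) • V j x := by
      intro j x
      rw [Complex.real_smul]
      push_cast
      ring
    have r3 : ∀ x, ((φ x : ℂ) * W x) * (m x : ℂ) = (φ x * m x) • W x := by
      intro x
      rw [Complex.real_smul]
      push_cast
      ring
    simp only [r1, r2, r3]
    rw [← add_assoc, h3, neg_add_cancel]
  simp only [Fintype.sum_sum_type, Finset.univ_unique, Finset.sum_singleton, k, G, Sum.elim_inl,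
    Sum.elim_inr] at key
  have i2 : ∀ j, Integrable fun x => φ x • (V j x * (g' j x : ℂ)) := fun j =>
    integrable_test_smul (l2 j) h1.continuous h2
  simp only [smul_add, Finset.smul_sum]
  rw [integral_add (integrable_finsetSum _ fun j _ => i2 j)
    (integrable_test_smul l3 h1.continuous h2), integral_finsetSum _ fun j _ => i2 j,
    eq_neg_iff_add_eq_zero]
  simpa only [Complex.real_smul, mul_assoc] using key

/-- The real rule, applied to Re g and Im g. -/
theorem mul {g : Plane → ℂ} {g' : Fin 2 → Plane → ℂ} (h : HasWeakDiv V W)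
    (hV : ∀ j, IsL2Loc (V j)) (hW : IsL2Loc W) (hg : IsL2Loc g) (hg' : ∀ j, IsL2Loc (g' j))
    (hw : ∀ j, HasWeakPartial j g (g' j)) :
    HasWeakDiv (fun j x => V j x * g x) (fun x => ∑ j, V j x * g' j x + W x * g x) := by
  have h1 := h.mul_ofReal hV hW (hg.clm_comp Complex.reCLM)
    (fun j => (hg' j).clm_comp Complex.reCLM) (fun j => (hw j).clm_comp Complex.reCLM)
  have h2 := h.mul_ofReal hV hW (hg.clm_comp Complex.imCLM)
    (fun j => (hg' j).clm_comp Complex.imCLM) (fun j => (hw j).clm_comp Complex.imCLM)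
  refine (h1.add (h2.const_mul Complex.I)).congr (fun j => Eventually.of_forall fun x => ?_)
    (Eventually.of_forall fun x => ?_)
  · simp only [Complex.reCLM_apply, Complex.imCLM_apply]
    conv_rhs => rw [← Complex.re_add_im (g x)]
    ring
  · simp only [Complex.reCLM_apply, Complex.imCLM_apply, Fin.sum_univ_two]
    conv_rhs => rw [← Complex.re_add_im (g x), ← Complex.re_add_im (g' 0 x),
      ← Complex.re_add_im (g' 1 x)]
    ring

end HasWeakDiv

/-- The product rule for weak derivatives. -/
theorem HasWeakPartial.mul {j : Fin 2} {f f' g : Plane → ℂ} {g' : Fin 2 → Plane → ℂ}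
    (h : HasWeakPartial j f f') (hf : IsL2Loc f) (hf' : IsL2Loc f') (hg : IsL2Loc g)
    (hg' : ∀ j, IsL2Loc (g' j)) (hw : ∀ j, HasWeakPartial j g (g' j)) :
    HasWeakPartial j (fun x => f x * g x) (fun x => f x * g' j x + f' x * g x) := by
  rw [← HasWeakDiv.single_iff] at h ⊢
  refine (h.mul (fun i => ?_) hf' hg hg' hw).congr (fun i => Eventually.of_forall fun x => ?_)
    (Eventually.of_forall fun x => ?_)
  · by_cases hi : i = j
    · simpa [hi] using hf
    · intro K _
      simp [hi]
  · by_cases hi : i = j <;> simp [hi]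
  · simp [ite_mul, Finset.sum_ite_eq']

/-! ### The divergence theorem on the fundamental cell. -/

section CellIntegral

theorem hasWeakPartial_of_contDiff {E : Type} [NormedAddCommGroup E] [NormedSpace ℝ E]
    {f : Plane → E} (hf : ContDiff ℝ 1 f) (j : Fin 2) :
    HasWeakPartial j f fun x => fderiv ℝ f x (coordVec j) := by
  have hc : Continuous fun x => fderiv ℝ f x (coordVec j) :=
    (hf.continuous_fderiv one_ne_zero).clm_apply continuous_const
  refine ⟨hf.continuous.locallyIntegrable, hc.locallyIntegrable, fun φ h1 h2 => ?_⟩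
  have hd := continuous_test_fderiv h1 (coordVec j)
  have hs : HasCompactSupport fun x => fderiv ℝ φ x (coordVec j) := h2.fderiv_apply ℝ _
  have := integral_smul_fderiv_eq_neg_fderiv_smul_of_integrable (μ := volume) (f := φ) (g := f)
    (v := coordVec j) (integrable_test_smul hf.continuous.locallyIntegrable hd hs)
    (integrable_test_smul hc.locallyIntegrable h1.continuous h2)
    (integrable_test_smul hf.continuous.locallyIntegrable h1.continuous h2)
    (fun x _ => h1.differentiable (by simp) x) (fun x _ => hf.differentiable one_ne_zero x)
  rw [this, neg_neg]

theorem integral_fderiv_test_eq_zero {η : Plane → ℝ} (hη : ContDiff ℝ ∞ η)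
    (hηc : HasCompactSupport η) (j : Fin 2) : ∫ x, fderiv ℝ η x (coordVec j) = 0 := by
  have h := (hasWeakPartial_of_contDiff (f := fun _ => (1 : ℝ)) contDiff_const j).2.2 η hη hηc
  simpa using h

variable {τ : UpperHalfPlane}

theorem locallyIntegrable_indicator_cell :
    LocallyIntegrable ((cell τ).indicator fun _ => (1 : ℝ)) := by
  have : Integrable ((cell τ).indicator fun _ => (1 : ℝ)) :=
    (integrable_indicator_iff (measurableSet_cell τ)).2 (integrable_const _)
  exact this.locallyIntegrable

/-- By Fubini the left side is an average, with weight θ(y), of the integrals of f over the cell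
translated by y; by periodicity each of these is the integral over the cell itself. -/
theorem integral_periodization {θ : Plane → ℝ} (hθ : Continuous θ) (hθc : HasCompactSupport θ)
    {f : Plane → ℂ} (hf : LocallyIntegrable f) (hper : IsPeriodic τ f) :
    ∫ x, (∫ y, θ y * (cell τ).indicator (fun _ => (1 : ℝ)) (x - y)) • f x =
      (∫ y, θ y) • ∫ x in cell τ, f x := by
  obtain ⟨K, hK, hcell⟩ := cell_subset_ball τ
  obtain ⟨K', hK', hsub⟩ := exists_compact_sub hK (hθc.isCompact.neg)
  set χ : Plane → ℝ := (cell τ).indicator fun _ => (1 : ℝ) with hχ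
  have hχm : Measurable χ := measurable_const.indicator (measurableSet_cell τ)
  have hχ1 : ∀ x, ‖χ x‖ ≤ 1 := fun x => by
    by_cases hx : x ∈ cell τ <;> simp [hχ, hx]
  have hfK : Integrable (K'.indicator f) :=
    (integrable_indicator_iff hK'.measurableSet).2 ((locallyIntegrable_iff.1 hf) K' hK')
  have hθi : Integrable θ := hθ.integrable_of_hasCompactSupport hθc
  have hint : Integrable (fun p : Plane × Plane => (θ p.2 * χ (p.1 - p.2)) • f p.1)
      (volume.prod volume) := by
    have h1 : Integrable (fun p : Plane × Plane => K'.indicator f p.1 * (θ p.2 : ℂ))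
        (volume.prod volume) := hfK.mul_prod hθi.ofReal
    have h2 := h1.bdd_mul (c := 1) (f := fun p : Plane × Plane => (χ (p.1 - p.2) : ℂ)) (by
      refine (Complex.measurable_ofReal.comp (hχm.comp ?_)).aestronglyMeasurable
      exact measurable_fst.sub measurable_snd)
      (Eventually.of_forall fun p => by rw [Complex.norm_real]; exact hχ1 _)
    refine h2.congr (Eventually.of_forall fun p => ?_)
    simp only [Complex.real_smul]
    by_cases h3 : p.1 ∈ K'
    · rw [indicator_of_mem h3]
      push_cast
      ring
    · rw [indicator_of_notMem h3]
      by_cases h4 : p.2 ∈ tsupport θ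
      · have h5 : p.1 - p.2 ∉ cell τ := by
          intro h5
          apply h3
          have := hsub _ (hcell h5) (-p.2) (by simpa using h4)
          simpa using this
        simp [hχ, h5]
      · simp [image_eq_zero_of_notMem_tsupport h4]
  simp only [← integral_smul_const]
  rw [integral_integral_swap (f := fun x y => (θ y * χ (x - y)) • f x) hint]
  refine integral_congr_ae (Eventually.of_forall fun y => ?_)
  dsimp only
  simp only [mul_smul]
  rw [integral_smul, ← hper.setIntegral_add_right y, ← integral_add_right_eq_self _ y,
    ← integral_indicator (measurableSet_cell τ)]
  congr 1
  refine integral_congr_ae (Eventually.of_forall fun x => ?_)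
  by_cases hx : x ∈ cell τ <;> simp [hχ, hx]

/-- The divergence theorem on the fundamental cell. -/
theorem HasWeakDiv.setIntegral_cell_eq_zero {V : Fin 2 → Plane → ℂ} {W : Plane → ℂ}
    (h : HasWeakDiv V W) (hV : ∀ j, IsPeriodic τ (V j)) (hW : IsPeriodic τ W) :
    ∫ x in cell τ, W x = 0 := by
  let b : ContDiffBump (0 : Plane) := ⟨1, 2, one_pos, one_lt_two⟩
  have hη : ContDiff ℝ ∞ b := b.contDiff
  have hηc : HasCompactSupport b := b.hasCompactSupport
  set χ : Plane → ℝ := (cell τ).indicator fun _ => (1 : ℝ) with hχ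
  -- The test function is the mollified indicator of the cell. Against periodic functions it acts as
  -- ∫ b times integration over the cell, while its derivatives, mollified by ∂ⱼb, act as zero
  -- because ∂ⱼb has integral zero.
  have hφ : ContDiff ℝ ∞ fun x => ∫ y, b y * χ (x - y) :=
    contDiff_mollify locallyIntegrable_indicator_cell hη hηc
  obtain ⟨K, hK, hcell⟩ := cell_subset_ball τ
  have hχc : HasCompactSupport χ := HasCompactSupport.intro hK fun x hx =>
    indicator_of_notMem (fun h => hx (hcell h)) _
  have hφc : HasCompactSupport fun x => ∫ y, b y * χ (x - y) :=
    hηc.convolution (ContinuousLinearMap.lsmul ℝ ℝ) hχc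
  have hd : ∀ j x, fderiv ℝ (fun x => ∫ y, b y * χ (x - y)) x (coordVec j) =
      ∫ y, fderiv ℝ b y (coordVec j) * χ (x - y) := by
    intro j x
    have h1 := hηc.hasFDerivAt_convolution_left (μ := volume) (ContinuousLinearMap.lsmul ℝ ℝ)
      (hη.of_le (by simp)) (locallyIntegrable_indicator_cell (τ := τ)) x
    have h1' : HasFDerivAt (fun x => ∫ y, b y * χ (x - y)) _ x := h1
    have hcex := (hηc.fderiv ℝ).convolutionExists_left
      ((ContinuousLinearMap.lsmul ℝ ℝ).precompL Plane) (hη.continuous_fderiv (by simp))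
      (locallyIntegrable_indicator_cell (τ := τ)) x (μ := volume)
    rw [h1'.fderiv, convolution_def, ContinuousLinearMap.integral_apply hcex]
    simp [ContinuousLinearMap.precompL_apply, hχ]
  have h1 := h.integral_eq _ hφ hφc
  simp only [hd] at h1
  rw [integral_periodization hη.continuous hηc h.right hW] at h1
  have h2 : ∀ j, ∫ x, (∫ y, fderiv ℝ b y (coordVec j) * χ (x - y)) • V j x = 0 := by
    intro j
    rw [integral_periodization (continuous_test_fderiv hη _) (hηc.fderiv_apply ℝ _) (h.left j)
      (hV j), integral_fderiv_test_eq_zero hη hηc, zero_smul]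
  simp only [h2, Finset.sum_const_zero] at h1
  have h3 := b.integral_pos (μ := volume)
  exact (smul_eq_zero.1 (neg_eq_zero.1 h1.symm)).resolve_left h3.ne'

/-- Multiplication by a conjugate, with covariant derivatives. -/
theorem HasWeakDiv.mul_conj {a : Fin 2 → Plane → ℝ} (ha : ∀ j, Continuous (a j))
    {V : Fin 2 → Plane → ℂ} {W g : Plane → ℂ} {g' : Fin 2 → Plane → ℂ}
    (h : HasWeakDiv V fun x => W x + ∑ j, Complex.I * (a j x : ℂ) * V j x)
    (hV : ∀ j, IsL2Loc (V j)) (hW : IsL2Loc W) (hg : IsL2Loc g) (hg' : ∀ j, IsL2Loc (g' j))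
    (hw : ∀ j, HasWeakPartial j g fun x => g' j x + Complex.I * (a j x : ℂ) * g x) :
    HasWeakDiv (fun j x => V j x * conj (g x))
      (fun x => ∑ j, V j x * conj (g' j x) + W x * conj (g x)) := by
  have hac : ∀ j, Continuous fun x => Complex.I * (a j x : ℂ) := fun j =>
    continuous_const.mul (Complex.continuous_ofReal.comp (ha j))
  have hW' : IsL2Loc fun x => W x + ∑ j, Complex.I * (a j x : ℂ) * V j x := by
    simp only [Fin.sum_univ_two]
    exact hW.add (((hV 0).continuous_mul (hac 0)).add ((hV 1).continuous_mul (hac 1)))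
  have hg2 : ∀ j, IsL2Loc fun x => g' j x + Complex.I * (a j x : ℂ) * g x := fun j =>
    (hg' j).add (hg.continuous_mul (hac j))
  have := h.mul hV hW' (hg.clm_comp (Complex.conjCLE : ℂ →L[ℝ] ℂ))
    (fun j => (hg2 j).clm_comp (Complex.conjCLE : ℂ →L[ℝ] ℂ))
    (fun j => (hw j).clm_comp (Complex.conjCLE : ℂ →L[ℝ] ℂ))
  refine this.congr (fun j => EventuallyEq.rfl) (Eventually.of_forall fun x => ?_)
  simp [Fin.sum_univ_two]
  ring

/-- Integration by parts on the fundamental cell, with covariant derivatives. -/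
theorem HasWeakDiv.cell_pairing {a : Fin 2 → Plane → ℝ} (ha : ∀ j, Continuous (a j))
    {V : Fin 2 → Plane → ℂ} {W g : Plane → ℂ} {g' : Fin 2 → Plane → ℂ}
    (h : HasWeakDiv V fun x => W x + ∑ j, Complex.I * (a j x : ℂ) * V j x)
    (hV : ∀ j, IsL2Loc (V j)) (hW : IsL2Loc W) (hg : IsL2Loc g) (hg' : ∀ j, IsL2Loc (g' j))
    (hw : ∀ j, HasWeakPartial j g fun x => g' j x + Complex.I * (a j x : ℂ) * g x)
    {m : ℤ → ℤ → Plane → ℂ} (hm : ∀ p q x, ‖m p q x‖ = 1)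
    (pV : ∀ j, ∀ p q : ℤ, ∀ᵐ x : Plane, V j (x + latticeVec τ p q) = m p q x * V j x)
    (pW : ∀ p q : ℤ, ∀ᵐ x : Plane, W (x + latticeVec τ p q) = m p q x * W x)
    (pg : ∀ p q : ℤ, ∀ᵐ x : Plane, g (x + latticeVec τ p q) = m p q x * g x)
    (pg' : ∀ j, ∀ p q : ℤ, ∀ᵐ x : Plane, g' j (x + latticeVec τ p q) = m p q x * g' j x) :
    ∫ x in cell τ, (∑ j, V j x * conj (g' j x) + W x * conj (g x)) = 0 := by
  -- The multiplier of one factor cancels against that of the conjugated factor, so all the products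
  -- are periodic.
  have hmm : ∀ p q x, m p q x * conj (m p q x) = 1 := by
    intro p q x
    rw [Complex.mul_conj, Complex.normSq_eq_norm_sq, hm]
    simp
  refine (h.mul_conj ha hV hW hg hg' hw).setIntegral_cell_eq_zero (fun j p q => ?_) fun p q => ?_
  · filter_upwards [pV j p q, pg p q] with x h1 h2
    rw [h1, h2, map_mul]
    linear_combination (V j x * conj (g x)) * hmm p q x
  · filter_upwards [pV 0 p q, pV 1 p q, pW p q, pg p q, pg' 0 p q, pg' 1 p q]
      with x h1 h2 h3 h4 h5 h6
    simp only [Fin.sum_univ_two]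
    rw [h1, h2, h3, h4, h5, h6, map_mul, map_mul, map_mul]
    linear_combination (V 0 x * conj (g' 0 x) + V 1 x * conj (g' 1 x) + W x * conj (g x)) *
      hmm p q x

end CellIntegral

/-! ### Completeness of the Sobolev spaces. -/

section Completeness

theorem norm_phase (n : ℕ) (τ : UpperHalfPlane) (p q : ℤ) (x : Plane) : ‖phase n τ p q x‖ = 1 :=
  Complex.norm_exp_I_mul_ofReal _

variable {𝕜 E : Type} [RCLike 𝕜] [NormedAddCommGroup E] [InnerProductSpace 𝕜 E]
  [NormedSpace ℝ E] [SMulCommClass ℝ 𝕜 E] {τ : UpperHalfPlane} {m : ℤ → ℤ → Plane → 𝕜}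
  {c : Fin 2 → Plane → 𝕜}

omit [NormedSpace ℝ E] [SMulCommClass ℝ 𝕜 E] in
theorem locallyIntegrable_continuous_smul {f : Plane → E} (hf : LocallyIntegrable f)
    {b : Plane → 𝕜} (hb : Continuous b) : LocallyIntegrable fun x => b x • f x := by
  rw [locallyIntegrable_iff] at hf ⊢
  exact fun K hK => (hf K hK).continuousOn_smul hb.continuousOn hK

omit [SMulCommClass ℝ 𝕜 E] in
-- Each of the three integrals in the weak formulation is continuous for the norm of the cell, by
-- `QP.tendsto_integral`.
theorem weakCov_closed {b : Plane → 𝕜} (hb : Continuous b) (hm : ∀ p q x, ‖m p q x‖ = 1)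
    (j : Fin 2) {u v : ℕ → QP 𝕜 E τ m} {f g : QP 𝕜 E τ m}
    (h : ∀ k, HasWeakPartial j (u k).1 fun x => (v k).1 x + b x • (u k).1 x)
    (hu : Tendsto u atTop (𝓝 f)) (hv : Tendsto v atTop (𝓝 g)) :
    HasWeakPartial j f.1 fun x => g.1 x + b x • f.1 x := by
  have hbf : ∀ w : QP 𝕜 E τ m, LocallyIntegrable fun x => b x • w.1 x := fun w =>
    locallyIntegrable_continuous_smul w.locallyIntegrable hb
  refine ⟨f.locallyIntegrable, g.locallyIntegrable.add (hbf f), fun φ h1 h2 => ?_⟩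
  have hd := continuous_test_fderiv h1 (coordVec j)
  have hs : HasCompactSupport fun x => fderiv ℝ φ x (coordVec j) := h2.fderiv_apply ℝ _
  obtain ⟨C1, hC1⟩ := hs.exists_bound_of_continuous hd
  obtain ⟨C2, hC2⟩ := h2.exists_bound_of_continuous h1.continuous
  obtain ⟨C3, hC3⟩ := (h2.smul_right (f' := b)).exists_bound_of_continuous
    (h1.continuous.smul hb)
  have t1 := QP.tendsto_integral hm hs (C := C1)
    (fun x => DistribSMul.toAddMonoidHom E (fderiv ℝ φ x (coordVec j)))
    (fun x w => by
      simp only [DistribSMul.toAddMonoidHom_apply, norm_smul]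
      exact mul_le_mul_of_nonneg_right (hC1 x) (norm_nonneg _))
    (fun x hx w => by
      simp only [DistribSMul.toAddMonoidHom_apply]
      rw [image_eq_zero_of_notMem_tsupport (f := fun x => fderiv ℝ φ x (coordVec j)) hx, zero_smul])
    (fun w => integrable_test_smul w.locallyIntegrable hd hs) hu
  have t2 := QP.tendsto_integral hm h2 (C := C2)
    (fun x => DistribSMul.toAddMonoidHom E (φ x))
    (fun x w => by
      simp only [DistribSMul.toAddMonoidHom_apply, norm_smul]
      exact mul_le_mul_of_nonneg_right (hC2 x) (norm_nonneg _))
    (fun x hx w => by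
      simp only [DistribSMul.toAddMonoidHom_apply]
      rw [image_eq_zero_of_notMem_tsupport hx, zero_smul])
    (fun w => integrable_test_smul w.locallyIntegrable h1.continuous h2) hv
  have t3 := QP.tendsto_integral hm h2 (C := C3)
    (fun x => (DistribSMul.toAddMonoidHom E (φ x)).comp (DistribSMul.toAddMonoidHom E (b x)))
    (fun x w => by
      have := hC3 x
      simp only [AddMonoidHom.comp_apply, DistribSMul.toAddMonoidHom_apply, norm_smul]
      rw [Pi.smul_apply', norm_smul] at this
      rw [← mul_assoc]
      exact mul_le_mul_of_nonneg_right this (norm_nonneg _))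
    (fun x hx w => by
      simp only [AddMonoidHom.comp_apply, DistribSMul.toAddMonoidHom_apply]
      rw [image_eq_zero_of_notMem_tsupport hx, zero_smul])
    (fun w => integrable_test_smul (hbf w) h1.continuous h2) hu
  simp only [AddMonoidHom.comp_apply, DistribSMul.toAddMonoidHom_apply] at t1 t2 t3
  have e : ∀ w z : QP 𝕜 E τ m, ∫ x, φ x • (z.1 x + b x • w.1 x) =
      (∫ x, φ x • z.1 x) + ∫ x, φ x • b x • w.1 x := by
    intro w z
    simp only [smul_add]
    exact integral_add (integrable_test_smul z.locallyIntegrable h1.continuous h2)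
      (integrable_test_smul (hbf w) h1.continuous h2)
  rw [e]
  refine tendsto_nhds_unique t1 ((t2.add t3).neg.congr fun k => ?_)
  rw [← e, (h k).2.2 φ h1 h2]

theorem isClosed_sobolevJets (hm : ∀ p q x, ‖m p q x‖ = 1) (hc : ∀ j, Continuous (c j)) :
    IsClosed (sobolevJets 𝕜 E τ m c : Set (PiLp 2 fun _ : JetIdx => QP 𝕜 E τ m)) := by
  refine IsSeqClosed.isClosed fun u v hu huv => ?_
  have hi : ∀ i, Tendsto (fun k => u k i) atTop (𝓝 (v i)) := fun i =>
    ((PiLp.continuous_apply 2 (fun _ : JetIdx => QP 𝕜 E τ m) i).tendsto v).comp huv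
  exact ⟨fun j => weakCov_closed (hc j) hm j (fun k => (hu k).1 j) (hi _) (hi _),
    fun k j => weakCov_closed (hc k) hm k (fun l => (hu l).2 k j) (hi _) (hi _)⟩

theorem Sobolev2.completeSpace [CompleteSpace E] (hm : ∀ p q x, ‖m p q x‖ = 1)
    (hc : ∀ j, Continuous (c j)) : CompleteSpace (Sobolev2 𝕜 E τ m c) := by
  have := QP.completeSpace (E := E) (τ := τ) hm
  exact (isClosed_sobolevJets hm hc).completeSpace_coe

theorem Sobolev2.continuous_val :
    Continuous (Sobolev2.val : Sobolev2 𝕜 E τ m c →ₗ[𝕜] QP 𝕜 E τ m) :=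
  (PiLp.continuous_apply 2 (fun _ : JetIdx => QP 𝕜 E τ m) _).comp continuous_subtype_val

end Completeness

/-! ### Closedness of the parity and solenoidal conditions. -/

section Closed

variable {n : ℕ} {τ : UpperHalfPlane}

theorem continuous_bgPotential (n : ℕ) (j : Fin 2) : Continuous fun x => bgPotential n x j := by
  fin_cases j
  · simp [bgPotential, J]
    fun_prop
  · simp [bgPotential, J]
    fun_prop

instance : CompleteSpace (GaugeL2 n τ) := QP.completeSpace (norm_phase n τ)

instance : CompleteSpace (PerL2 τ) := QP.completeSpace (fun _ _ _ => by simp)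

instance : CompleteSpace (GaugeH2 n τ) :=
  Sobolev2.completeSpace (norm_phase n τ) fun j =>
    continuous_const.mul (Complex.continuous_ofReal.comp (continuous_bgPotential n j))

instance : CompleteSpace (PerH2 τ) :=
  Sobolev2.completeSpace (fun _ _ _ => by simp) fun _ => continuous_const

theorem isClosed_evenFunctions : IsClosed (evenFunctions n τ : Set (GaugeL2 n τ)) := by
  refine IsSeqClosed.isClosed fun u v hu huv => ?_
  obtain ⟨ns, -, h⟩ := QP.exists_subseq_ae huv
  have h' := (Measure.measurePreserving_neg (volume : Measure Plane)).quasiMeasurePreserving.ae h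
  have h2 : ∀ᵐ x : Plane, ∀ i, (u (ns i)).1 (-x) = (u (ns i)).1 x := by
    rw [ae_all_iff]
    exact fun i => hu (ns i)
  filter_upwards [h, h', h2] with x h3 h4 h5
  simp only [h5] at h4
  exact tendsto_nhds_unique h4 h3

theorem isClosed_oddFields : IsClosed (oddFields τ : Set (PerL2 τ)) := by
  refine IsSeqClosed.isClosed fun u v hu huv => ?_
  obtain ⟨ns, -, h⟩ := QP.exists_subseq_ae huv
  have h' := (Measure.measurePreserving_neg (volume : Measure Plane)).quasiMeasurePreserving.ae h
  have h2 : ∀ᵐ x : Plane, ∀ i, (u (ns i)).1 (-x) = -(u (ns i)).1 x := by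
    rw [ae_all_iff]
    exact fun i => hu (ns i)
  filter_upwards [h, h', h2] with x h3 h4 h5
  simp only [h5] at h4
  exact tendsto_nhds_unique h4 h3.neg

theorem isClosed_solenoidal : IsClosed (solenoidal τ : Set (PerL2 τ)) := by
  have hm : ∀ (p q : ℤ) (x : Plane), ‖(fun _ _ _ => 1 : ℤ → ℤ → Plane → ℝ) p q x‖ = 1 :=
    fun _ _ _ => by simp
  refine IsSeqClosed.isClosed fun u v hu huv => ⟨fun φ h1 h2 => ?_, ?_⟩
  · have hs : ∀ j, HasCompactSupport fun x => fderiv ℝ φ x (coordVec j) := fun j =>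
      h2.fderiv_apply ℝ _
    choose C hC using fun j => (hs j).exists_bound_of_continuous (continuous_test_fderiv h1 _)
    have hint : ∀ w : PerL2 τ,
        Integrable fun x => ∑ j : Fin 2, fderiv ℝ φ x (coordVec j) * w.1 x j := by
      intro w
      refine integrable_finsetSum _ fun j _ => ?_
      have h3 := integrable_test_smul (QP.locallyIntegrable w)
        (continuous_test_fderiv h1 (coordVec j)) (hs j)
      exact (EuclideanSpace.proj (𝕜 := ℝ) j).integrable_comp h3
    have t := QP.tendsto_integral hm (show IsCompact (tsupport φ) from h2) (C := ∑ j, C j)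
      (fun x => AddMonoidHom.mk' (fun w : Plane => ∑ j, fderiv ℝ φ x (coordVec j) * w j)
        fun a b => by simp [mul_add, Finset.sum_add_distrib])
      (fun x w => by
        simp only [AddMonoidHom.mk'_apply, Finset.sum_mul]
        refine (norm_sum_le _ _).trans (Finset.sum_le_sum fun j _ => ?_)
        rw [norm_mul]
        exact mul_le_mul (hC j x) (PiLp.norm_apply_le w j) (norm_nonneg _)
          ((norm_nonneg _).trans (hC j x)))
      (fun x hx w => by
        have e2 : fderiv ℝ φ x = 0 := by
          by_contra hne
          exact hx (support_fderiv_subset ℝ hne)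
        simp [e2])
      hint huv
    simp only [AddMonoidHom.mk'_apply] at t
    have hz : ∀ k, ∫ x, ∑ j : Fin 2, fderiv ℝ φ x (coordVec j) * (u k).1 x j = 0 :=
      fun k => (hu k).1 φ h1 h2
    exact tendsto_nhds_unique (t.congr hz) tendsto_const_nhds
  · obtain ⟨K, hK, hcell⟩ := cell_subset_ball τ
    classical
    have t := QP.tendsto_integral hm hK (C := 1)
      (fun x => if x ∈ cell τ then AddMonoidHom.id Plane else 0)
      (fun x w => by by_cases hx : x ∈ cell τ <;> simp [hx])
      (fun x hx w => by rw [if_neg fun h => hx (hcell h)]; rfl)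
      (fun w => by
        refine ((integrable_indicator_iff (measurableSet_cell τ)).2 w.integrableOn_cell).congr
          (Eventually.of_forall fun x => ?_)
        by_cases hx : x ∈ cell τ <;> simp [hx])
      huv
    have e : ∀ w : PerL2 τ, ∫ x, (if x ∈ cell τ then AddMonoidHom.id Plane else 0) (w.1 x) =
        ∫ x in cell τ, w.1 x := by
      intro w
      rw [← integral_indicator (measurableSet_cell τ)]
      refine integral_congr_ae (Eventually.of_forall fun x => ?_)
      by_cases hx : x ∈ cell τ <;> simp [hx]
    have hz : ∀ k, ∫ x in cell τ, (u k).1 x = 0 := fun k => (hu k).2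
    simp only [e] at t
    exact tendsto_nhds_unique (t.congr hz) tendsto_const_nhds

instance : CompleteSpace (L2psi n τ) :=
  (isClosed_evenFunctions (n := n) (τ := τ)).completeSpace_coe

instance : CompleteSpace (L2alpha τ) :=
  ((isClosed_solenoidal (τ := τ)).inter isClosed_oddFields).completeSpace_coe

instance : CompleteSpace (H2psi n τ) :=
  ((isClosed_evenFunctions (n := n) (τ := τ)).preimage Sobolev2.continuous_val).completeSpace_coe

instance : CompleteSpace (H2alpha τ) :=
  (((isClosed_solenoidal (τ := τ)).inter isClosed_oddFields).preimage
    Sobolev2.continuous_val).completeSpace_coe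

end Closed

/-! ### Ranges of abstract self-adjoint operators. -/

section SelfAdjoint

variable {𝕜 X Y : Type*} [RCLike 𝕜] [AddCommGroup X] [Module 𝕜 X] [NormedAddCommGroup Y]
  [InnerProductSpace 𝕜 Y] {ι A : X →ₗ[𝕜] Y}

/-- `A`, as an operator with domain `ι X`, is self-adjoint: the graph of its adjoint is its own
graph. -/
def IsGraphSelfAdjoint (ι A : X →ₗ[𝕜] Y) : Prop :=
  ∀ y w : Y, (∀ x, inner 𝕜 (A x) y = inner 𝕜 (ι x) w) ↔ ∃ x, ι x = y ∧ A x = w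

theorem IsGraphSelfAdjoint.symm (h : IsGraphSelfAdjoint ι A) (x y : X) :
    inner 𝕜 (A x) (ι y) = inner 𝕜 (ι x) (A y) :=
  (h (ι y) (A y)).2 ⟨y, rfl, rfl⟩ x

theorem IsGraphSelfAdjoint.add_real (h : IsGraphSelfAdjoint ι A) (r : ℝ) :
    IsGraphSelfAdjoint ι (A + (r : 𝕜) • ι) := by
  intro y w
  have h1 := h y (w - (r : 𝕜) • y)
  have e : ∀ x, inner 𝕜 ((A + (r : 𝕜) • ι) x) y = inner 𝕜 (ι x) w ↔
      inner 𝕜 (A x) y = inner 𝕜 (ι x) (w - (r : 𝕜) • y) := by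
    intro x
    simp only [LinearMap.add_apply, LinearMap.smul_apply, inner_add_left, inner_smul_left,
      inner_sub_right, inner_smul_right, RCLike.conj_ofReal]
    exact eq_sub_iff_add_eq.symm
  simp only [e, h1]
  refine exists_congr fun x => and_congr_right fun hx => ?_
  simp only [LinearMap.add_apply, LinearMap.smul_apply, hx]
  exact eq_sub_iff_add_eq

/-- The graph of a self-adjoint operator is closed. -/
theorem IsGraphSelfAdjoint.exists_of_tendsto (h : IsGraphSelfAdjoint ι A) {u : ℕ → X} {y w : Y}
    (hy : Tendsto (fun k => ι (u k)) atTop (𝓝 y)) (hw : Tendsto (fun k => A (u k)) atTop (𝓝 w)) :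
    ∃ x, ι x = y ∧ A x = w := by
  refine (h y w).1 fun x => ?_
  have t1 : Tendsto (fun k => inner 𝕜 (A x) (ι (u k))) atTop (𝓝 (inner 𝕜 (A x) y)) :=
    tendsto_const_nhds.inner hy
  have t2 : Tendsto (fun k => inner 𝕜 (ι x) (A (u k))) atTop (𝓝 (inner 𝕜 (ι x) w)) :=
    tendsto_const_nhds.inner hw
  simp only [h.symm] at t1
  exact tendsto_nhds_unique t1 t2

theorem cauchySeq_of_norm_sub_le {E F : Type*} [NormedAddCommGroup E] [NormedAddCommGroup F]
    {u : ℕ → E} {v : ℕ → F} {c : ℝ} (hc : 0 < c) (hv : CauchySeq v)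
    (h : ∀ k l, c * ‖u k - u l‖ ≤ ‖v k - v l‖) : CauchySeq u := by
  rw [Metric.cauchySeq_iff] at hv ⊢
  intro ε hε
  obtain ⟨N, hN⟩ := hv (c * ε) (by positivity)
  refine ⟨N, fun k hk l hl => ?_⟩
  have := hN k hk l hl
  rw [dist_eq_norm] at this ⊢
  exact lt_of_mul_lt_mul_left ((h k l).trans_lt this) hc.le

variable [CompleteSpace Y]

/-- The range of a self-adjoint operator is dense in the orthogonal complement of its kernel. -/
theorem IsGraphSelfAdjoint.exists_seq (h : IsGraphSelfAdjoint ι A) {y : Y}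
    (hy : ∀ x, A x = 0 → inner 𝕜 (ι x) y = 0) :
    ∃ z : ℕ → X, Tendsto (fun k => A (z k)) atTop (𝓝 y) := by
  have h1 : y ∈ closure (LinearMap.range A : Set Y) := by
    rw [← Submodule.topologicalClosure_coe, SetLike.mem_coe,
      ← Submodule.orthogonal_orthogonal_eq_closure, Submodule.mem_orthogonal]
    intro w hw
    -- A vector orthogonal to the range lies in the domain of the adjoint with value 0, so it lies
    -- in the kernel.
    obtain ⟨x, hx1, hx2⟩ := (h w 0).1 fun x => by
      rw [inner_zero_right]
      exact (Submodule.mem_orthogonal _ _).1 hw _ ⟨x, rfl⟩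
    rw [← hx1]
    exact hy x hx2
  obtain ⟨v, hv, hvy⟩ := mem_closure_iff_seq_limit.1 h1
  choose z hz using hv
  exact ⟨z, by simpa only [hz] using hvy⟩

/-- The lower bound makes the kernel trivial in `Y`, so the range is dense, and it turns convergence
of `A (z k)` into convergence of `ι (z k)`; the graph is closed. -/
theorem IsGraphSelfAdjoint.surjective_of_bound (h : IsGraphSelfAdjoint ι A) {c : ℝ} (hc : 0 < c)
    (hb : ∀ x, c * ‖ι x‖ ≤ ‖A x‖) : Function.Surjective A := by
  intro y
  obtain ⟨z, hz⟩ := h.exists_seq (y := y) fun x hx => by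
    have h1 := hb x
    rw [hx, norm_zero] at h1
    have h2 : ‖ι x‖ = 0 := by nlinarith [norm_nonneg (ι x)]
    rw [norm_eq_zero.1 h2, inner_zero_left]
  obtain ⟨v, hv⟩ := cauchySeq_tendsto_of_complete
    (cauchySeq_of_norm_sub_le (u := fun k => ι (z k)) hc hz.cauchySeq fun k l => by
      simpa only [map_sub] using hb (z k - z l))
  obtain ⟨x, -, hx⟩ := h.exists_of_tendsto hv hz
  exact ⟨x, hx⟩

/-- The range of a nonnegative self-adjoint operator `A` with `A² ≥ c A` and with a kernel of
dimension one is the orthogonal complement of the kernel. -/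
theorem IsGraphSelfAdjoint.exists_of_gap (h : IsGraphSelfAdjoint ι A) {c : ℝ} (hc : 0 < c)
    (hpos : ∀ x, 0 ≤ RCLike.re (inner 𝕜 (A x) (ι x)))
    (hgap : ∀ x, c * RCLike.re (inner 𝕜 (A x) (ι x)) ≤ ‖A x‖ ^ 2) {x₀ : X} (hx₀ : A x₀ = 0)
    (hne : ι x₀ ≠ 0)
    (hker : ∀ x, A x = 0 → ∃ a : 𝕜, x = a • x₀) {y : Y} (hy : inner 𝕜 (ι x₀) y = 0) :
    ∃ x, A x = y := by
  have hker' : ∀ {v : Y}, inner 𝕜 (ι x₀) v = 0 → ∀ x, A x = 0 → inner 𝕜 (ι x) v = 0 := by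
    intro v hv x hx
    obtain ⟨a, rfl⟩ := hker x hx
    rw [map_smul, inner_smul_left, hv, mul_zero]
  -- Cauchy–Schwarz for the nonnegative form ⟨A ·, ι ·⟩ gives ‖ι x‖⁴ ≤ ⟨A x, ι x⟩⟨A z, ι z⟩ when A z
  -- = ι x, and the gap gives c⟨A z, ι z⟩ ≤ ‖ι x‖². Hence c‖ι x‖² ≤ ⟨A x, ι x⟩ ≤ ‖A x‖‖ι x‖.
  have hran : ∀ z x, A z = ι x → c * ‖ι x‖ ≤ ‖A x‖ := by
    intro z x hzx
    set b := ‖ι x‖ ^ 2 with hb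
    have h1 : RCLike.re (inner 𝕜 (A z) (ι x)) = b := by
      rw [hzx, inner_self_eq_norm_sq]
    have h2 : RCLike.re (inner 𝕜 (A x) (ι z)) = b := by
      rw [h.symm, hzx, inner_self_eq_norm_sq]
    have hquad : ∀ t : ℝ, 0 ≤ RCLike.re (inner 𝕜 (A x) (ι x)) * (t * t) + 2 * b * t +
        RCLike.re (inner 𝕜 (A z) (ι z)) := by
      intro t
      have h3 := hpos (z + (t : 𝕜) • x)
      simp only [map_add, map_smul, inner_add_left, inner_add_right, inner_smul_left,
        inner_smul_right, RCLike.conj_ofReal, RCLike.re_ofReal_mul, h1, h2] at h3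
      nlinarith
    have h4 := discrim_le_zero hquad
    rw [discrim] at h4
    have h5 := hgap z
    rw [hzx] at h5
    have h7 := hpos x
    have h8 : RCLike.re (inner 𝕜 (A x) (ι x)) ≤ ‖A x‖ * ‖ι x‖ := re_inner_le_norm _ _
    rcases (norm_nonneg (ι x)).eq_or_lt with h0 | h0
    · rw [← h0]
      simp
    · have hb0 : 0 < b := by positivity
      have h6 : b * b ≤ RCLike.re (inner 𝕜 (A x) (ι x)) * RCLike.re (inner 𝕜 (A z) (ι z)) := by
        nlinarith
      rw [hzx] at h6
      have h9 : c * b ≤ RCLike.re (inner 𝕜 (A x) (ι x)) := by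
        have : (c * b) * b ≤ RCLike.re (inner 𝕜 (A x) (ι x)) * b := by
          nlinarith [mul_le_mul_of_nonneg_left h5 h7]
        exact le_of_mul_le_mul_right this hb0
      have h10 : (c * ‖ι x‖) * ‖ι x‖ ≤ ‖A x‖ * ‖ι x‖ := by nlinarith
      exact le_of_mul_le_mul_right h10 h0
  have h1 : IsGraphSelfAdjoint ι (A + ((1 : ℝ) : 𝕜) • ι) := h.add_real 1
  have hB : ∀ x, 1 * ‖ι x‖ ≤ ‖(A + ((1 : ℝ) : 𝕜) • ι) x‖ := by
    intro x
    have e : ‖(A + ((1 : ℝ) : 𝕜) • ι) x‖ ^ 2 =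
        ‖A x‖ ^ 2 + 2 * RCLike.re (inner 𝕜 (A x) (ι x)) + ‖ι x‖ ^ 2 := by
      simp [norm_add_sq (𝕜 := 𝕜)]
    rw [one_mul]
    refine le_of_sq_le_sq ?_ (norm_nonneg _)
    nlinarith [hpos x, sq_nonneg ‖A x‖]
  have hsurj := h1.surjective_of_bound one_pos hB
  -- The bound extends from vectors in the range to all x orthogonal to x₀. Choose A z_k → (A + 1) x
  -- and solve (A + 1) u_k = A z_k. Then ι u_k = A(z_k - u_k) is in the range, and ι u_k → ι x, A
  -- u_k → A x.
  have hest : ∀ x, inner 𝕜 (ι x₀) (ι x) = 0 → c * ‖ι x‖ ≤ ‖A x‖ := by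
    intro x hx
    have hx' : inner 𝕜 (ι x₀) ((A + ((1 : ℝ) : 𝕜) • ι) x) = 0 := by
      simp only [LinearMap.add_apply, LinearMap.smul_apply, inner_add_right, inner_smul_right, hx]
      rw [← h.symm, hx₀]
      simp
    obtain ⟨z, hz⟩ := h.exists_seq (hker' hx')
    choose u hu using fun k => hsurj (A (z k))
    have hd : ∀ k, ‖ι (u k) - ι x‖ ≤ ‖A (z k) - (A + ((1 : ℝ) : 𝕜) • ι) x‖ := by
      intro k
      rw [← hu, ← map_sub, ← map_sub]
      simpa using hB (u k - x)
    have t1 : Tendsto (fun k => ι (u k)) atTop (𝓝 (ι x)) := by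
      rw [tendsto_iff_norm_sub_tendsto_zero] at hz ⊢
      exact squeeze_zero (fun _ => norm_nonneg _) hd hz
    have e2 : ∀ k, A (u k) = A (z k) - ι (u k) := by
      intro k
      rw [← hu]
      simp
    have t2 : Tendsto (fun k => A (u k)) atTop (𝓝 (A x)) := by
      simp only [e2]
      simpa using hz.sub t1
    refine le_of_tendsto_of_tendsto (t1.norm.const_mul c) t2.norm (Eventually.of_forall fun k => ?_)
    refine hran (z k - u k) (u k) ?_
    rw [map_sub, e2]
    abel
  obtain ⟨z, hz⟩ := h.exists_seq (hker' hy)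
  have hn : inner 𝕜 (ι x₀) (ι x₀) ≠ (0 : 𝕜) := inner_self_ne_zero.2 hne
  -- Removing the component along x₀ leaves A z_k unchanged and makes the bound `hest` available for
  -- differences.
  set z' : ℕ → X := fun k =>
    z k - (inner 𝕜 (ι x₀) (ι (z k)) / inner 𝕜 (ι x₀) (ι x₀)) • x₀ with hz'
  have hAz : ∀ k, A (z' k) = A (z k) := fun k => by simp [hz', hx₀]
  have horth : ∀ k, inner 𝕜 (ι x₀) (ι (z' k)) = 0 := by
    intro k
    simp only [hz', map_sub, map_smul, inner_sub_right, inner_smul_right]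
    rw [div_mul_cancel₀ _ hn, sub_self]
  have hc' : CauchySeq fun k => ι (z' k) :=
    cauchySeq_of_norm_sub_le hc hz.cauchySeq fun k l => by
      rw [← map_sub, ← hAz, ← hAz, ← map_sub]
      refine hest _ ?_
      rw [map_sub, inner_sub_right, horth, horth, sub_self]
  obtain ⟨v, hv⟩ := cauchySeq_tendsto_of_complete hc'
  simp only [← hAz] at hz
  obtain ⟨x, -, hx⟩ := h.exists_of_tendsto hv hz
  exact ⟨x, hx⟩

end SelfAdjoint

/-! ### Polynomial maps between abelian groups. -/

section Polynomial

variable {E G : Type*} [AddCommGroup E] [AddCommGroup G]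

/-- `f` is a polynomial of degree at most `k` in the sense of Fréchet: its differences of order
`k + 1` vanish. -/
def IsPolyDeg : ℕ → (E → G) → Prop
  | 0, f => ∀ x y, f x = f y
  | k + 1, f => ∀ h, IsPolyDeg k fun x => f (x + h) - f x

namespace IsPolyDeg

theorem const (c : G) : ∀ k, IsPolyDeg k fun _ : E => c
  | 0 => fun _ _ => rfl
  | k + 1 => fun _ => by
    simp only [sub_self]
    exact const 0 k

theorem succ : ∀ {k : ℕ} {f : E → G}, IsPolyDeg k f → IsPolyDeg (k + 1) f
  | 0, f, hf => fun h => by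
    have : (fun x => f (x + h) - f x) = fun _ => 0 := funext fun x => by
      rw [hf (x + h) x, sub_self]
    rw [this]
    exact const 0 0
  | k + 1, f, hf => fun h => (hf h).succ

theorem mono {k l : ℕ} {f : E → G} (hf : IsPolyDeg k f) (hkl : k ≤ l) : IsPolyDeg l f := by
  induction hkl with
  | refl => exact hf
  | step _ ih => exact ih.succ

theorem map {G' : Type*} [AddCommGroup G'] (L : G →+ G') :
    ∀ {k : ℕ} {f : E → G}, IsPolyDeg k f → IsPolyDeg k fun x => L (f x)
  | 0, _, hf => fun x y => congrArg L (hf x y)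
  | k + 1, f, hf => fun h => by
    simp only [← map_sub]
    exact (hf h).map L

/-- This lets the degree be computed in a larger group, such as classes of measurable functions,
where products make sense. -/
theorem of_map {G' : Type*} [AddCommGroup G'] {L : G →+ G'} (hL : Function.Injective L) :
    ∀ {k : ℕ} {f : E → G}, (IsPolyDeg k fun x => L (f x)) → IsPolyDeg k f
  | 0, _, hf => fun x y => hL (hf x y)
  | k + 1, f, hf => fun h => by
    have h1 := hf h
    simp only [← map_sub] at h1
    exact of_map hL h1

theorem add : ∀ {k : ℕ} {f g : E → G}, IsPolyDeg k f → IsPolyDeg k g →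
    IsPolyDeg k fun x => f x + g x
  | 0, _, _, hf, hg => fun x y => congrArg₂ _ (hf x y) (hg x y)
  | k + 1, f, g, hf, hg => fun h => by
    simp only [add_sub_add_comm]
    exact (hf h).add (hg h)

theorem neg {k : ℕ} {f : E → G} (hf : IsPolyDeg k f) : IsPolyDeg k fun x => -f x :=
  hf.map (negAddMonoidHom : G →+ G)

theorem sub {k : ℕ} {f g : E → G} (hf : IsPolyDeg k f) (hg : IsPolyDeg k g) :
    IsPolyDeg k fun x => f x - g x := by
  simpa only [sub_eq_add_neg] using hf.add hg.neg

theorem of_add {f : E → G} (hf : ∀ x y, f (x + y) = f x + f y) : IsPolyDeg 1 f := by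
  intro h x y
  simp [hf]

/-- A biadditive map of polynomials is a polynomial. -/
theorem bilin {G₁ G₂ : Type*} [AddCommGroup G₁] [AddCommGroup G₂] (B : G₁ →+ G₂ →+ G) :
    ∀ {k l : ℕ} {f : E → G₁} {g : E → G₂}, IsPolyDeg k f → IsPolyDeg l g →
      IsPolyDeg (k + l) fun x => B (f x) (g x)
  | 0, l, f, g, hf, hg => by
    have : (fun x => B (f x) (g x)) = fun x => B (f 0) (g x) := funext fun x => by rw [hf x 0]
    rw [this, zero_add]
    exact hg.map (B (f 0))
  | k + 1, 0, f, g, hf, hg => by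
    have : (fun x => B (f x) (g x)) = fun x => B.flip (g 0) (f x) := funext fun x => by
      rw [hg x 0]
      rfl
    rw [this]
    exact hf.map (B.flip (g 0))
  | k + 1, l + 1, f, g, hf, hg => fun h => by
    -- The discrete Leibniz rule. The last term, with both factors differenced, has a lower degree
    -- than the other two.
    have e : (fun x => B (f (x + h)) (g (x + h)) - B (f x) (g x)) =
        fun x => (B (f (x + h) - f x) (g x) + B (f x) (g (x + h) - g x)) +
          B (f (x + h) - f x) (g (x + h) - g x) := funext fun x => by
      simp only [map_sub, AddMonoidHom.sub_apply]
      abel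
    rw [e]
    have h1 : IsPolyDeg (k + 1 + l) fun x => B (f (x + h) - f x) (g x) :=
      (bilin B (hf h) hg).mono (by omega)
    have h2 : IsPolyDeg (k + 1 + l) fun x => B (f x) (g (x + h) - g x) := bilin B hf (hg h)
    have h3 : IsPolyDeg (k + 1 + l) fun x => B (f (x + h) - f x) (g (x + h) - g x) :=
      (bilin B (hf h) (hg h)).mono (by omega)
    exact (h1.add h2).add h3
  termination_by k l => k + l

end IsPolyDeg

end Polynomial

/-! ### Continuous polynomials are analytic. -/

section Analytic

variable {E G : Type*} [NormedAddCommGroup E] [NormedSpace ℝ E] [NormedAddCommGroup G]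
  [NormedSpace ℝ G]

/-- A continuous additive map between real normed spaces is real linear, so T is a continuous
multilinear map; it is composed with the diagonal embedding. -/
theorem analyticAt_diagonal {k : ℕ} {T : (Fin k → E) → G} (hT : Continuous T)
    (hadd : ∀ (v : Fin k → E) (i : Fin k) (a b : E),
      T (Function.update v i (a + b)) = T (Function.update v i a) + T (Function.update v i b))
    (x : E) : AnalyticAt ℝ (fun x => T fun _ => x) x := by
  let M : ContinuousMultilinearMap ℝ (fun _ : Fin k => E) G :=
    { toFun := T
      map_update_add' := fun {hd} v i a b => by
        obtain rfl := Subsingleton.elim hd (instDecidableEqFin k)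
        exact hadd v i a b
      map_update_smul' := fun {hd} v i c a => by
        obtain rfl := Subsingleton.elim hd (instDecidableEqFin k)
        exact map_real_smul (AddMonoidHom.mk' (fun a => T (Function.update v i a)) (hadd v i))
          (hT.comp (continuous_const.update i continuous_id)) c a
      cont := hT }
  have h1 : AnalyticAt ℝ M fun _ => x := M.analyticAt
  have h2 : AnalyticAt ℝ (ContinuousLinearMap.pi fun _ : Fin k => ContinuousLinearMap.id ℝ E) x :=
    ContinuousLinearMap.analyticAt _ x
  exact h1.comp h2

theorem IsPolyDeg.analyticAt_one {f : E → G} (hf : IsPolyDeg 1 f) (hc : Continuous f) (x : E) :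
    AnalyticAt ℝ f x := by
  let L : E →+ G := AddMonoidHom.mk' (fun x => f x - f 0) fun a b => by
    have h1 := hf b a 0
    simp only [zero_add] at h1
    rw [sub_eq_iff_eq_add] at h1
    rw [h1]
    abel
  have hL : Continuous L := hc.sub continuous_const
  have h1 : AnalyticAt ℝ (fun x => L.toRealLinearMap hL x + f 0) x :=
    ((L.toRealLinearMap hL).analyticAt x).add analyticAt_const
  refine h1.congr (Eventually.of_forall fun y => ?_)
  change f y - f 0 + f 0 = f y
  abel

/-- The second difference D does not depend on the base point, hence is biadditive; subtracting D(x,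
x)/2 leaves a polynomial of degree one. -/
theorem IsPolyDeg.analyticAt_two {f : E → G} (hf : IsPolyDeg 2 f) (hc : Continuous f) (x : E) :
    AnalyticAt ℝ f x := by
  let D : E → E → G := fun a b => f (a + b) - f a - f b + f 0
  have hD : ∀ x a b, f (x + a + b) - f (x + a) - f (x + b) + f x = D a b := by
    intro x a b
    have h1 := hf b a x 0
    simp only [zero_add] at h1
    have h2 : f (x + a + b) - f (x + a) - f (x + b) + f x =
      f (x + a + b) - f (x + a) - (f (x + b) - f x) := by abel
    rw [h2, h1]
    simp only [D]
    abel
  have hadd : ∀ a a' b, D (a + a') b = D a b + D a' b := by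
    intro a a' b
    rw [← hD a' a b]
    simp only [D, add_comm a a']
    abel
  have hsym : ∀ a b, D a b = D b a := by
    intro a b
    simp only [D, add_comm a b]
    abel
  have hadd' : ∀ a b b', D a (b + b') = D a b + D a b' := by
    intro a b b'
    rw [hsym, hadd, hsym b, hsym b']
  have hT : Continuous fun v : Fin 2 → E => D (v 0) (v 1) := by
    simp only [D]
    fun_prop
  have h1 : AnalyticAt ℝ (fun x => D x x) x :=
    analyticAt_diagonal (T := fun v : Fin 2 → E => D (v 0) (v 1)) hT (fun v i a b => by
      fin_cases i
      · simp [hadd]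
      · simp [hadd']) x
  have hDc : Continuous fun x => D x x := by
    simp only [D]
    fun_prop
  have h2 : IsPolyDeg 1 fun x => f x - (1 / 2 : ℝ) • D x x := by
    intro h x y
    have e : ∀ z, f (z + h) - (1 / 2 : ℝ) • D (z + h) (z + h) - (f z - (1 / 2 : ℝ) • D z z) =
        f h - f 0 - (1 / 2 : ℝ) • D h h := by
      intro z
      have e1 : f (z + h) = D z h + f z + f h - f 0 := by
        simp only [D]
        abel
      rw [e1]
      simp only [hadd, hadd', hsym h z]
      module
    exact (e x).trans (e y).symm
  have h3 := (h2.analyticAt_one (hc.sub (hDc.const_smul _)) x).add (h1.const_smul (c := (1 / 2 : ℝ)))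
  refine h3.congr (Eventually.of_forall fun y => ?_)
  simp

/-- Polarization again: the third difference D is symmetric and additive in each argument, and
subtracting D(x, x, x)/6 leaves a polynomial of degree two. -/
theorem IsPolyDeg.analyticAt_three {f : E → G} (hf : IsPolyDeg 3 f) (hc : Continuous f) (x : E) :
    AnalyticAt ℝ f x := by
  let D : E → E → E → G := fun a b c =>
    f (a + b + c) - f (a + b) - f (a + c) - f (b + c) + f a + f b + f c - f 0
  have hD : ∀ x a b c, f (x + a + b + c) - f (x + a + b) - f (x + a + c) - f (x + b + c) +
      f (x + a) + f (x + b) + f (x + c) - f x = D a b c := by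
    intro x a b c
    have h1 := hf c b a x 0
    simp only [zero_add] at h1
    have h2 : f (x + a + b + c) - f (x + a + b) - f (x + a + c) - f (x + b + c) +
      f (x + a) + f (x + b) + f (x + c) - f x = f (x + a + b + c) - f (x + a + b) -
        (f (x + a + c) - f (x + a)) - (f (x + b + c) - f (x + b) - (f (x + c) - f x)) := by abel
    rw [h2, h1]
    simp only [D]
    abel
  have hadd : ∀ a a' b c, D (a + a') b c = D a b c + D a' b c := by
    intro a a' b c
    rw [← hD a' a b c]
    simp only [D, add_comm a a']
    abel
  have hs1 : ∀ a b c, D a b c = D b a c := by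
    intro a b c
    simp only [D, add_comm a b]
    abel
  have hs2 : ∀ a b c, D a b c = D a c b := by
    intro a b c
    simp only [D, add_comm b c, add_right_comm a b c]
    abel
  have hadd2 : ∀ a b b' c, D a (b + b') c = D a b c + D a b' c := by
    intro a b b' c
    rw [hs1, hadd, hs1 b, hs1 b']
  have hadd3 : ∀ a b c c', D a b (c + c') = D a b c + D a b c' := by
    intro a b c c'
    rw [hs2, hadd2, hs2 a c, hs2 a c']
  have hT : Continuous fun v : Fin 3 → E => D (v 0) (v 1) (v 2) := by
    simp only [D]
    fun_prop
  have h1 : AnalyticAt ℝ (fun x => D x x x) x :=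
    analyticAt_diagonal (T := fun v : Fin 3 → E => D (v 0) (v 1) (v 2)) hT (fun v i a b => by
      fin_cases i
      · simp [hadd]
      · simp [hadd2]
      · simp [hadd3]) x
  have hDc : Continuous fun x => D x x x := by
    simp only [D]
    fun_prop
  have h2 : IsPolyDeg 2 fun x => f x - (1 / 6 : ℝ) • D x x x := by
    intro a b x y
    have e : ∀ z, f (z + b + a) - (1 / 6 : ℝ) • D (z + b + a) (z + b + a) (z + b + a) -
        (f (z + b) - (1 / 6 : ℝ) • D (z + b) (z + b) (z + b)) -
        (f (z + a) - (1 / 6 : ℝ) • D (z + a) (z + a) (z + a) - (f z - (1 / 6 : ℝ) • D z z z)) =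
        f (b + a) - f b - f a + f 0 - (1 / 2 : ℝ) • D a a b - (1 / 2 : ℝ) • D b b a := by
      intro z
      have e1 : f (z + b + a) = D z b a + f (z + b) + f (z + a) + f (b + a) - f z - f b - f a
          + f 0 := by
        simp only [D]
        abel
      rw [e1]
      have p1 : D a b z = D z b a := by rw [hs2, hs1, hs2, hs1 z, hs2, hs1]
      have p2 : D a z b = D z b a := by rw [hs2, p1]
      have p3 : D b a z = D z b a := by rw [hs1, p1]
      have p4 : D b z a = D z b a := hs1 _ _ _
      have p5 : D z a b = D z b a := hs2 _ _ _
      have q1 : ∀ u v, D u v u = D u u v := fun u v => hs2 _ _ _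
      have q2 : ∀ u v, D v u u = D u u v := fun u v => by rw [hs1, hs2]
      simp only [hadd, hadd2, hadd3, p1, p2, p3, p4, p5, q1 a b, q2 a b, q1 b a, q2 b a, q1 z a,
        q2 z a, q1 z b, q2 z b, q1 a z, q2 a z, q1 b z, q2 b z]
      module
    exact (e x).trans (e y).symm
  have h3 := (h2.analyticAt_two (hc.sub (hDc.const_smul _)) x).add (h1.const_smul (c := (1 / 6 : ℝ)))
  refine h3.congr (Eventually.of_forall fun y => ?_)
  simp

end Analytic

/-! ### Abstract bifurcation from a simple eigenvalue with gauge symmetry. -/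

section Bifurcation

variable {X Y X₂ Y₂ : Type*} [NormedAddCommGroup X] [NormedSpace ℂ X]
  [NormedAddCommGroup Y] [NormedSpace ℂ Y] [NormedAddCommGroup X₂]
  [NormedSpace ℝ X₂] [NormedAddCommGroup Y₂] [NormedSpace ℝ Y₂]

/-- The data of a bifurcation problem with gauge symmetry
`A ψ - μ ι ψ + H(ψ, α) + C ψ = 0`, `M α - K(ψ, α) = 0`. -/
structure BifurcationData (ι A : X →L[ℂ] Y) (M : X₂ →L[ℝ] Y₂) (H : X × X₂ → Y) (C : X → Y)
    (K : X × X₂ → Y₂) (x₀ : X) (ℓ : Y →L[ℂ] ℂ) : Prop where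
  analytic_H : ∀ p, AnalyticAt ℝ H p
  analytic_C : ∀ p, AnalyticAt ℝ C p
  analytic_K : ∀ p, AnalyticAt ℝ K p
  H_smul : ∀ (c : ℂ) ψ α, H (c • ψ, α) = c • H (ψ, α)
  H_zero : ∀ ψ, H (ψ, 0) = 0
  C_smul : ∀ (c : ℂ) ψ, C (c • ψ) = (((‖c‖ ^ 2 : ℝ) : ℂ) * c) • C ψ
  K_smul : ∀ (c : ℂ) ψ α, K (c • ψ, α) = (‖c‖ ^ 2) • K (ψ, α)
  A_x₀ : A x₀ = 0
  ℓ_x₀ : ℓ (ι x₀) ≠ 0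
  ℓ_A : ∀ x, ℓ (A x) = 0
  ker_A : ∀ x, A x = 0 → ∃ c : ℂ, x = c • x₀
  range_A : ∀ y, ℓ y = 0 → ∃ x, A x = y
  bijective_M : Function.Bijective M
  gauge : ∀ (t μ ν : ℝ) (u : X) (α : X₂), ℓ (ι u) = ℓ (ι x₀) →
    A u - μ • ι u + H (u, α) + t • C u = ν • Complex.I • ι x₀ → ν = 0

namespace BifurcationData

variable {ι A : X →L[ℂ] Y} {M : X₂ →L[ℝ] Y₂} {H : X × X₂ → Y} {C : X → Y} {K : X × X₂ → Y₂}
  {x₀ : X} {ℓ : Y →L[ℂ] ℂ}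

/-- The equations in the blown up variables `ψ = s (x₀ + w)`, `t = s²`, with the normalization
of `w` and with the parameter made complex. -/
def blowUp (ι A : X →L[ℂ] Y) (M : X₂ →L[ℝ] Y₂) (H : X × X₂ → Y) (C : X → Y) (K : X × X₂ → Y₂)
    (x₀ : X) (ℓ : Y →L[ℂ] ℂ) (p : ℝ × ℂ × X × X₂) : ℝ × ℂ × Y × Y₂ :=
  (p.1, ℓ (ι p.2.2.1),
    A (x₀ + p.2.2.1) - p.2.1.re • ι (x₀ + p.2.2.1) + H (x₀ + p.2.2.1, p.2.2.2)
      + p.1 • C (x₀ + p.2.2.1) - p.2.1.im • Complex.I • ι x₀,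
    M p.2.2.2 - p.1 • K (x₀ + p.2.2.1, p.2.2.2))

theorem H_zero_left (h : BifurcationData ι A M H C K x₀ ℓ) (α : X₂) : H (0, α) = 0 := by
  simpa using h.H_smul 0 0 α

theorem C_zero (h : BifurcationData ι A M H C K x₀ ℓ) : C 0 = 0 := by
  simpa using h.C_smul 0 0

theorem K_zero_left (h : BifurcationData ι A M H C K x₀ ℓ) (α : X₂) : K (0, α) = 0 := by
  simpa using h.K_smul 0 0 α

theorem blowUp_zero (h : BifurcationData ι A M H C K x₀ ℓ) : blowUp ι A M H C K x₀ ℓ 0 = 0 := by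
  simp [blowUp, h.A_x₀, h.H_zero]

theorem analyticAt_blowUp (h : BifurcationData ι A M H C K x₀ ℓ) (p : ℝ × ℂ × X × X₂) :
    AnalyticAt ℝ (blowUp ι A M H C K x₀ ℓ) p := by
  have a1 : AnalyticAt ℝ (fun p : ℝ × ℂ × X × X₂ => p.1) p := analyticAt_fst
  have a2 : AnalyticAt ℝ (fun p : ℝ × ℂ × X × X₂ => p.2.1) p :=
    AnalyticAt.fun_comp (g := Prod.fst) analyticAt_fst analyticAt_snd
  have a34 : AnalyticAt ℝ (fun p : ℝ × ℂ × X × X₂ => p.2.2) p :=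
    AnalyticAt.fun_comp (g := Prod.snd) analyticAt_snd analyticAt_snd
  have a3 : AnalyticAt ℝ (fun p : ℝ × ℂ × X × X₂ => p.2.2.1) p :=
    AnalyticAt.fun_comp (g := Prod.fst) analyticAt_fst a34
  have a4 : AnalyticAt ℝ (fun p : ℝ × ℂ × X × X₂ => p.2.2.2) p :=
    AnalyticAt.fun_comp (g := Prod.snd) analyticAt_snd a34
  have a5 : AnalyticAt ℝ (fun p : ℝ × ℂ × X × X₂ => x₀ + p.2.2.1) p := analyticAt_const.add a3
  have aℓ : AnalyticAt ℝ (fun p : ℝ × ℂ × X × X₂ => ℓ (ι p.2.2.1)) p :=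
    (((ℓ.comp ι).restrictScalars ℝ).analyticAt _).comp a3
  have aA : AnalyticAt ℝ (fun p : ℝ × ℂ × X × X₂ => A (x₀ + p.2.2.1)) p :=
    ((A.restrictScalars ℝ).analyticAt _).comp a5
  have aι : AnalyticAt ℝ (fun p : ℝ × ℂ × X × X₂ => ι (x₀ + p.2.2.1)) p :=
    ((ι.restrictScalars ℝ).analyticAt _).comp a5
  have are : AnalyticAt ℝ (fun p : ℝ × ℂ × X × X₂ => p.2.1.re) p :=
    (Complex.reCLM.analyticAt _).comp a2
  have aim : AnalyticAt ℝ (fun p : ℝ × ℂ × X × X₂ => p.2.1.im) p :=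
    (Complex.imCLM.analyticAt _).comp a2
  have aH : AnalyticAt ℝ (fun p : ℝ × ℂ × X × X₂ => H (x₀ + p.2.2.1, p.2.2.2)) p :=
    (h.analytic_H _).comp (a5.prod a4)
  have aK : AnalyticAt ℝ (fun p : ℝ × ℂ × X × X₂ => K (x₀ + p.2.2.1, p.2.2.2)) p :=
    (h.analytic_K _).comp (a5.prod a4)
  have aC : AnalyticAt ℝ (fun p : ℝ × ℂ × X × X₂ => C (x₀ + p.2.2.1)) p :=
    (h.analytic_C _).comp a5
  have aM : AnalyticAt ℝ (fun p : ℝ × ℂ × X × X₂ => M p.2.2.2) p := (M.analyticAt _).comp a4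
  exact a1.prod (aℓ.prod (((((aA.sub (are.smul aι)).add aH).add (a1.smul aC)).sub
    (aim.smul analyticAt_const)).prod (aM.sub (a1.smul aK))))

/-- H vanishes identically along α = 0. -/
theorem fderiv_H_left (h : BifurcationData ι A M H C K x₀ ℓ) (w : X) :
    fderiv ℝ H (x₀, 0) (w, 0) = 0 := by
  have h1 : HasFDerivAt H (fderiv ℝ H (x₀, 0)) (x₀, 0) :=
    (h.analytic_H _).differentiableAt.hasFDerivAt
  have h2 : HasFDerivAt (fun x : X => (x, (0 : X₂))) (ContinuousLinearMap.inl ℝ X X₂) x₀ :=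
    hasFDerivAt_prodMk_left x₀ 0
  have h3 : HasFDerivAt (fun x : X => H (x, 0)) _ x₀ := h1.comp x₀ h2
  simp only [h.H_zero] at h3
  have h4 := h3.unique (hasFDerivAt_const (0 : Y) x₀)
  exact DFunLike.congr_fun h4 w

/-- The derivative of `blowUp` at the origin. -/
theorem fderiv_blowUp (h : BifurcationData ι A M H C K x₀ ℓ) (τ : ℝ) (ζ : ℂ) (w : X) (β : X₂) :
    fderiv ℝ (blowUp ι A M H C K x₀ ℓ) 0 (τ, ζ, w, β) =
      (τ, ℓ (ι w), A w - ζ • ι x₀ + fderiv ℝ H (x₀, 0) (0, β) + τ • C x₀,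
        M β - τ • K (x₀, 0)) := by
  have h1 : HasFDerivAt (blowUp ι A M H C K x₀ ℓ) _ 0 :=
    (h.analyticAt_blowUp 0).differentiableAt.hasFDerivAt
  -- The derivative exists by analyticity, so it may be computed along a ray.
  let γ : ℝ → ℝ × ℂ × X × X₂ := fun r => r • (τ, ζ, w, β)
  have hγ : HasDerivAt γ (τ, ζ, w, β) 0 := by
    have := (hasDerivAt_id (0 : ℝ)).smul_const (τ, ζ, w, β)
    rw [one_smul] at this
    exact this
  have hγ0 : γ 0 = 0 := zero_smul _ _
  rw [← hγ0] at h1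
  have h2 := h1.comp_hasDerivAt (0 : ℝ) hγ
  rw [hγ0] at h2
  refine h2.unique ?_
  have d1 : HasDerivAt (fun r : ℝ => r * τ) τ 0 := by
    simpa using (hasDerivAt_id (0 : ℝ)).mul_const τ
  have dw : HasDerivAt (fun r : ℝ => r • w) w 0 := by
    simpa using (hasDerivAt_id (0 : ℝ)).smul_const w
  have dβ : HasDerivAt (fun r : ℝ => r • β) β 0 := by
    simpa using (hasDerivAt_id (0 : ℝ)).smul_const β
  have dre : HasDerivAt (fun r : ℝ => r * ζ.re) ζ.re 0 := by
    simpa using (hasDerivAt_id (0 : ℝ)).mul_const ζ.re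
  have dim : HasDerivAt (fun r : ℝ => r * ζ.im) ζ.im 0 := by
    simpa using (hasDerivAt_id (0 : ℝ)).mul_const ζ.im
  have dx : HasDerivAt (fun r : ℝ => x₀ + r • w) w 0 := dw.const_add x₀
  have dp : HasDerivAt (fun r : ℝ => (x₀ + r • w, r • β)) (w, β) 0 := dx.prodMk dβ
  have dℓ : HasDerivAt (fun r : ℝ => ℓ (ι (r • w))) (ℓ (ι w)) 0 :=
    ((ℓ.comp ι).restrictScalars ℝ).hasFDerivAt.comp_hasDerivAt 0 dw
  have dA : HasDerivAt (fun r : ℝ => A (x₀ + r • w)) (A w) 0 :=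
    (A.restrictScalars ℝ).hasFDerivAt.comp_hasDerivAt 0 dx
  have dι : HasDerivAt (fun r : ℝ => ι (x₀ + r • w)) (ι w) 0 :=
    (ι.restrictScalars ℝ).hasFDerivAt.comp_hasDerivAt 0 dx
  have dM : HasDerivAt (fun r : ℝ => M (r • β)) (M β) 0 :=
    M.hasFDerivAt.comp_hasDerivAt 0 dβ
  have hp : (x₀ + (0 : ℝ) • w, (0 : ℝ) • β) = (x₀, 0) := by simp
  have dH : HasDerivAt (fun r : ℝ => H (x₀ + r • w, r • β)) (fderiv ℝ H (x₀, 0) (w, β)) 0 := by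
    have := (h.analytic_H (x₀ + (0 : ℝ) • w, (0 : ℝ) • β)).differentiableAt.hasFDerivAt
    have h3 := this.comp_hasDerivAt (0 : ℝ) dp
    rwa [hp] at h3
  have dK := (h.analytic_K (x₀ + (0 : ℝ) • w, (0 : ℝ) • β)).differentiableAt.hasFDerivAt
  have dK := dK.comp_hasDerivAt (0 : ℝ) dp
  have dC := (h.analytic_C (x₀ + (0 : ℝ) • w)).differentiableAt.hasFDerivAt
  have dC := dC.comp_hasDerivAt (0 : ℝ) dx
  have e1 := ((((dA.sub (dre.smul dι)).add dH).add (d1.smul dC)).sub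
    (dim.smul_const (Complex.I • ι x₀)))
  have e2 := dM.sub (d1.smul dK)
  have e3 := d1.prodMk (dℓ.prodMk (e1.prodMk e2))
  have e4 : fderiv ℝ H (x₀, 0) (w, β) = fderiv ℝ H (x₀, 0) (0, β) := by
    have : (w, β) = (w, (0 : X₂)) + ((0 : X), β) := by simp
    rw [this, map_add, h.fderiv_H_left, zero_add]
  have e5 : ζ • ι x₀ = ζ.re • ι x₀ + ζ.im • Complex.I • ι x₀ := by
    conv_lhs => rw [← Complex.re_add_im ζ, add_smul, mul_smul, Complex.coe_smul, Complex.coe_smul]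
  convert! e3 using 1
  · funext r
    simp [γ, blowUp]
  · simp [e4, e5]
    abel

/-- The derivative is triangular. M determines β; applying ℓ, which kills the range of A but not ι
x₀, determines the complex number ζ; the remaining equation determines w up to a multiple of x₀,
which the value of ℓ(ι w) fixes. A real parameter alone could not fill the cokernel, which is a
complex line. -/
theorem bijective_fderiv_blowUp (h : BifurcationData ι A M H C K x₀ ℓ) :
    Function.Bijective (fderiv ℝ (blowUp ι A M H C K x₀ ℓ) 0) := by
  constructor
  · rw [injective_iff_map_eq_zero]
    rintro ⟨τ, ζ, w, β⟩ hp
    rw [h.fderiv_blowUp] at hp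
    simp only [Prod.mk_eq_zero] at hp
    obtain ⟨rfl, h2, h3, h4⟩ := hp
    have hβ : β = 0 := h.bijective_M.1 (by simpa using h4)
    subst hβ
    have h5 : A w - ζ • ι x₀ = 0 := by
      have : ((0 : X), (0 : X₂)) = 0 := rfl
      simpa [this] using h3
    have h6 := congrArg ℓ h5
    simp only [map_sub, h.ℓ_A, map_smul, map_zero, zero_sub, neg_eq_zero, smul_eq_mul] at h6
    have hζ : ζ = 0 := (mul_eq_zero.1 h6).resolve_right h.ℓ_x₀
    subst hζ
    obtain ⟨c, rfl⟩ := h.ker_A w (by simpa using h5)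
    simp only [map_smul, smul_eq_mul] at h2
    have hc : c = 0 := (mul_eq_zero.1 h2).resolve_right h.ℓ_x₀
    simp [hc]
  · rintro ⟨τ, k, y, z⟩
    obtain ⟨β, hβ⟩ := h.bijective_M.2 (z + τ • K (x₀, 0))
    set y' := y - fderiv ℝ H (x₀, 0) (0, β) - τ • C x₀ with hy'
    set ζ := -(ℓ y' / ℓ (ι x₀)) with hζ
    obtain ⟨w₀, hw₀⟩ := h.range_A (y' + ζ • ι x₀) (by
      rw [map_add, map_smul, hζ, smul_eq_mul, neg_mul, div_mul_cancel₀ _ h.ℓ_x₀, add_neg_cancel])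
    refine ⟨(τ, ζ, w₀ + ((k - ℓ (ι w₀)) / ℓ (ι x₀)) • x₀, β), ?_⟩
    rw [h.fderiv_blowUp]
    refine Prod.ext rfl (Prod.ext ?_ (Prod.ext ?_ ?_))
    · simp only [map_add, map_smul, smul_eq_mul]
      rw [div_mul_cancel₀ _ h.ℓ_x₀]
      ring
    · simp only [map_add, map_smul, h.A_x₀, hw₀, hy']
      simp
      abel
    · simp [hβ]

theorem blowUp_eq_iff (p : ℝ × ℂ × X × X₂) (t : ℝ) :
    blowUp ι A M H C K x₀ ℓ p = (t, 0, 0, 0) ↔ p.1 = t ∧ ℓ (ι p.2.2.1) = 0 ∧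
      A (x₀ + p.2.2.1) - p.2.1.re • ι (x₀ + p.2.2.1) + H (x₀ + p.2.2.1, p.2.2.2)
      + p.1 • C (x₀ + p.2.2.1) = p.2.1.im • Complex.I • ι x₀ ∧
      M p.2.2.2 = p.1 • K (x₀ + p.2.2.1, p.2.2.2) := by
  simp only [blowUp, Prod.mk.injEq, sub_eq_zero]

/-- The solution set of the equations. -/
def IsSol (ι A : X →L[ℂ] Y) (M : X₂ →L[ℝ] Y₂) (H : X × X₂ → Y) (C : X → Y) (K : X × X₂ → Y₂)
    (μ : ℝ) (ψ : X) (α : X₂) : Prop :=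
  A ψ - μ • ι ψ + H (ψ, α) + C ψ = 0 ∧ M α = K (ψ, α)

/-- All terms of the first equation carry the factor z, so it cancels; only |z|² remains, and the
phase of z disappears altogether. -/
theorem isSol_smul_iff (h : BifurcationData ι A M H C K x₀ ℓ) {μ : ℝ} {u : X} {α : X₂} {z : ℂ}
    (hz : z ≠ 0) : IsSol ι A M H C K μ (z • u) α ↔
      A u - μ • ι u + H (u, α) + (‖z‖ ^ 2) • C u = 0 ∧ M α = (‖z‖ ^ 2) • K (u, α) := by
  have e : A (z • u) - μ • ι (z • u) + H (z • u, α) + C (z • u) =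
      z • (A u - μ • ι u + H (u, α) + (‖z‖ ^ 2) • C u) := by
    rw [h.H_smul, h.C_smul, map_smul, map_smul, smul_add, smul_add, smul_sub, smul_comm μ z,
      mul_comm, mul_smul, Complex.coe_smul]
  rw [IsSol, e, h.K_smul, smul_eq_zero_iff_right hz]

/-- Near the trivial branch, solutions are close to the kernel of `A`. -/
theorem eventually_norm_le (h : BifurcationData ι A M H C K x₀ ℓ) {η : ℝ} (hη : 0 < η) :
    ∀ᶠ p : ℝ × X × X₂ in 𝓝 0, IsSol ι A M H C K p.1 p.2.1 p.2.2 → ‖A p.2.1‖ ≤ η * ‖p.2.1‖ := by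
  let R : ℝ × X × X₂ → Y := fun p => H p.2 + C p.2.1 - p.1 • ι p.2.1
  have aR : AnalyticAt ℝ R 0 := by
    have a1 : AnalyticAt ℝ (fun p : ℝ × X × X₂ => p.1) 0 := analyticAt_fst
    have a2 : AnalyticAt ℝ (fun p : ℝ × X × X₂ => p.2) 0 := analyticAt_snd
    have a3 : AnalyticAt ℝ (fun p : ℝ × X × X₂ => p.2.1) 0 :=
      AnalyticAt.fun_comp (g := Prod.fst) analyticAt_fst a2
    have aι : AnalyticAt ℝ (fun p : ℝ × X × X₂ => ι p.2.1) 0 :=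
      ((ι.restrictScalars ℝ).analyticAt _).comp a3
    exact (((h.analytic_H _).comp a2).add ((h.analytic_C _).comp a3)).sub (a1.smul aι)
  have hs : HasStrictFDerivAt R (fderiv ℝ R 0) 0 := aR.hasStrictFDerivAt
  -- Along (0, rψ, 0) the term H vanishes and R equals r³ C(ψ), so R has no linear part in ψ.
  have hD : ∀ ψ : X, fderiv ℝ R 0 (0, ψ, 0) = 0 := by
    intro ψ
    let γ : ℝ → ℝ × X × X₂ := fun r => r • (0, ψ, 0)
    have hγ : HasDerivAt γ (0, ψ, 0) 0 := by
      have := (hasDerivAt_id (0 : ℝ)).smul_const ((0 : ℝ), ψ, (0 : X₂))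
      rw [one_smul] at this
      exact this
    have hγ0 : γ 0 = 0 := zero_smul _ _
    have h1 := hs.hasFDerivAt
    rw [← hγ0] at h1
    have h2 := h1.comp_hasDerivAt (0 : ℝ) hγ
    rw [hγ0] at h2
    have h3 : R ∘ γ = fun r : ℝ => (r ^ 3) • C ψ := by
      funext r
      have := h.C_smul r ψ
      rw [Complex.coe_smul] at this
      simp only [Function.comp_apply, R, γ, Prod.smul_mk, smul_zero, h.H_zero, zero_smul, this]
      rw [Complex.norm_real, Real.norm_eq_abs, sq_abs, ← Complex.ofReal_mul, Complex.coe_smul]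
      simp only [zero_add, sub_zero]
      congr 1
    rw [h3] at h2
    have h4 : HasDerivAt (fun r : ℝ => (r ^ 3) • C ψ) 0 0 := by
      simpa using (hasDerivAt_pow 3 (0 : ℝ)).smul_const (C ψ)
    exact h2.unique h4
  -- Strict differentiability compares p with (p.1, 0, p.2.2), where R vanishes. It therefore bounds
  -- R(p) by η‖ψ‖ and not merely by a multiple of the norm of p; at a solution R(p) = -A ψ.
  have ho := (hs.isLittleO).bound hη
  have ht : Tendsto (fun p : ℝ × X × X₂ => (p, ((p.1, 0, p.2.2) : ℝ × X × X₂))) (𝓝 0)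
      (𝓝 ((0 : ℝ × X × X₂), (0 : ℝ × X × X₂))) := by
    have : Continuous (fun p : ℝ × X × X₂ => (p, ((p.1, 0, p.2.2) : ℝ × X × X₂))) := by fun_prop
    exact this.tendsto' _ _ rfl
  filter_upwards [ht.eventually ho] with p hp hsol
  have e1 : p - (p.1, 0, p.2.2) = (0, p.2.1, 0) := by ext <;> simp
  have e2 : R (p.1, 0, p.2.2) = 0 := by simp [R, h.H_zero_left, h.C_zero]
  have e3 : R p = -A p.2.1 := by
    rw [eq_neg_iff_add_eq_zero, ← hsol.1]
    simp only [R]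
    abel
  simp only [e1, e2, e3, hD, sub_zero, norm_neg] at hp
  simpa [Prod.norm_def] using hp

/-- Bifurcation from a simple eigenvalue in the presence of a gauge symmetry. -/
theorem bifurcation [CompleteSpace X] [CompleteSpace Y] [CompleteSpace X₂] [CompleteSpace Y₂]
    (h : BifurcationData ι A M H C K x₀ ℓ) :
    ∃ ε > (0 : ℝ), ∃ (gl : ℝ → ℝ) (gψ : ℝ → X) (gα : ℝ → X₂),
      AnalyticOnNhd ℝ gl (Ico 0 ε) ∧ AnalyticOnNhd ℝ gψ (Ico 0 ε) ∧
      AnalyticOnNhd ℝ gα (Ico 0 ε) ∧ gl 0 = 0 ∧ gψ 0 = 0 ∧ gα 0 = 0 ∧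
      (∀ t ∈ Ico 0 ε, ℓ (ι (gψ t)) = 0) ∧
      (∀ s ∈ Ico 0 (√ε), IsSol ι A M H C K (gl (s ^ 2)) (s • x₀ + s • gψ (s ^ 2)) (gα (s ^ 2))) ∧
      (∀ s ∈ Ioo 0 (√ε), s • x₀ + s • gψ (s ^ 2) ≠ 0) ∧
      ∀ᶠ p : ℝ × X × X₂ in 𝓝 0, IsSol ι A M H C K p.1 p.2.1 p.2.2 →
        (p.2.1 = 0 ∧ p.2.2 = 0) ∨ ∃ s ∈ Ioo 0 (√ε), ∃ δ : ℝ, p.1 = gl (s ^ 2) ∧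
          p.2.1 = Complex.exp (Complex.I * δ) • (s • x₀ + s • gψ (s ^ 2)) ∧
          p.2.2 = gα (s ^ 2) := by
  set Φ := blowUp ι A M H C K x₀ ℓ with hΦ
  have hbij := h.bijective_fderiv_blowUp
  -- Completeness of the spaces makes the inverse of the bijective derivative continuous.
  let e : (ℝ × ℂ × X × X₂) ≃L[ℝ] (ℝ × ℂ × Y × Y₂) :=
    ContinuousLinearEquiv.ofBijective (fderiv ℝ Φ 0) (LinearMap.ker_eq_bot.2 hbij.1)
      (LinearMap.range_eq_top.2 hbij.2)
  have he : (e : (ℝ × ℂ × X × X₂) →L[ℝ] (ℝ × ℂ × Y × Y₂)) = fderiv ℝ Φ 0 := rfl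
  have hs : HasStrictFDerivAt Φ (e : (ℝ × ℂ × X × X₂) →L[ℝ] (ℝ × ℂ × Y × Y₂)) 0 :=
    (h.analyticAt_blowUp 0).hasStrictFDerivAt
  set P := hs.toOpenPartialHomeomorph Φ with hP
  have hP0 : (0 : ℝ × ℂ × X × X₂) ∈ P.source := hs.mem_toOpenPartialHomeomorph_source
  have hPΦ : ∀ p, P p = Φ p := fun p => rfl
  have hΦ0 : Φ 0 = 0 := h.blowUp_zero
  have hPs : AnalyticAt ℝ P.symm 0 := by
    have := P.analyticAt_symm' (i := e) hP0 (h.analyticAt_blowUp 0) rfl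
    rwa [hPΦ, hΦ0] at this
  have hsymm0 : P.symm 0 = 0 := by
    have := P.left_inv hP0
    rwa [hPΦ, hΦ0] at this
  have htarget : P.target ∈ 𝓝 (0 : ℝ × ℂ × Y × Y₂) := by
    refine P.open_target.mem_nhds ?_
    have := P.map_source hP0
    rwa [hPΦ, hΦ0] at this
  let i : ℝ → ℝ × ℂ × Y × Y₂ := fun t => (t, 0, 0, 0)
  have hi : Continuous i := by fun_prop
  have hi0 : i 0 = 0 := rfl
  have hev : ∀ᶠ t in 𝓝 (0 : ℝ), i t ∈ P.target ∧ AnalyticAt ℝ P.symm (i t) := by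
    have : Tendsto i (𝓝 0) (𝓝 0) := hi.tendsto' _ _ hi0
    exact this.eventually ((eventually_mem_set.2 htarget).and hPs.eventually_analyticAt)
  obtain ⟨ε, hε, hball⟩ := Metric.eventually_nhds_iff.1 hev
  have hmem : ∀ t ∈ Ico 0 ε, i t ∈ P.target ∧ AnalyticAt ℝ P.symm (i t) := fun t ht =>
    hball (by rw [Real.dist_eq, sub_zero, abs_of_nonneg ht.1]; exact ht.2)
  -- The branch is the image of the line (t, 0, 0, 0) under the local inverse. Since `blowUp` keeps
  -- t as its first component, the inverse function theorem does the work of the implicit one.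
  let G : ℝ → ℝ × ℂ × X × X₂ := fun t => P.symm (i t)
  have hG0 : G 0 = 0 := hsymm0
  have hGa : ∀ t ∈ Ico 0 ε, AnalyticAt ℝ G t := by
    intro t ht
    have a1 : AnalyticAt ℝ i t :=
      analyticAt_id.prod (analyticAt_const.prod (analyticAt_const.prod analyticAt_const))
    exact (hmem t ht).2.comp a1
  have hGΦ : ∀ t ∈ Ico 0 ε, Φ (G t) = (t, 0, 0, 0) := fun t ht => P.right_inv (hmem t ht).1
  have hGa1 : ∀ t ∈ Ico 0 ε, AnalyticAt ℝ (fun t => (G t).2) t := fun t ht =>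
    AnalyticAt.fun_comp (g := Prod.snd) analyticAt_snd (hGa t ht)
  have hGa2 : ∀ t ∈ Ico 0 ε, AnalyticAt ℝ (fun t => (G t).2.2) t := fun t ht =>
    AnalyticAt.fun_comp (g := Prod.snd) analyticAt_snd (hGa1 t ht)
  have hG : ∀ t ∈ Ico 0 ε, (G t).1 = t ∧ ℓ (ι (G t).2.2.1) = 0 ∧
      A (x₀ + (G t).2.2.1) - (G t).2.1.re • ι (x₀ + (G t).2.2.1) +
        H (x₀ + (G t).2.2.1, (G t).2.2.2) + t • C (x₀ + (G t).2.2.1) = 0 ∧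
      M (G t).2.2.2 = t • K (x₀ + (G t).2.2.1, (G t).2.2.2) := by
    intro t ht
    obtain ⟨h1, h2, h3, h4⟩ := (blowUp_eq_iff _ _).1 (hGΦ t ht)
    rw [h1] at h3 h4
    -- The imaginary part of the parameter vanishes, so solutions of the enlarged system solve the
    -- original one.
    have h5 := h.gauge t _ _ _ _ (by rw [map_add, map_add, h2, add_zero]) h3
    rw [h5, zero_smul] at h3
    exact ⟨h1, h2, h3, h4⟩
  have hsq : ∀ s ∈ Ico 0 (√ε), s ^ 2 ∈ Ico 0 ε := fun s hs' =>
    ⟨sq_nonneg s, (Real.lt_sqrt hs'.1).1 hs'.2⟩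
  refine ⟨ε, hε, fun t => (G t).2.1.re, fun t => (G t).2.2.1, fun t => (G t).2.2.2,
    fun t ht => ?_, fun t ht => ?_, fun t ht => ?_, by simp [hG0], by simp [hG0], by simp [hG0],
    fun t ht => (hG t ht).2.1, fun s hs' => ?_, fun s hs' h0 => ?_, ?_⟩
  · exact (Complex.reCLM.analyticAt _).comp (f := fun t => (G t).2.1)
      (AnalyticAt.fun_comp (g := Prod.fst) analyticAt_fst (hGa1 t ht))
  · exact AnalyticAt.fun_comp (g := Prod.fst) analyticAt_fst (hGa2 t ht)
  · exact AnalyticAt.fun_comp (g := Prod.snd) analyticAt_snd (hGa2 t ht)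
  · obtain ⟨-, -, h3, h4⟩ := hG _ (hsq s hs')
    rcases hs'.1.eq_or_lt with h0 | h0
    · subst h0
      refine ⟨by simp [h.H_zero_left, h.C_zero], ?_⟩
      simp [h.K_zero_left, hG0]
    · have e1 : s • x₀ + s • (G (s ^ 2)).2.2.1 = (s : ℂ) • (x₀ + (G (s ^ 2)).2.2.1) := by
        rw [Complex.coe_smul, smul_add]
      dsimp only
      rw [e1, h.isSol_smul_iff (by exact_mod_cast h0.ne')]
      rw [Complex.norm_real, Real.norm_eq_abs, sq_abs]
      exact ⟨h3, h4⟩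
  · have h1 := congrArg (fun x => ℓ (ι x)) h0
    have h2 := (hG _ (hsq s ⟨hs'.1.le, hs'.2⟩)).2.1
    have e1 : s • x₀ + s • (G (s ^ 2)).2.2.1 = (s : ℂ) • (x₀ + (G (s ^ 2)).2.2.1) := by
      rw [Complex.coe_smul, smul_add]
    simp only [e1, map_smul, map_add, h2, add_zero, map_zero, smul_eq_mul] at h1
    rcases mul_eq_zero.1 h1 with h3 | h3
    · exact hs'.1.ne' (by exact_mod_cast h3)
    · exact h.ℓ_x₀ h3
  · obtain ⟨r, hr, hrsub⟩ := Metric.mem_nhds_iff.1 (P.open_source.mem_nhds hP0)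
    -- When ℓ(ι w) = 0, e maps (0, 0, w, 0) to (0, 0, A w, 0), so the norm of the inverse bounds w
    -- by A w. The summand 1 keeps c positive.
    set c := ‖(e.symm : (ℝ × ℂ × Y × Y₂) →L[ℝ] (ℝ × ℂ × X × X₂))‖ + 1 with hc
    have hc0 : 0 < c := by positivity
    have hbound : ∀ w, ℓ (ι w) = 0 → ‖w‖ ≤ c * ‖A w‖ := by
      intro w hw
      have h1 : e (0, 0, w, 0) = (0, 0, A w, 0) := by
        change fderiv ℝ Φ 0 (0, 0, w, 0) = _
        rw [h.fderiv_blowUp]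
        have : ((0 : X), (0 : X₂)) = 0 := rfl
        simp [hw, this]
      have h2 := (e.symm : (ℝ × ℂ × Y × Y₂) →L[ℝ] (ℝ × ℂ × X × X₂)).le_opNorm (0, 0, A w, 0)
      rw [← h1] at h2
      simp only [ContinuousLinearEquiv.coe_coe, ContinuousLinearEquiv.symm_apply_apply] at h2
      rw [h1] at h2
      have e1 : ‖((0 : ℝ), (0 : ℂ), w, (0 : X₂))‖ = ‖w‖ := by simp [Prod.norm_def]
      have e2 : ‖((0 : ℝ), (0 : ℂ), A w, (0 : Y₂))‖ = ‖A w‖ := by simp [Prod.norm_def]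
      rw [e1, e2] at h2
      refine h2.trans ?_
      gcongr
      exact (le_add_iff_nonneg_right _).2 zero_le_one
    set ρ := r / 2 with hρ
    have hρ0 : 0 < ρ := by positivity
    -- Chosen so that c η ≤ 1/2 and c η ‖x₀‖ ≤ ρ/2. In ‖w'‖ ≤ c η (‖z‖‖x₀‖ + ‖w'‖) the last term is
    -- then absorbed, which leaves ‖w'‖ ≤ ρ‖z‖.
    set η := min (1 / 2) (ρ / (2 * (‖x₀‖ + 1))) / c with hη
    have hη0 : 0 < η := by positivity
    have hη1 : c * η ≤ 1 / 2 := by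
      rw [hη, mul_div_cancel₀ _ hc0.ne']
      exact min_le_left _ _
    have hη2 : c * η * ‖x₀‖ ≤ ρ / 2 := by
      have : c * η ≤ ρ / (2 * (‖x₀‖ + 1)) := by
        rw [hη, mul_div_cancel₀ _ hc0.ne']
        exact min_le_right _ _
      have h2 : c * η * (‖x₀‖ + 1) ≤ ρ / 2 := by
        calc c * η * (‖x₀‖ + 1) ≤ ρ / (2 * (‖x₀‖ + 1)) * (‖x₀‖ + 1) := by gcongr
          _ = ρ / 2 := by field_simp
      have h3 : 0 ≤ c * η := by positivity
      nlinarith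
    have hz : ∀ᶠ p : ℝ × X × X₂ in 𝓝 0,
        ‖ℓ (ι p.2.1) / ℓ (ι x₀)‖ ^ 2 < min r ε ∧ ‖p.1‖ < r ∧ ‖p.2.2‖ < r := by
      have c1 : Continuous fun p : ℝ × X × X₂ => ‖ℓ (ι p.2.1) / ℓ (ι x₀)‖ ^ 2 :=
        ((ℓ.continuous.comp (ι.continuous.comp
          (continuous_fst.comp continuous_snd))).div_const _).norm.pow 2
      have c2 : Continuous fun p : ℝ × X × X₂ => ‖p.1‖ := by fun_prop
      have c3 : Continuous fun p : ℝ × X × X₂ => ‖p.2.2‖ := by fun_prop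
      refine (c1.tendsto' 0 0 (by simp)).eventually_lt_const (lt_min hr hε) |>.and
        ((c2.tendsto' 0 0 (by simp)).eventually_lt_const hr |>.and
          ((c3.tendsto' 0 0 (by simp)).eventually_lt_const hr))
    filter_upwards [h.eventually_norm_le hη0, hz] with p hp1 hp2 hsol
    obtain ⟨μ, ψ, α⟩ := p
    dsimp only at hp1 hp2 hsol ⊢
    have hAψ := hp1 hsol
    set z := ℓ (ι ψ) / ℓ (ι x₀) with hzdef
    set w' := ψ - z • x₀ with hw'
    have hψ : ψ = z • x₀ + w' := by rw [hw']; abel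
    have hℓw' : ℓ (ι w') = 0 := by
      rw [hw', map_sub, map_sub, map_smul, map_smul, hzdef, smul_eq_mul,
        div_mul_cancel₀ _ h.ℓ_x₀, sub_self]
    have hAw' : A w' = A ψ := by rw [hw', map_sub, map_smul, h.A_x₀, smul_zero, sub_zero]
    have hw'le : ‖w'‖ ≤ ρ * ‖z‖ := by
      have h1 := hbound w' hℓw'
      rw [hAw'] at h1
      have h2 : ‖ψ‖ ≤ ‖z‖ * ‖x₀‖ + ‖w'‖ := by
        conv_lhs => rw [hψ]
        exact (norm_add_le _ _).trans (by rw [norm_smul])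
      have h3 : ‖w'‖ ≤ c * η * (‖z‖ * ‖x₀‖ + ‖w'‖) := by
        calc ‖w'‖ ≤ c * ‖A ψ‖ := h1
          _ ≤ c * (η * (‖z‖ * ‖x₀‖ + ‖w'‖)) := by
            refine mul_le_mul_of_nonneg_left (hAψ.trans ?_) hc0.le
            exact mul_le_mul_of_nonneg_left h2 hη0.le
          _ = _ := by ring
      nlinarith [norm_nonneg w', norm_nonneg z, mul_le_mul_of_nonneg_right hη1 (norm_nonneg w'),
        mul_le_mul_of_nonneg_right hη2 (norm_nonneg z)]
    -- If the component along x₀ vanishes, so does w', and the solution is trivial. Otherwise w =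
    -- w'/z has norm at most ρ < r and the blown up point lies in the domain of the local inverse.
    by_cases hz0 : z = 0
    · left
      have hw0 : w' = 0 := by
        rw [hz0, norm_zero, mul_zero] at hw'le
        exact norm_le_zero_iff.1 hw'le
      have hψ0 : ψ = 0 := by rw [hψ, hz0, hw0]; simp
      refine ⟨hψ0, h.bijective_M.1 ?_⟩
      rw [hsol.2, hψ0, h.K_zero_left, map_zero]
    · right
      have hzpos : 0 < ‖z‖ := norm_pos_iff.2 hz0
      set w := z⁻¹ • w' with hw
      have hψu : ψ = z • (x₀ + w) := by
        rw [smul_add, hw, smul_inv_smul₀ hz0, ← hψ]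
      have hwle : ‖w‖ ≤ ρ := by
        rw [hw, norm_smul, norm_inv, inv_mul_le_iff₀ hzpos, mul_comm]
        exact hw'le
      have hℓw : ℓ (ι w) = 0 := by rw [hw, map_smul, map_smul, hℓw', smul_zero]
      rw [hψu, h.isSol_smul_iff hz0] at hsol
      set t := ‖z‖ ^ 2 with ht
      have ht0 : 0 ≤ t := sq_nonneg _
      have htε : t < ε := hp2.1.trans_le (min_le_right _ _)
      have hsrc : ((t, (μ : ℂ), w, α) : ℝ × ℂ × X × X₂) ∈ P.source := by
        refine hrsub ?_
        rw [mem_ball_zero_iff]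
        simp only [Prod.norm_def, max_lt_iff]
        refine ⟨?_, ?_, ?_, hp2.2.2⟩
        · rw [Real.norm_eq_abs, abs_of_nonneg ht0]
          exact hp2.1.trans_le (min_le_left _ _)
        · rw [Complex.norm_real]
          exact hp2.2.1
        · refine hwle.trans_lt ?_
          rw [hρ]
          linarith
      have hΦp : Φ (t, (μ : ℂ), w, α) = i t := by
        refine (blowUp_eq_iff _ _).2 ⟨rfl, hℓw, ?_, hsol.2⟩
        simpa using hsol.1
      have hGt : G t = (t, (μ : ℂ), w, α) := by
        change P.symm (i t) = _
        rw [← hΦp]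
        exact P.left_inv hsrc
      -- Amplitude and phase of the solution are the modulus and the argument of z.
      refine ⟨‖z‖, ⟨hzpos, (Real.lt_sqrt hzpos.le).2 htε⟩, z.arg, ?_, ?_, ?_⟩
      · rw [← ht, hGt]
        simp
      · rw [← ht, hGt, ← smul_add, ← Complex.coe_smul, smul_smul, mul_comm (Complex.exp _),
          mul_comm Complex.I, Complex.norm_mul_exp_arg_mul_I]
        exact hψu
      · rw [← ht, hGt]

end BifurcationData

end Bifurcation

/-! ### The magnetic Laplacian and its spectral gap. -/

section Landau

variable {n : ℕ} {τ : UpperHalfPlane}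

/-- `g' j` are the weak covariant derivatives of `g`. -/
def HasCovPartials (n : ℕ) (g : Plane → ℂ) (g' : Fin 2 → Plane → ℂ) : Prop :=
  ∀ j, HasWeakPartial j g fun x => g' j x + Complex.I * (bgPotential n x j : ℂ) * g x

theorem hasCovPartials_val (u : GaugeH2 n τ) :
    HasCovPartials n (Sobolev2.val u).1 fun j => (Sobolev2.D j u).1 :=
  u.2.1

theorem hasCovPartials_D (j : Fin 2) (u : GaugeH2 n τ) :
    HasCovPartials n (Sobolev2.D j u).1 fun k => (Sobolev2.DD k j u).1 :=
  fun k => u.2.2 k j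

theorem GaugeL2.inner_eq (f g : GaugeL2 n τ) :
    inner ℂ f g = ∫ x in cell τ, g.1 x * conj (f.1 x) :=
  QP.inner_eq f g

theorem GaugeL2.integrable_mul_conj (f g : GaugeL2 n τ) :
    Integrable (fun x => g.1 x * conj (f.1 x)) (volume.restrict (cell τ)) :=
  g.memLp_cell.integrable_mul ((Complex.conjCLE : ℂ →L[ℝ] ℂ).comp_memLp' f.memLp_cell)

theorem GaugeL2.pairing {V g' : Fin 2 → GaugeL2 n τ} {W g : GaugeL2 n τ}
    (h : HasWeakDiv (fun j => (V j).1)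
      fun x => W.1 x + ∑ j, Complex.I * (bgPotential n x j : ℂ) * (V j).1 x)
    (hw : HasCovPartials n g.1 fun j => (g' j).1) :
    ∑ j, inner ℂ (g' j) (V j) + inner ℂ g W = 0 := by
  have h1 := h.cell_pairing (a := fun j x => bgPotential n x j) (continuous_bgPotential n)
    (fun j => (V j).isL2Loc) W.isL2Loc g.isL2Loc (fun j => (g' j).isL2Loc) hw (norm_phase n τ)
    (fun j => (V j).2.1) W.2.1 g.2.1 (fun j => (g' j).2.1)
  rw [← h1, integral_add, integral_finsetSum]
  · simp only [GaugeL2.inner_eq]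
  · exact fun j _ => GaugeL2.integrable_mul_conj _ _
  · exact integrable_finsetSum _ fun j _ => GaugeL2.integrable_mul_conj _ _
  · exact GaugeL2.integrable_mul_conj _ _

theorem hasWeakDiv_D (u : GaugeH2 n τ) :
    HasWeakDiv (fun j => (Sobolev2.D j u).1) fun x =>
      (Sobolev2.DD 0 0 u + Sobolev2.DD 1 1 u).1 x +
        ∑ j, Complex.I * (bgPotential n x j : ℂ) * (Sobolev2.D j u).1 x := by
  refine (HasWeakDiv.of_partial fun j => hasCovPartials_D j u j).congr
    (fun j => EventuallyEq.rfl) ?_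
  filter_upwards [QP.coeFn_add (Sobolev2.DD 0 0 u) (Sobolev2.DD 1 1 u)] with x hx
  rw [hx]
  simp only [Fin.sum_univ_two]
  ring

/-- The form of the magnetic Laplacian. -/
theorem inner_laplacian (v u : GaugeH2 n τ) :
    inner ℂ (Sobolev2.val v) (-(Sobolev2.DD 0 0 u + Sobolev2.DD 1 1 u)) =
      ∑ j, inner ℂ (Sobolev2.D j v) (Sobolev2.D j u) := by
  have := GaugeL2.pairing (g' := fun j => Sobolev2.D j v) (V := fun j => Sobolev2.D j u)
    (hasWeakDiv_D u) (hasCovPartials_val v)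
  rw [inner_neg_right]
  exact (eq_neg_of_add_eq_zero_left this).symm

/-- The second derivatives of the test function are symmetric, so f needs only first weak
derivatives. -/
theorem hasWeakDiv_rotated_gradient {f : Plane → ℂ} {f' : Fin 2 → Plane → ℂ}
    (h : ∀ j, HasWeakPartial j f (f' j)) :
    HasWeakDiv ![f' 1, fun x => -f' 0 x] fun _ => 0 := by
  refine ⟨fun j => ?_, locallyIntegrable_zero, fun φ h1 h2 => ?_⟩
  · fin_cases j
    · exact (h 1).2.1
    · exact (h 0).2.1.neg
  · have hd : ∀ j, ContDiff ℝ ∞ fun x => fderiv ℝ φ x (coordVec j) := fun j =>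
      (h1.fderiv_right (m := ∞) (by simp)).clm_apply contDiff_const
    have hc : ∀ j, HasCompactSupport fun x => fderiv ℝ φ x (coordVec j) := fun j =>
      h2.fderiv_apply ℝ _
    have e1 := (h 1).2.2 _ (hd 0) (hc 0)
    have e0 := (h 0).2.2 _ (hd 1) (hc 1)
    have hsymm : ∀ x, fderiv ℝ (fun x => fderiv ℝ φ x (coordVec 0)) x (coordVec 1) =
        fderiv ℝ (fun x => fderiv ℝ φ x (coordVec 1)) x (coordVec 0) := by
      intro x
      have hs : IsSymmSndFDerivAt ℝ φ x := h1.contDiffAt.isSymmSndFDerivAt (by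
        simp only [minSmoothness_of_isRCLikeNormedField]; exact WithTop.coe_le_coe.2 (le_top : (2 : ℕ∞) ≤ ⊤))
      have hdd : DifferentiableAt ℝ (fderiv ℝ φ) x :=
        (h1.fderiv_right (m := ∞) (by simp)).differentiable (by simp) x
      rw [fderiv_clm_apply hdd (differentiableAt_const _),
        fderiv_clm_apply hdd (differentiableAt_const _)]
      simpa using hs.eq (coordVec 1) (coordVec 0)
    simp only [hsymm] at e1
    simp only [Fin.sum_univ_two, Matrix.cons_val_zero, Matrix.cons_val_one, smul_neg, smul_zero,
      integral_zero, neg_zero, integral_neg]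
    rw [← neg_eq_iff_eq_neg] at e1 e0
    rw [← e1, ← e0]
    ring

theorem fderiv_bgPotential (n : ℕ) (x : Plane) (i j : Fin 2) :
    fderiv ℝ (fun x => bgPotential n x i) x (coordVec j) = bgPotential n (coordVec j) i := by
  have hlin : (fun x => bgPotential n x i) =
      fun x => ((n : ℝ) / 2) * (![-x 1, x 0] : Fin 2 → ℝ) i := by
    funext x
    simp [bgPotential, J]
  have h0 : HasFDerivAt (fun x : Plane => x 0) (EuclideanSpace.proj (𝕜 := ℝ) (0 : Fin 2)) x :=
    (EuclideanSpace.proj (𝕜 := ℝ) (0 : Fin 2) : Plane →L[ℝ] ℝ).hasFDerivAt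
  have h1 : HasFDerivAt (fun x : Plane => x 1) (EuclideanSpace.proj (𝕜 := ℝ) (1 : Fin 2)) x :=
    (EuclideanSpace.proj (𝕜 := ℝ) (1 : Fin 2) : Plane →L[ℝ] ℝ).hasFDerivAt
  rw [hlin]
  fin_cases i
  · have := (h1.neg.const_mul ((n : ℝ) / 2)).fderiv
    simp only [Fin.zero_eta, Matrix.cons_val_zero]
    erw [this]
    simp [bgPotential, J]
  · have := (h0.const_mul ((n : ℝ) / 2)).fderiv
    simp only [Fin.mk_one, Matrix.cons_val_one, Matrix.cons_val_fin_one]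
    erw [this]
    simp [bgPotential, J]

theorem contDiff_bgPotential (n : ℕ) (i : Fin 2) : ContDiff ℝ 1 fun x => bgPotential n x i := by
  fin_cases i
  · simp [bgPotential, J]
    fun_prop
  · simp [bgPotential, J]
    fun_prop

theorem isL2Loc_of_continuous {E : Type} [NormedAddCommGroup E] {f : Plane → E}
    (hf : Continuous f) : IsL2Loc f := by
  intro K hK
  have : IsFiniteMeasure ((volume : Measure Plane).restrict K) :=
    ⟨by simpa using hK.measure_lt_top⟩
  obtain ⟨b, hb⟩ := hK.exists_bound_of_continuousOn hf.continuousOn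
  exact MemLp.of_bound hf.aestronglyMeasurable b
    (ae_restrict_of_forall_mem hK.measurableSet hb)

/-- The commutator of the covariant derivatives is the magnetic field. -/
theorem hasWeakDiv_commutator {f : Plane → ℂ} {f' : Fin 2 → Plane → ℂ}
    (h : HasCovPartials n f f') (hf : IsL2Loc f) (hf' : ∀ j, IsL2Loc (f' j)) :
    HasWeakDiv ![f' 1, fun x => -f' 0 x] fun x => -Complex.I * n * f x +
      ∑ j, Complex.I * (bgPotential n x j : ℂ) *
        (![f' 1, fun x => -f' 0 x] : Fin 2 → Plane → ℂ) j x := by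
  have hc : ∀ j, Continuous fun x => Complex.I * (bgPotential n x j : ℂ) := fun j =>
    continuous_const.mul (Complex.continuous_ofReal.comp (continuous_bgPotential n j))
  have hd : ∀ j, IsL2Loc fun x => f' j x + Complex.I * (bgPotential n x j : ℂ) * f x := fun j =>
    (hf' j).add (hf.continuous_mul (hc j))
  have hg : ∀ i j, HasWeakPartial j (fun x => (bgPotential n x i : ℂ))
      fun _ => (bgPotential n (coordVec j) i : ℂ) := by
    intro i j
    have := (hasWeakPartial_of_contDiff (contDiff_bgPotential n i) j).clm_comp Complex.ofRealCLM
    simp only [fderiv_bgPotential] at this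
    exact this
  have hm : ∀ i j, HasWeakPartial j (fun x => f x * (bgPotential n x i : ℂ)) fun x =>
      f x * (bgPotential n (coordVec j) i : ℂ) +
        (f' j x + Complex.I * (bgPotential n x j : ℂ) * f x) * (bgPotential n x i : ℂ) :=
    fun i j => (h j).mul hf (hd j) (isL2Loc_of_continuous (f := fun x => (bgPotential n x i : ℂ))
      (Complex.continuous_ofReal.comp (continuous_bgPotential n i)))
      (g' := fun j _ => (bgPotential n (coordVec j) i : ℂ))
      (fun _ => isL2Loc_of_continuous continuous_const) (hg i)
  -- This field is the difference between the rotated covariant gradient and the rotated gradient.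
  -- In its divergence the derivatives of the potential combine to ∂₀a₁ - ∂₁a₀ = n.
  have hA : HasWeakDiv ![fun x => -Complex.I * (f x * (bgPotential n x 1 : ℂ)),
      fun x => Complex.I * (f x * (bgPotential n x 0 : ℂ))] fun x =>
      -Complex.I * (f x * (bgPotential n (coordVec 0) 1 : ℂ) +
        (f' 0 x + Complex.I * (bgPotential n x 0 : ℂ) * f x) * (bgPotential n x 1 : ℂ)) +
      Complex.I * (f x * (bgPotential n (coordVec 1) 0 : ℂ) +
        (f' 1 x + Complex.I * (bgPotential n x 1 : ℂ) * f x) * (bgPotential n x 0 : ℂ)) := by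
    have := HasWeakDiv.of_partial (V := ![fun x => -Complex.I * (f x * (bgPotential n x 1 : ℂ)),
      fun x => Complex.I * (f x * (bgPotential n x 0 : ℂ))]) (U := ![fun x =>
      -Complex.I * (f x * (bgPotential n (coordVec 0) 1 : ℂ) +
        (f' 0 x + Complex.I * (bgPotential n x 0 : ℂ) * f x) * (bgPotential n x 1 : ℂ)), fun x =>
      Complex.I * (f x * (bgPotential n (coordVec 1) 0 : ℂ) +
        (f' 1 x + Complex.I * (bgPotential n x 1 : ℂ) * f x) * (bgPotential n x 0 : ℂ))])
      (fun j => by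
        fin_cases j
        · exact (hm 1 0).const_smul (-Complex.I)
        · exact (hm 0 1).const_smul Complex.I)
    simpa only [Fin.sum_univ_two, Matrix.cons_val_zero, Matrix.cons_val_one] using this
  refine ((hasWeakDiv_rotated_gradient h).add hA).congr (fun j => ?_) ?_
  · fin_cases j
    · refine Eventually.of_forall fun x => ?_
      simp
      ring
    · refine Eventually.of_forall fun x => ?_
      simp
      ring
  · refine Eventually.of_forall fun x => ?_
    simp [Fin.sum_univ_two, bgPotential, J, coordVec]
    ring_nf

/-- The commutator [D₀, D₁] = -in is tested with v itself, so only first derivatives of v occur.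
This matters because it is applied also to D₀w + iD₁w, which has only one derivative left. -/
theorem inner_commutator {v : GaugeL2 n τ} {v' : Fin 2 → GaugeL2 n τ}
    (h : HasCovPartials n v.1 fun j => (v' j).1) :
    inner ℂ (v' 0) (v' 1) - inner ℂ (v' 1) (v' 0) = Complex.I * n * inner ℂ v v := by
  have h1 := hasWeakDiv_commutator h v.isL2Loc fun j => (v' j).isL2Loc
  have h2 := GaugeL2.pairing (V := ![v' 1, -v' 0]) (W := (-Complex.I * n) • v) (g := v) (g' := v')
    (h1.congr (fun j => ?_) ?_) h
  · simp only [Fin.sum_univ_two, Matrix.cons_val_zero, Matrix.cons_val_one, inner_neg_right,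
      inner_smul_right] at h2
    linear_combination h2
  · fin_cases j
    · exact EventuallyEq.rfl
    · exact (QP.coeFn_neg (v' 0)).mono fun x hx => hx.symm
  · filter_upwards [QP.coeFn_smul (-Complex.I * n) v, QP.coeFn_neg (v' 0)] with x h3 h4
    rw [h3]
    simp only [Fin.sum_univ_two, Matrix.cons_val_zero, Matrix.cons_val_one, h4, smul_eq_mul]

/-- With Q = D₀ + iD₁ these are the quadratic forms of Q*Q = -Δ - n and QQ* = -Δ + n, where Δ is the
magnetic Laplacian; `inner_commutator` evaluates the cross terms. -/
theorem norm_add_I_smul {v : GaugeL2 n τ} {v' : Fin 2 → GaugeL2 n τ}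
    (h : HasCovPartials n v.1 fun j => (v' j).1) :
    ‖v' 0 + Complex.I • v' 1‖ ^ 2 = ‖v' 0‖ ^ 2 + ‖v' 1‖ ^ 2 - n * ‖v‖ ^ 2 ∧
    ‖v' 0 - Complex.I • v' 1‖ ^ 2 = ‖v' 0‖ ^ 2 + ‖v' 1‖ ^ 2 + n * ‖v‖ ^ 2 := by
  have h1 := inner_commutator h
  rw [← inner_conj_symm (v' 1) (v' 0), inner_self_eq_norm_sq_to_K] at h1
  have h2 := congrArg Complex.im h1
  have h3 : 2 * (inner ℂ (v' 0) (v' 1)).im = n * ‖v‖ ^ 2 := by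
    have e : (Complex.I * n * ((‖v‖ : ℂ)) ^ 2).im = n * ‖v‖ ^ 2 := by
      rw [mul_assoc, Complex.I_mul_im, ← Complex.ofReal_natCast, ← Complex.ofReal_pow,
        ← Complex.ofReal_mul, Complex.ofReal_re]
    have h4 := h2.trans e
    rw [Complex.sub_im, Complex.conj_im] at h4
    linarith
  rw [@norm_add_sq ℂ, @norm_sub_sq ℂ]
  simp only [inner_smul_right, norm_smul, Complex.norm_I, one_mul, RCLike.re_eq_complex_re,
    Complex.I_mul_re]
  constructor <;> linarith

/-- The weak divergence of (D₁w, -D₀w) is computed in two ways, from the commutator identity and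
from the second derivatives of w; weak divergences are unique. -/
theorem DD_commutator (w : GaugeH2 n τ) :
    Sobolev2.DD 0 1 w - Sobolev2.DD 1 0 w = (-Complex.I * n) • Sobolev2.val w := by
  have h1 := hasWeakDiv_commutator (hasCovPartials_val w) (Sobolev2.val w).isL2Loc
    fun j => (Sobolev2.D j w).isL2Loc
  have h2 := HasWeakDiv.of_partial (V := ![(Sobolev2.D 1 w).1, fun x => -(Sobolev2.D 0 w).1 x])
    (U := ![fun x => (Sobolev2.DD 0 1 w).1 x + Complex.I * (bgPotential n x 0 : ℂ) *
      (Sobolev2.D 1 w).1 x, fun x => -((Sobolev2.DD 1 0 w).1 x +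
        Complex.I * (bgPotential n x 1 : ℂ) * (Sobolev2.D 0 w).1 x)]) (fun j => by
      fin_cases j
      · exact hasCovPartials_D 1 w 0
      · exact (hasCovPartials_D 0 w 1).neg)
  have h3 := ae_eq_of_integral_contDiff_smul_eq h1.right h2.right fun φ h4 h5 =>
    neg_injective ((h1.integral_eq φ h4 h5).symm.trans (h2.integral_eq φ h4 h5))
  refine QP.ext_ae ?_
  filter_upwards [h3, QP.coeFn_sub (Sobolev2.DD 0 1 w) (Sobolev2.DD 1 0 w),
    QP.coeFn_smul (-Complex.I * n) (Sobolev2.val w)] with x h4 h5 h6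
  rw [h5, h6, smul_eq_mul]
  simp only [Fin.sum_univ_two, Matrix.cons_val_zero, Matrix.cons_val_one] at h4
  linear_combination -h4

/-- The spectral gap of the magnetic Laplacian above its lowest eigenvalue `n`. -/
theorem laplacian_gap (w : GaugeH2 n τ) (A : GaugeL2 n τ)
    (hA : A = -(Sobolev2.DD 0 0 w + Sobolev2.DD 1 1 w) - (n : ℂ) • Sobolev2.val w) :
    0 ≤ (inner ℂ A (Sobolev2.val w)).re ∧
      2 * n * (inner ℂ A (Sobolev2.val w)).re ≤ ‖A‖ ^ 2 := by
  have e1 : (inner ℂ A (Sobolev2.val w)).re = ‖Sobolev2.D 0 w + Complex.I • Sobolev2.D 1 w‖ ^ 2 := by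
    rw [(norm_add_I_smul (v' := fun j => Sobolev2.D j w) (hasCovPartials_val w)).1,
      ← inner_conj_symm, Complex.conj_re, hA, inner_sub_right, inner_laplacian, inner_smul_right]
    simp only [inner_self_eq_norm_sq_to_K, Fin.sum_univ_two]
    norm_cast
    change (((‖Sobolev2.D 0 w‖ ^ 2 + ‖Sobolev2.D 1 w‖ ^ 2 : ℝ) : ℂ) -
      (n : ℂ) * ((‖Sobolev2.val w‖ ^ 2 : ℝ) : ℂ)).re = _
    rw [← Complex.ofReal_natCast, ← Complex.ofReal_mul, ← Complex.ofReal_sub, Complex.ofReal_re]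
  -- Put v = Qw with Q = D₀ + iD₁, so that ⟨A, w⟩ = ‖v‖² and A = Q*v. The two identities of
  -- `norm_add_I_smul` for v differ by 2n‖v‖², and give ‖A‖² = ‖Qv‖² + 2n‖v‖².
  have h2 : HasCovPartials n (Sobolev2.D 0 w + Complex.I • Sobolev2.D 1 w).1
      fun k => (Sobolev2.DD k 0 w + Complex.I • Sobolev2.DD k 1 w).1 := fun k =>
    weakCov_add (hasCovPartials_D 0 w k) (weakCov_smul Complex.I (hasCovPartials_D 1 w k))
  have h3 := norm_add_I_smul
    (v' := fun k => Sobolev2.DD k 0 w + Complex.I • Sobolev2.DD k 1 w) h2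
  have e2 : (Sobolev2.DD 0 0 w + Complex.I • Sobolev2.DD 0 1 w) -
      Complex.I • (Sobolev2.DD 1 0 w + Complex.I • Sobolev2.DD 1 1 w) = -A := by
    have h4 := congrArg (Complex.I • ·) (DD_commutator w)
    simp only [smul_sub, smul_smul, neg_mul, mul_neg, ← mul_assoc, Complex.I_mul_I] at h4
    simp only [smul_add, smul_smul, Complex.I_mul_I, hA]
    simp only [neg_smul, one_smul, neg_neg, one_mul] at h4 ⊢
    rw [← h4]
    abel
  have h4 := h3.2
  have h5 := h3.1
  simp only [e2, norm_neg] at h4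
  refine ⟨by rw [e1]; positivity, ?_⟩
  rw [e1, h4]
  have h6 : 0 ≤ ‖Sobolev2.DD 0 0 w + Complex.I • Sobolev2.DD 0 1 w +
    Complex.I • (Sobolev2.DD 1 0 w + Complex.I • Sobolev2.DD 1 1 w)‖ ^ 2 := sq_nonneg _
  simp only at h5
  linarith

end Landau

/-! ### The Poincaré inequality on the cell, by duality and translation. -/

section Poincare

/-- Real, lattice-periodic, locally square integrable functions. -/
abbrev PerR (τ : UpperHalfPlane) := QP ℝ ℝ τ (fun _ _ _ => 1)

variable {τ : UpperHalfPlane}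

theorem volume_cell_ne_zero : volume (cell τ) ≠ 0 := by
  intro h
  have h1 : ∀ᵐ x : Plane, x ∈ cell τ → False := measure_mono_null (fun x hx => by simpa using hx) h
  have h2 : ∀ᵐ _ : Plane, False :=
    ae_of_ae_cell (τ := τ) (fun _ _ => Eventually.of_forall fun _ h => h) h1
  rw [ae_iff] at h2
  simp at h2

theorem PerR.isPeriodic (u : PerR τ) : IsPeriodic τ u.1 := fun p q => by
  filter_upwards [u.2.1 p q] with x hx
  rw [hx, one_smul]

theorem eLpNorm_le_mul_norm {K : Set Plane} (hK : IsCompact K) :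
    ∃ C : ℝ, 0 ≤ C ∧ ∀ u : PerR τ,
      eLpNorm u.1 2 (volume.restrict K) ≤ ENNReal.ofReal (C * ‖u‖) := by
  obtain ⟨N, hN⟩ := exists_setLIntegral_le τ hK
  refine ⟨√N, Real.sqrt_nonneg _, fun u => ?_⟩
  have h1 := hN (fun x => ‖u.1 x‖ₑ ^ (2 : ℝ)) fun p q => by
    filter_upwards [u.2.1 p q] with x hx
    rw [hx, one_smul]
  rw [ENNReal.ofReal_mul (Real.sqrt_nonneg _), ofReal_norm, QP.enorm_eq,
    eLpNorm_eq_lintegral_rpow_enorm_toReal (by norm_num) (by norm_num),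
    eLpNorm_eq_lintegral_rpow_enorm_toReal (by norm_num) (by norm_num)]
  simp only [ENNReal.toReal_ofNat]
  have h2 : ENNReal.ofReal √N = (N : ENNReal) ^ (1 / 2 : ℝ) := by
    rw [Real.sqrt_eq_rpow, ← ENNReal.ofReal_rpow_of_nonneg (by positivity) (by norm_num),
      ENNReal.ofReal_natCast]
  rw [h2, ← ENNReal.mul_rpow_of_nonneg _ _ (by norm_num)]
  exact ENNReal.rpow_le_rpow h1 (by norm_num)

/-- Cauchy–Schwarz, together with the bound of the L² norm of u on a compact set by its norm on the
cell. -/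
theorem exists_abs_correlation_le {K B : Set Plane} (hK : IsCompact K) (hB : IsCompact B) :
    ∃ C : ℝ, 0 ≤ C ∧ ∀ k : Plane → ℝ, MemLp k 2 volume → (∀ x ∉ K, k x = 0) → ∀ u : PerR τ,
      ∀ y ∈ B, |∫ x, k x * u.1 (x - y)| ≤ C * (eLpNorm k 2 volume).toReal * ‖u‖ := by
  obtain ⟨K', hK', hsub⟩ := exists_compact_sub hK hB
  obtain ⟨C, hC0, hC⟩ := eLpNorm_le_mul_norm (τ := τ) hK'
  refine ⟨C, hC0, fun k hk hk0 u y hy => ?_⟩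
  set G := K'.indicator u.1 with hG
  have hGm : MemLp G 2 volume := u.isL2Loc.memLp_indicator hK'
  have mp := measurePreserving_sub_right (volume : Measure Plane) y
  have hGy : MemLp (fun x => G (x - y)) 2 volume := hGm.comp_measurePreserving mp
  have e : ∫ x, k x * u.1 (x - y) = ∫ x, (k • fun x => G (x - y)) x := by
    refine integral_congr_ae (Eventually.of_forall fun x => ?_)
    by_cases hx : x ∈ K
    · simp [hG, hsub x hx y hy]
    · simp [hk0 x hx]
  have h1 := eLpNorm_smul_le_mul_eLpNorm (r := 1) (p := 2) (q := 2) hGy.1 hk.1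
  have h2 : eLpNorm (fun x => G (x - y)) 2 volume ≤ ENNReal.ofReal (C * ‖u‖) := by
    refine le_trans (le_of_eq ?_) (hC u)
    have := eLpNorm_comp_measurePreserving (p := 2) hGm.1 mp
    refine Eq.trans this ?_
    rw [hG, eLpNorm_indicator_eq_eLpNorm_restrict hK'.measurableSet]
  have h3 : ‖∫ x, (k • fun x => G (x - y)) x‖ₑ ≤
      ENNReal.ofReal (C * (eLpNorm k 2 volume).toReal * ‖u‖) := by
    refine (enorm_integral_le_lintegral_enorm _).trans ?_
    rw [← eLpNorm_one_eq_lintegral_enorm]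
    refine (h1.trans (mul_le_mul_right h2 _)).trans (le_of_eq ?_)
    rw [mul_comm C (ENNReal.toReal _), mul_assoc, ENNReal.ofReal_mul ENNReal.toReal_nonneg,
      ENNReal.ofReal_toReal hk.eLpNorm_ne_top]
  rw [e, ← Real.norm_eq_abs]
  rw [← ofReal_norm] at h3
  exact (ENNReal.ofReal_le_ofReal_iff (by positivity)).1 h3

theorem norm_le_of_coordVec {T : Plane →L[ℝ] ℝ} {b : ℝ} (h : ∀ j, |T (coordVec j)| ≤ b) :
    ‖T‖ ≤ 2 * b := by
  have hb : 0 ≤ b := (abs_nonneg _).trans (h 0)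
  refine T.opNorm_le_bound (by positivity) fun v => ?_
  have e : v = v 0 • coordVec 0 + v 1 • coordVec 1 := by
    ext i
    fin_cases i <;> simp [coordVec]
  have h1 : ∀ j, |v j| ≤ ‖v‖ := fun j => by
    simpa using PiLp.norm_apply_le v j
  calc ‖T v‖ = |v 0 * T (coordVec 0) + v 1 * T (coordVec 1)| := by
        conv_lhs => rw [e]
        simp
    _ ≤ |v 0| * |T (coordVec 0)| + |v 1| * |T (coordVec 1)| := by
        rw [← abs_mul, ← abs_mul]
        exact abs_add_le _ _
    _ ≤ ‖v‖ * b + ‖v‖ * b := by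
        gcongr
        exacts [h1 0, h 0, h1 1, h 1]
    _ = 2 * b * ‖v‖ := by ring

/-- Translations are Lipschitz in the weak sense. -/
theorem exists_abs_translate_sub_le {K : Set Plane} (hK : IsCompact K) (R : ℝ) :
    ∃ C : ℝ, 0 ≤ C ∧ ∀ (u : PerR τ) (u' : Fin 2 → PerR τ),
      (∀ j, HasWeakPartial j u.1 (u' j).1) → ∀ φ : Plane → ℝ, ContDiff ℝ ∞ φ →
      HasCompactSupport φ → (∀ x ∉ K, φ x = 0) → ∀ y ∈ Metric.closedBall (0 : Plane) R,
      |(∫ x, φ x * u.1 (x - y)) - ∫ x, φ x * u.1 x| ≤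
        C * (eLpNorm φ 2 volume).toReal * (‖u' 0‖ + ‖u' 1‖) := by
  obtain ⟨C, hC0, hC⟩ := exists_abs_correlation_le (τ := τ) hK
    (isCompact_closedBall (0 : Plane) R)
  refine ⟨2 * C * |R|, by positivity, fun u u' hu φ h1 h2 h3 y hy => ?_⟩
  have hR : 0 ≤ R := (norm_nonneg y).trans (mem_closedBall_zero_iff.1 hy)
  have hφ : MemLp φ 2 volume := h1.continuous.memLp_of_hasCompactSupport h2
  -- Written as a mollification of u(-·), the correlation is smooth in y, and its gradient is a
  -- correlation of φ with the derivatives of u. The mean value inequality on the ball concludes.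
  set F : Plane → ℝ := fun y => ∫ x, φ x * u.1 (-(y - x)) with hF
  have hd : ∀ j y, fderiv ℝ F y (coordVec j) = ∫ x, φ x * -(u' j).1 (-(y - x)) := fun j y =>
    fderiv_mollify (hu j).comp_neg h1 h2 y
  have hdiff : Differentiable ℝ F :=
    (contDiff_mollify (hu 0).comp_neg.1 h1 h2).differentiable (by simp)
  have hb : ∀ z ∈ Metric.closedBall (0 : Plane) R, ‖fderiv ℝ F z‖ ≤
      2 * (C * (eLpNorm φ 2 volume).toReal * (‖u' 0‖ + ‖u' 1‖)) := by
    intro z hz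
    refine norm_le_of_coordVec fun j => ?_
    rw [hd]
    have h4 := hC φ hφ h3 (u' j) z hz
    simp only [neg_sub, mul_neg, integral_neg, abs_neg]
    refine h4.trans ?_
    gcongr
    fin_cases j
    · exact le_add_of_nonneg_right (norm_nonneg _)
    · exact le_add_of_nonneg_left (norm_nonneg _)
  have h4 := (convex_closedBall (0 : Plane) R).norm_image_sub_le_of_norm_fderiv_le
    (fun z _ => hdiff z) hb (Metric.mem_closedBall_self hR) hy
  simp only [hF, neg_sub, sub_zero, Real.norm_eq_abs] at h4
  refine h4.trans ?_
  have h5 : ‖y‖ ≤ |R| := (mem_closedBall_zero_iff.1 hy).trans (le_abs_self R)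
  calc _ ≤ 2 * (C * (eLpNorm φ 2 volume).toReal * (‖u' 0‖ + ‖u' 1‖)) * |R| := by gcongr
    _ = _ := by ring

/-- Θ is the mollified indicator of the cell: by `integral_periodization`, integrating a periodic
function against it is a multiple of integrating over the cell. -/
theorem exists_partition (τ : UpperHalfPlane) :
    ∃ Θ : Plane → ℝ, Continuous Θ ∧ HasCompactSupport Θ ∧ (∀ x, 0 ≤ Θ x) ∧ 0 < ∫ x, Θ x ∧
      ∀ u : PerR τ, ∫ x in cell τ, u.1 x = 0 → ∀ x, ∫ y, Θ y * u.1 (x - y) = 0 := by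
  let b : ContDiffBump (0 : Plane) := ⟨1, 2, one_pos, one_lt_two⟩
  have hη : ContDiff ℝ ∞ b := b.contDiff
  have hηc : HasCompactSupport b := b.hasCompactSupport
  set χ : Plane → ℝ := (cell τ).indicator fun _ => (1 : ℝ) with hχ
  obtain ⟨K, hK, hcell⟩ := cell_subset_ball τ
  have hχc : HasCompactSupport χ := HasCompactSupport.intro hK fun x hx =>
    indicator_of_notMem (fun h => hx (hcell h)) _
  have hχ0 : ∀ x, 0 ≤ χ x := fun x => indicator_nonneg (fun _ _ => zero_le_one) x
  refine ⟨fun x => ∫ y, b y * χ (x - y),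
    (contDiff_mollify locallyIntegrable_indicator_cell hη hηc).continuous,
    hηc.convolution (ContinuousLinearMap.lsmul ℝ ℝ) hχc,
    fun x => integral_nonneg fun y => mul_nonneg b.nonneg (hχ0 _), ?_, fun u hu x => ?_⟩
  · have h1 := integral_periodization (τ := τ) hη.continuous hηc
      (f := fun _ => (1 : ℂ)) (locallyIntegrable_const _) fun p q => Eventually.of_forall fun _ => rfl
    simp only [Complex.real_smul, mul_one, integral_complex_ofReal, setIntegral_const] at h1
    have h2 : ∫ x, ∫ y, b y * χ (x - y) = (∫ y, b y) * volume.real (cell τ) := by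
      exact_mod_cast h1
    rw [h2]
    refine mul_pos b.integral_pos ?_
    rw [measureReal_def]
    exact ENNReal.toReal_pos volume_cell_ne_zero (volume_cell_lt_top τ).ne
  · have hq : IsPeriodic τ fun y => (u.1 (x - y) : ℂ) := by
      intro p q
      have h1 := (Measure.measurePreserving_sub_left (volume : Measure Plane)
        x).quasiMeasurePreserving.ae (u.isPeriodic (-p) (-q))
      filter_upwards [h1] with y hy
      have e : latticeVec τ (-p) (-q) = -latticeVec τ p q := by
        ext i
        fin_cases i <;> simp [latticeVec, latticePoint] <;> ring
      rw [e] at hy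
      rw [← hy]
      congr 2
      abel
    have hl : LocallyIntegrable fun y => (u.1 (x - y) : ℂ) := by
      have h1 := locallyIntegrable_comp_neg u.locallyIntegrable
      rw [locallyIntegrable_iff] at h1 ⊢
      intro K₁ hK₁
      have h2 := h1 ((fun y => y - x) '' K₁) (hK₁.image (by fun_prop))
      have h3 := ((measurePreserving_sub_right (volume : Measure Plane) x).integrableOn_image
        (MeasurableEquiv.subRight x).measurableEmbedding).1 h2
      refine h3.ofReal.congr (Eventually.of_forall fun y => ?_)
      simp
    have h1 := integral_periodization (τ := τ) hη.continuous hηc hl hq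
    have h2 : ∫ y in cell τ, u.1 (x - y) = 0 := by
      have h3 : IsPeriodic τ fun y => u.1 (x + y) := by
        intro p q
        filter_upwards [(measurePreserving_add_left (volume : Measure Plane)
          x).quasiMeasurePreserving.ae (u.isPeriodic p q)] with y hy
        rw [← hy, add_assoc]
      have h4 := h3.setIntegral_neg
      have h5 := u.isPeriodic.setIntegral_add_right x
      simp only [← sub_eq_add_neg] at h4
      rw [h4, ← hu, ← h5]
      simp only [add_comm]
    have h3 : ∫ y in cell τ, (u.1 (x - y) : ℂ) = 0 := by
      rw [integral_complex_ofReal, h2, Complex.ofReal_zero]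
    rw [h3, smul_zero] at h1
    simp only [Complex.real_smul, ← Complex.ofReal_mul, integral_complex_ofReal] at h1
    exact_mod_cast h1

/-- Averaging y ↦ ∫ φ(x) u(x - y) dx with the weight Θ gives zero, because u has mean zero. So ∫ φ u
is, up to sign, an average of its own changes under translation, and these are bounded by the
derivatives of u. -/
theorem exists_abs_integral_test_le {K : Set Plane} (hK : IsCompact K) :
    ∃ C : ℝ, 0 ≤ C ∧ ∀ (u : PerR τ) (u' : Fin 2 → PerR τ),
      (∀ j, HasWeakPartial j u.1 (u' j).1) → ∫ x in cell τ, u.1 x = 0 →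
      ∀ φ : Plane → ℝ, ContDiff ℝ ∞ φ → HasCompactSupport φ → (∀ x ∉ K, φ x = 0) →
      |∫ x, φ x * u.1 x| ≤ C * (eLpNorm φ 2 volume).toReal * (‖u' 0‖ + ‖u' 1‖) := by
  obtain ⟨Θ, hΘ, hΘc, hΘ0, hΘ1, hΘu⟩ := exists_partition τ
  obtain ⟨R, hR⟩ := hΘc.isCompact.isBounded.subset_closedBall (0 : Plane)
  obtain ⟨C, hC0, hC⟩ := exists_abs_translate_sub_le (τ := τ) hK R
  refine ⟨C, hC0, fun u u' hu hmean φ h1 h2 h3 => ?_⟩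
  have hφ : MemLp φ 2 volume := h1.continuous.memLp_of_hasCompactSupport h2
  have hi := integrable_mollify (k := fun x => (φ x : ℂ)) (g := fun x => (u.1 x : ℂ))
    (hφ.ofReal) hK (fun x hx => by simp [h3 x hx]) (u.isL2Loc.clm_comp Complex.ofRealCLM) hΘ hΘc
  have hi' : Integrable (fun p : Plane × Plane => Θ p.2 * (φ p.1 * u.1 (p.1 - p.2)))
      (volume.prod volume) := by
    refine hi.re.congr (Eventually.of_forall fun p => ?_)
    simp only [← Complex.ofReal_mul]
    exact Complex.ofReal_re _
  have hsw := integral_integral_swap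
    (f := fun x y => Θ y * (φ x * u.1 (x - y))) hi'
  have e1 : ∫ x, ∫ y, Θ y * (φ x * u.1 (x - y)) = 0 := by
    have : ∀ x, ∫ y, Θ y * (φ x * u.1 (x - y)) = 0 := fun x => by
      simp only [mul_left_comm _ (φ x), integral_const_mul, hΘu u hmean x, mul_zero]
    simp only [this, integral_zero]
  have hΘi : Integrable Θ := hΘ.integrable_of_hasCompactSupport hΘc
  have hi2 : Integrable fun y => Θ y * ∫ x, φ x * u.1 (x - y) := by
    refine hi'.swap.integral_prod_left.congr (Eventually.of_forall fun y => ?_)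
    simp [integral_const_mul]
  rw [e1] at hsw
  simp only [integral_const_mul] at hsw
  set c := ∫ x, φ x * u.1 x with hc
  set D := C * (eLpNorm φ 2 volume).toReal * (‖u' 0‖ + ‖u' 1‖) with hD
  have e2 : ∫ y, Θ y * ((∫ x, φ x * u.1 (x - y)) - c) = -((∫ y, Θ y) * c) := by
    simp only [mul_sub]
    rw [integral_sub hi2 (hΘi.mul_const c), ← hsw, integral_mul_const, zero_sub]
  have e3 : |∫ y, Θ y * ((∫ x, φ x * u.1 (x - y)) - c)| ≤ ∫ y, Θ y * D := by
    rw [← Real.norm_eq_abs]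
    refine norm_integral_le_of_norm_le (hΘi.mul_const D) (Eventually.of_forall fun y => ?_)
    rw [norm_mul, Real.norm_of_nonneg (hΘ0 y)]
    by_cases hy : y ∈ tsupport Θ
    · exact mul_le_mul_of_nonneg_left (hC u u' hu φ h1 h2 h3 y (hR hy)) (hΘ0 y)
    · simp [image_eq_zero_of_notMem_tsupport hy]
  rw [e2, abs_neg, abs_mul, abs_of_pos hΘ1, integral_mul_const] at e3
  exact le_of_mul_le_mul_left e3 hΘ1

/-- The Poincaré inequality for periodic functions of mean zero. -/
theorem poincare_inequality (τ : UpperHalfPlane) :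
    ∃ C : ℝ, 0 ≤ C ∧ ∀ (u : PerR τ) (u' : Fin 2 → PerR τ),
      (∀ j, HasWeakPartial j u.1 (u' j).1) → ∫ x in cell τ, u.1 x = 0 →
      ‖u‖ ≤ C * (‖u' 0‖ + ‖u' 1‖) := by
  obtain ⟨K₀, hK₀, hcell⟩ := cell_subset_ball τ
  obtain ⟨r, hr⟩ := hK₀.isBounded.subset_closedBall (0 : Plane)
  -- This bump equals 1 on the cell. It confines the smooth approximants of u on the cell to one
  -- compact set, so that the constants C and N do not depend on them.
  let b : ContDiffBump (0 : Plane) := ⟨max r 1, max r 1 + 1, by positivity, by linarith⟩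
  have hb1 : ∀ x ∈ cell τ, b x = 1 := fun x hx =>
    b.one_of_mem_closedBall (Metric.closedBall_subset_closedBall (le_max_left _ _) (hr (hcell hx)))
  have hbc : HasCompactSupport b := b.hasCompactSupport
  have hbs : ContDiff ℝ ∞ b := b.contDiff
  have hK : IsCompact (tsupport b) := hbc
  obtain ⟨C, hC0, hC⟩ := exists_abs_integral_test_le (τ := τ) hK
  obtain ⟨N, hN0, hN⟩ := exists_abs_correlation_le (τ := τ) hK isCompact_singleton (B := {0})
  refine ⟨C, hC0, fun u u' hu hmean => ?_⟩
  set D := ‖u' 0‖ + ‖u' 1‖ with hD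
  have hD0 : 0 ≤ D := by positivity
  set k : Plane → ℝ := (cell τ).indicator u.1 with hk
  have hkm : MemLp k 2 volume := (memLp_indicator_iff_restrict (measurableSet_cell τ)).2 u.memLp_cell
  have hkn : (eLpNorm k 2 volume).toReal = ‖u‖ := by
    rw [hk, eLpNorm_indicator_eq_eLpNorm_restrict (measurableSet_cell τ), ← QP.enorm_eq,
      toReal_enorm]
  have hku : ∫ x, k x * u.1 x = ‖u‖ ^ 2 := by
    rw [← real_inner_self_eq_norm_sq, QP.inner_eq, ← integral_indicator (measurableSet_cell τ)]
    refine integral_congr_ae (Eventually.of_forall fun x => ?_)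
    by_cases hx : x ∈ cell τ <;> simp [hk, hx, sq]
  -- ‖u‖² is the pairing of u with its restriction k to the cell. Replacing k by a smooth φ within ε
  -- in L² gives the duality bound for φ plus a Cauchy–Schwarz bound for k - φ.
  have hε : ∀ ε : ℝ, 0 < ε → ‖u‖ ^ 2 ≤ C * (‖u‖ + ε) * D + N * ε * ‖u‖ := by
    intro ε hε
    obtain ⟨g, hg1, hg2, hg3⟩ := hkm.exist_eLpNorm_sub_le (by norm_num) (by norm_num) hε
    have hgm : MemLp g 2 volume := hg2.continuous.memLp_of_hasCompactSupport hg1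
    set φ : Plane → ℝ := fun x => b x * g x with hφ
    have hφ0 : ∀ x ∉ tsupport b, φ x = 0 := fun x hx => by
      simp [hφ, image_eq_zero_of_notMem_tsupport hx]
    have hφs : ContDiff ℝ ∞ φ := hbs.mul hg2
    have hφc : HasCompactSupport φ := hg1.mul_left
    have hφm : MemLp φ 2 volume := hφs.continuous.memLp_of_hasCompactSupport hφc
    have hble : ∀ x, ‖b x‖ ≤ 1 := fun x => by
      rw [Real.norm_of_nonneg b.nonneg]
      exact b.le_one
    have n1 : (eLpNorm φ 2 volume).toReal ≤ ‖u‖ + ε := by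
      have h1 : eLpNorm φ 2 volume ≤ eLpNorm g 2 volume := eLpNorm_mono fun x => by
        rw [hφ, norm_mul]
        exact mul_le_of_le_one_left (norm_nonneg _) (hble x)
      have h2 : eLpNorm g 2 volume ≤ eLpNorm k 2 volume + ENNReal.ofReal ε := by
        have e : g = k - (k - g) := by simp
        conv_lhs => rw [e]
        exact (eLpNorm_sub_le hkm.1 (hkm.sub hgm).1 (by norm_num)).trans (by gcongr)
      have h3 := ENNReal.toReal_mono
        (ENNReal.add_ne_top.2 ⟨hkm.eLpNorm_ne_top, ENNReal.ofReal_ne_top⟩) (h1.trans h2)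
      rwa [ENNReal.toReal_add hkm.eLpNorm_ne_top ENNReal.ofReal_ne_top, hkn,
        ENNReal.toReal_ofReal hε.le] at h3
    have hdm : MemLp (fun x => k x - φ x) 2 volume := hkm.sub hφm
    have hkb : ∀ x, k x = b x * k x := fun x => by
      by_cases hx : x ∈ cell τ
      · rw [hb1 x hx, one_mul]
      · simp [hk, hx]
    have n2 : (eLpNorm (fun x => k x - φ x) 2 volume).toReal ≤ ε := by
      have h1 : eLpNorm (fun x => k x - φ x) 2 volume ≤ eLpNorm (k - g) 2 volume :=
        eLpNorm_mono fun x => by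
          rw [hkb x, hφ, ← mul_sub, norm_mul, Pi.sub_apply]
          exact mul_le_of_le_one_left (norm_nonneg _) (hble x)
      have h2 := ENNReal.toReal_mono ENNReal.ofReal_ne_top (h1.trans hg3)
      rwa [ENNReal.toReal_ofReal hε.le] at h2
    have hd0 : ∀ x ∉ tsupport b, k x - φ x = 0 := fun x hx => by
      rw [hφ0 x hx, hkb x, image_eq_zero_of_notMem_tsupport hx, zero_mul, sub_zero]
    have b1 := hC u u' hu hmean φ hφs hφc hφ0
    have b2 := hN _ hdm hd0 u 0 rfl
    simp only [sub_zero] at b2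
    have hint : ∀ l : Plane → ℝ, MemLp l 2 volume → (∀ x ∉ tsupport b, l x = 0) →
        Integrable fun x => l x * u.1 x := by
      intro l hl hl0
      refine (hl.integrable_mul (u.isL2Loc.memLp_indicator hK)).congr
        (Eventually.of_forall fun x => ?_)
      by_cases hx : x ∈ tsupport b
      · simp [hx]
      · simp [hl0 x hx]
    have e : ∫ x, k x * u.1 x = (∫ x, φ x * u.1 x) + ∫ x, (k x - φ x) * u.1 x := by
      rw [← integral_add (hint _ hφm hφ0) (hint _ hdm hd0)]
      refine integral_congr_ae (Eventually.of_forall fun x => ?_)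
      ring
    rw [← hku, e]
    refine add_le_add ((le_abs_self _).trans (b1.trans ?_)) ((le_abs_self _).trans (b2.trans ?_))
    · gcongr
    · gcongr
  have hlim : ‖u‖ ^ 2 ≤ C * ‖u‖ * D := by
    have hcont : Continuous fun ε : ℝ => C * (‖u‖ + ε) * D + N * ε * ‖u‖ := by fun_prop
    have ht : Tendsto (fun ε : ℝ => C * (‖u‖ + ε) * D + N * ε * ‖u‖) (𝓝[>] 0)
        (𝓝 (C * ‖u‖ * D)) := by
      have := (hcont.tendsto' 0 (C * ‖u‖ * D) (by ring)).mono_left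
        (nhdsWithin_le_nhds (s := Ioi (0 : ℝ)))
      exact this
    exact ge_of_tendsto ht (eventually_mem_nhdsWithin.mono fun ε h => hε ε h)
  rcases (norm_nonneg u).eq_or_lt with h0 | h0
  · rw [← h0]
    positivity
  · refine le_of_mul_le_mul_left ?_ h0
    calc ‖u‖ * ‖u‖ = ‖u‖ ^ 2 := by ring
      _ ≤ C * ‖u‖ * D := hlim
      _ = ‖u‖ * (C * D) := by ring

end Poincare

/-! ### Periodic vector fields and the operator curl* curl. -/

section CurlCurl

variable {τ : UpperHalfPlane}

theorem PerL2.exists_component (f : PerL2 τ) (i : Fin 2) : ∃ g : PerR τ, g.1 =ᵐ[volume] fun x => f.1 x i := by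
  refine QP.exists_coe_eq (fun _ _ _ => by simp) ?_ (fun p q => ?_) ?_
  · exact (f.isL2Loc.clm_comp (EuclideanSpace.proj (𝕜 := ℝ) i)).aestronglyMeasurable
  · filter_upwards [f.2.1 p q] with x hx
    rw [hx]
    rfl
  · exact (EuclideanSpace.proj (𝕜 := ℝ) i : Plane →L[ℝ] ℝ).comp_memLp' f.memLp_cell

/-- The `i`-th component of a periodic vector field. -/
def component (f : PerL2 τ) (i : Fin 2) : PerR τ := (f.exists_component i).choose

theorem component_spec (f : PerL2 τ) (i : Fin 2) : ∀ᵐ x : Plane, (component f i).1 x = f.1 x i :=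
  (f.exists_component i).choose_spec

theorem PerL2.inner_eq_sum (f g : PerL2 τ) :
    inner ℝ f g = inner ℝ (component f 0) (component g 0) + inner ℝ (component f 1) (component g 1) := by
  have hi : ∀ u v : PerR τ, Integrable (fun x => inner ℝ (u.1 x) (v.1 x))
      (volume.restrict (cell τ)) := fun u v => v.memLp_cell.integrable_mul u.memLp_cell
  rw [QP.inner_eq, QP.inner_eq, QP.inner_eq, ← integral_add (hi _ _) (hi _ _)]
  refine integral_congr_ae (ae_restrict_of_ae ?_)
  filter_upwards [component_spec f 0, component_spec f 1, component_spec g 0, component_spec g 1] with x h1 h2 h3 h4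
  rw [h1, h2, h3, h4, PiLp.inner_apply, Fin.sum_univ_two]

theorem PerL2.norm_sq_eq_sum (f : PerL2 τ) : ‖f‖ ^ 2 = ‖component f 0‖ ^ 2 + ‖component f 1‖ ^ 2 := by
  simp only [← real_inner_self_eq_norm_sq, PerL2.inner_eq_sum]

theorem PerL2.norm_component_le (f : PerL2 τ) (i : Fin 2) : ‖component f i‖ ≤ ‖f‖ := by
  have h := f.norm_sq_eq_sum
  refine le_of_sq_le_sq ?_ (norm_nonneg _)
  fin_cases i
  · exact h ▸ le_add_of_nonneg_right (sq_nonneg _)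
  · exact h ▸ le_add_of_nonneg_left (sq_nonneg _)

theorem hasWeakPartial_comp {j : Fin 2} {f g : PerL2 τ}
    (h : HasWeakPartial j f.1 fun x => g.1 x + (0 : ℝ) • f.1 x) (i : Fin 2) :
    HasWeakPartial j (component f i).1 (component g i).1 := by
  refine (h.clm_comp (EuclideanSpace.proj (𝕜 := ℝ) i)).congr ?_ ?_
  · filter_upwards [component_spec f i] with x hx
    rw [hx]
    rfl
  · filter_upwards [component_spec g i] with x hx
    rw [hx]
    simp

theorem hasWeakPartial_val_comp (u : PerH2 τ) (j i : Fin 2) :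
    HasWeakPartial j (component (Sobolev2.val u) i).1 (component (Sobolev2.D j u) i).1 :=
  hasWeakPartial_comp (u.2.1 j) i

theorem hasWeakPartial_D_comp (u : PerH2 τ) (k j i : Fin 2) :
    HasWeakPartial k (component (Sobolev2.D j u) i).1 (component (Sobolev2.DD k j u) i).1 :=
  hasWeakPartial_comp (u.2.2 k j) i

/-- Weak second derivatives commute. -/
theorem DD_comm_comp (u : PerH2 τ) (i : Fin 2) :
    (component (Sobolev2.DD 0 1 u) i).1 =ᵐ[volume] (component (Sobolev2.DD 1 0 u) i).1 := by
  have h1 := hasWeakDiv_rotated_gradient fun j =>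
    (hasWeakPartial_val_comp u j i).clm_comp Complex.ofRealCLM
  have h2 := HasWeakDiv.of_partial (V := ![fun x => ((component (Sobolev2.D 1 u) i).1 x : ℂ),
    fun x => -((component (Sobolev2.D 0 u) i).1 x : ℂ)]) (U :=
    ![fun x => ((component (Sobolev2.DD 0 1 u) i).1 x : ℂ),
      fun x => -((component (Sobolev2.DD 1 0 u) i).1 x : ℂ)]) (fun j => by
    fin_cases j
    · exact (hasWeakPartial_D_comp u 0 1 i).clm_comp Complex.ofRealCLM
    · exact ((hasWeakPartial_D_comp u 1 0 i).clm_comp Complex.ofRealCLM).neg)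
  have h3 := ae_eq_of_integral_contDiff_smul_eq h1.right h2.right fun φ h4 h5 =>
    neg_injective ((h1.integral_eq φ h4 h5).symm.trans (h2.integral_eq φ h4 h5))
  filter_upwards [h3] with x hx
  simp only [Fin.sum_univ_two, Matrix.cons_val_zero, Matrix.cons_val_one] at hx
  have h4 : ((component (Sobolev2.DD 0 1 u) i).1 x : ℂ) = ((component (Sobolev2.DD 1 0 u) i).1 x : ℂ) := by
    linear_combination -hx
  exact_mod_cast h4

theorem integral_add_four {μ : Measure Plane} {a b c d : Plane → ℝ} (ha : Integrable a μ)
    (hb : Integrable b μ) (hc : Integrable c μ) (hd : Integrable d μ) :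
    ∫ x, (a x + b x + c x + d x) ∂μ = ∫ x, a x ∂μ + ∫ x, b x ∂μ + ∫ x, c x ∂μ + ∫ x, d x ∂μ := by
  have h1 := integral_add ((ha.add hb).add hc) hd
  have h2 := integral_add (ha.add hb) hc
  have h3 := integral_add ha hb
  simp only [Pi.add_apply] at h1 h2 h3
  rw [h1, h2, h3]

/-- Integration by parts on the cell: the covariant version with zero potential and trivial
multipliers. -/
theorem PerR.pairing {V U g' : Fin 2 → PerR τ} {g : PerR τ}
    (hV : ∀ j, HasWeakPartial j (V j).1 (U j).1) (hg : ∀ j, HasWeakPartial j g.1 (g' j).1) :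
    inner ℝ (g' 0) (V 0) + inner ℝ (g' 1) (V 1) + inner ℝ g (U 0) + inner ℝ g (U 1) = 0 := by
  have hc : ∀ u : PerR τ, IsL2Loc fun x => (u.1 x : ℂ) := fun u =>
    u.isL2Loc.clm_comp Complex.ofRealCLM
  have hp : ∀ (u : PerR τ) (p q : ℤ), ∀ᵐ x : Plane, (u.1 (x + latticeVec τ p q) : ℂ) =
      (fun _ _ _ => 1 : ℤ → ℤ → Plane → ℂ) p q x * (u.1 x : ℂ) := fun u p q => by
    filter_upwards [u.isPeriodic p q] with x hx
    rw [hx, one_mul]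
  have h1 := HasWeakDiv.of_partial fun j => (hV j).clm_comp Complex.ofRealCLM
  simp only [Fin.sum_univ_two] at h1
  have h2 := HasWeakDiv.cell_pairing (τ := τ) (a := fun _ _ => 0) (fun _ => continuous_const)
    (V := fun j x => ((V j).1 x : ℂ)) (W := fun x => ((U 0).1 x : ℂ) + ((U 1).1 x : ℂ))
    (g := fun x => (g.1 x : ℂ)) (g' := fun j x => ((g' j).1 x : ℂ))
    (by simpa using h1) (fun j => hc _) ((hc _).add (hc _)) (hc _) (fun j => hc _)
    (fun j => by simpa using (hg j).clm_comp Complex.ofRealCLM) (m := fun _ _ _ => 1)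
    (fun _ _ _ => by simp) (fun j => hp _) (fun p q => by
      filter_upwards [hp (U 0) p q, hp (U 1) p q] with x h3 h4
      rw [h3, h4, mul_add]) (hp _) (fun j => hp _)
  have hi : ∀ u v : PerR τ, Integrable (fun x => inner ℝ (u.1 x) (v.1 x))
      (volume.restrict (cell τ)) := fun u v => v.memLp_cell.integrable_mul u.memLp_cell
  have h3 : ∫ x in cell τ, (inner ℝ ((g' 0).1 x) ((V 0).1 x) + inner ℝ ((g' 1).1 x) ((V 1).1 x) +
      inner ℝ (g.1 x) ((U 0).1 x) + inner ℝ (g.1 x) ((U 1).1 x)) = 0 := by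
    rw [← Complex.ofReal_inj, Complex.ofReal_zero, ← h2, ← integral_complex_ofReal]
    refine integral_congr_ae (Eventually.of_forall fun x => ?_)
    simp [Fin.sum_univ_two]
    ring
  simp only [QP.inner_eq]
  exact (integral_add_four (hi _ _) (hi _ _) (hi _ _) (hi _ _)).symm.trans h3

/-- The form of the Laplacian on periodic vector fields. -/
theorem inner_laplacian_periodic (v u : PerH2 τ) :
    inner ℝ (Sobolev2.val v) (-(Sobolev2.DD 0 0 u + Sobolev2.DD 1 1 u)) =
      inner ℝ (Sobolev2.D 0 v) (Sobolev2.D 0 u) + inner ℝ (Sobolev2.D 1 v) (Sobolev2.D 1 u) := by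
  have h : ∀ i, _ := fun i => PerR.pairing (V := fun j => component (Sobolev2.D j u) i)
    (U := fun j => component (Sobolev2.DD j j u) i) (g := component (Sobolev2.val v) i)
    (g' := fun j => component (Sobolev2.D j v) i) (fun j => hasWeakPartial_D_comp u j j i)
    (fun j => hasWeakPartial_val_comp v j i)
  have h0 := h 0
  have h1 := h 1
  rw [inner_neg_right, inner_add_right]
  simp only [PerL2.inner_eq_sum]
  linarith

/-- A divergence free field of class `H²` has zero weak divergence. -/
theorem div_comp_eq_zero (α : H2alpha τ) : ∀ᵐ x : Plane,
    (component (Sobolev2.D 0 α.1) 0).1 x + (component (Sobolev2.D 1 α.1) 1).1 x = 0 := by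
  have h1 := hasWeakPartial_val_comp α.1 0 0
  have h2 := hasWeakPartial_val_comp α.1 1 1
  refine ae_eq_zero_of_integral_contDiff_smul_eq_zero (h1.2.1.add h2.2.1) fun φ h3 h4 => ?_
  have i1 := integrable_test_smul h1.2.1 h3.continuous h4
  have i2 := integrable_test_smul h2.2.1 h3.continuous h4
  have i3 : ∀ j, Integrable fun x => fderiv ℝ φ x (coordVec j) • (component (Sobolev2.val α.1) j).1 x :=
    fun j => integrable_test_smul (QP.locallyIntegrable _) (continuous_test_fderiv h3 _)
      (h4.fderiv_apply ℝ _)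
  have e := α.2.1.1 φ h3 h4
  have e2 : ∫ x, ((fderiv ℝ φ x (coordVec 0) • (component (Sobolev2.val α.1) 0).1 x) +
      fderiv ℝ φ x (coordVec 1) • (component (Sobolev2.val α.1) 1).1 x) = 0 := by
    refine Eq.trans (integral_congr_ae ?_) e
    filter_upwards [component_spec (Sobolev2.val α.1) 0, component_spec (Sobolev2.val α.1) 1] with x h5 h6
    rw [h5, h6, Fin.sum_univ_two]
    rfl
  rw [integral_add (i3 0) (i3 1), h1.2.2 φ h3 h4, h2.2.2 φ h3 h4] at e2
  simp only [smul_add]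
  rw [integral_add i1 i2]
  linarith

theorem DD_div_comp_eq_zero (α : H2alpha τ) (k : Fin 2) : ∀ᵐ x : Plane,
    (component (Sobolev2.DD k 0 α.1) 0).1 x + (component (Sobolev2.DD k 1 α.1) 1).1 x = 0 := by
  have h := (hasWeakPartial_D_comp α.1 k 0 0).add (hasWeakPartial_D_comp α.1 k 1 1)
  have h0 : HasWeakPartial k (0 : Plane → ℝ) 0 := HasWeakPartial.zero
  exact h.unique (h0.congr (by
    filter_upwards [div_comp_eq_zero α] with x hx
    exact hx.symm) EventuallyEq.rfl)

/-- On divergence free fields, `curl* curl` is minus the Laplacian. -/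
theorem curlCurl_eq (α : H2alpha τ) :
    curlCurl α =ᵐ[volume] (-(Sobolev2.DD 0 0 α.1 + Sobolev2.DD 1 1 α.1) : PerL2 τ).1 := by
  have hc : ∀ᵐ x : Plane, ∀ k j i, (component (Sobolev2.DD k j α.1) i).1 x =
      (Sobolev2.DD k j α.1).1 x i := by
    simp only [ae_all_iff]
    exact fun k j i => component_spec _ _
  filter_upwards [hc, QP.coeFn_neg (Sobolev2.DD 0 0 α.1 + Sobolev2.DD 1 1 α.1),
    QP.coeFn_add (Sobolev2.DD 0 0 α.1) (Sobolev2.DD 1 1 α.1), DD_comm_comp α.1 0,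
    DD_comm_comp α.1 1, DD_div_comp_eq_zero α 0, DD_div_comp_eq_zero α 1]
    with x h1 h2 h3 h4 h5 h6 h7
  simp only [h1] at h4 h5 h6 h7
  rw [h2, h3]
  ext i
  fin_cases i
  · simp [curlCurl]
    linarith
  · simp [curlCurl]
    linarith

theorem setIntegral_comp (f : PerL2 τ) (hf : ∫ x in cell τ, f.1 x = 0) (i : Fin 2) :
    ∫ x in cell τ, (component f i).1 x = 0 := by
  have h := (EuclideanSpace.proj (𝕜 := ℝ) i : Plane →L[ℝ] ℝ).integral_comp_comm f.integrableOn_cell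
  rw [hf, map_zero] at h
  rw [← h]
  exact integral_congr_ae (ae_restrict_of_ae (component_spec f i))

/-- `curl* curl` is bounded below on divergence free fields of mean zero. -/
theorem exists_curlCurl_bound (τ : UpperHalfPlane) : ∃ c : ℝ, 0 < c ∧ ∀ (α : H2alpha τ)
    (w : PerL2 τ), curlCurl α =ᵐ[volume] w.1 → c * ‖Sobolev2.val α.1‖ ≤ ‖w‖ := by
  obtain ⟨C, hC0, hC⟩ := poincare_inequality τ
  -- The Poincaré inequality and ‖D₀α‖² + ‖D₁α‖² = ⟨α, w⟩ ≤ ‖α‖‖w‖ give ‖α‖ ≤ 4C²‖w‖. The larger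
  -- constant 8C² + 1 is positive even if C = 0.
  refine ⟨(8 * C ^ 2 + 1)⁻¹, by positivity, fun α w hw => ?_⟩
  have hwe : w = -(Sobolev2.DD 0 0 α.1 + Sobolev2.DD 1 1 α.1) :=
    QP.ext_ae (hw.symm.trans (curlCurl_eq α))
  have h1 := inner_laplacian_periodic α.1 α.1
  rw [← hwe, real_inner_self_eq_norm_sq, real_inner_self_eq_norm_sq] at h1
  set A := ‖Sobolev2.val α.1‖ with hA
  set d0 := ‖Sobolev2.D 0 α.1‖ with hd0
  set d1 := ‖Sobolev2.D 1 α.1‖ with hd1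
  have h2 : d0 ^ 2 + d1 ^ 2 ≤ A * ‖w‖ := h1 ▸ real_inner_le_norm _ _
  have h3 : ∀ i, ‖component (Sobolev2.val α.1) i‖ ≤ C * (d0 + d1) := fun i =>
    (hC _ (fun j => component (Sobolev2.D j α.1) i) (fun j => hasWeakPartial_val_comp α.1 j i)
      (setIntegral_comp _ α.2.1.2 i)).trans (by
        gcongr
        · exact PerL2.norm_component_le _ _
        · exact PerL2.norm_component_le _ _)
  have h4 : A ^ 2 ≤ 2 * (C * (d0 + d1)) ^ 2 := by
    rw [hA, PerL2.norm_sq_eq_sum, two_mul]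
    exact add_le_add (pow_le_pow_left₀ (norm_nonneg _) (h3 0) 2)
      (pow_le_pow_left₀ (norm_nonneg _) (h3 1) 2)
  have h5 : A ^ 2 ≤ A * (4 * C ^ 2 * ‖w‖) := by
    have : (d0 + d1) ^ 2 ≤ 2 * (d0 ^ 2 + d1 ^ 2) := by nlinarith [sq_nonneg (d0 - d1)]
    calc A ^ 2 ≤ 2 * (C * (d0 + d1)) ^ 2 := h4
      _ = 2 * C ^ 2 * (d0 + d1) ^ 2 := by ring
      _ ≤ 2 * C ^ 2 * (2 * (A * ‖w‖)) := by gcongr; linarith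
      _ = _ := by ring
  have h6 : A ≤ 4 * C ^ 2 * ‖w‖ := by
    rcases (norm_nonneg (Sobolev2.val α.1)).eq_or_lt with h0 | h0
    · rw [hA, ← h0]
      positivity
    · rw [sq] at h5
      exact le_of_mul_le_mul_left h5 h0
  rw [inv_mul_le_iff₀ (by positivity)]
  nlinarith [norm_nonneg w, sq_nonneg C, mul_nonneg (sq_nonneg C) (norm_nonneg w)]

end CurlCurl

/-! ### The Ginzburg–Landau equations in the weak derivatives of ψ and α. -/

section Equations

variable {n : ℕ} {τ : UpperHalfPlane}

/-- The covariant derivative of `ψ` for the potential `aⁿ + α`. -/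
def fullCov (ψ : H2psi n τ) (α : H2alpha τ) (j : Fin 2) (x : Plane) : ℂ :=
  covFun ψ j x - Complex.I * (alphaFun α x j : ℂ) * psiFun ψ x

/-- The second covariant derivative of `ψ` in the direction `j`, for the potential `aⁿ + α`. -/
def fullCov₂ (ψ : H2psi n τ) (α : H2alpha τ) (j : Fin 2) (x : Plane) : ℂ :=
  (Sobolev2.DD j j ψ.1).1 x - 2 * Complex.I * (alphaFun α x j : ℂ) * covFun ψ j x
    - (alphaFun α x j : ℂ) ^ 2 * psiFun ψ x
    - Complex.I * ((Sobolev2.D j α.1).1 x j : ℂ) * psiFun ψ x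

theorem isL2Loc_psiFun (ψ : H2psi n τ) : IsL2Loc (psiFun ψ) := QP.isL2Loc _

theorem isL2Loc_covFun (ψ : H2psi n τ) (j : Fin 2) : IsL2Loc (covFun ψ j) := QP.isL2Loc _

theorem isL2Loc_alphaFun (α : H2alpha τ) (j : Fin 2) : IsL2Loc fun x => (alphaFun α x j : ℂ) :=
  (QP.isL2Loc (Sobolev2.val α.1)).clm_comp
    (Complex.ofRealCLM.comp (EuclideanSpace.proj (𝕜 := ℝ) j : Plane →L[ℝ] ℝ))

theorem isL2Loc_D_alpha (α : H2alpha τ) (k j : Fin 2) :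
    IsL2Loc fun x => ((Sobolev2.D k α.1).1 x j : ℂ) :=
  (QP.isL2Loc (Sobolev2.D k α.1)).clm_comp
    (Complex.ofRealCLM.comp (EuclideanSpace.proj (𝕜 := ℝ) j : Plane →L[ℝ] ℝ))

theorem hasCovPartials_psiFun (ψ : H2psi n τ) : HasCovPartials n (psiFun ψ) (covFun ψ) :=
  hasCovPartials_val ψ.1

theorem hasWeakPartial_psiFun (ψ : H2psi n τ) (α : H2alpha τ) (j : Fin 2) :
    HasWeakPartial j (psiFun ψ) fun x => fullCov ψ α j x +
      Complex.I * ((bgPotential n x + alphaFun α x) j : ℂ) * psiFun ψ x := by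
  refine (hasCovPartials_psiFun ψ j).congr EventuallyEq.rfl (Eventually.of_forall fun x => ?_)
  simp only [fullCov, PiLp.add_apply, Complex.ofReal_add]
  ring

theorem continuous_I_mul_bgPotential (n : ℕ) (j : Fin 2) :
    Continuous fun x => Complex.I * (bgPotential n x j : ℂ) :=
  continuous_const.mul (Complex.continuous_ofReal.comp (continuous_bgPotential n j))

theorem isL2Loc_partial_psiFun (ψ : H2psi n τ) (j : Fin 2) : IsL2Loc fun x =>
    covFun ψ j x + Complex.I * (bgPotential n x j : ℂ) * psiFun ψ x :=
  (isL2Loc_covFun ψ j).add ((isL2Loc_psiFun ψ).continuous_mul (continuous_I_mul_bgPotential n j))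

theorem hasWeakPartial_alphaFun (α : H2alpha τ) (k j : Fin 2) :
    HasWeakPartial k (fun x => (alphaFun α x j : ℂ))
      fun x => ((Sobolev2.D k α.1).1 x j : ℂ) := by
  refine ((α.1.2.1 k).clm_comp
    (Complex.ofRealCLM.comp (EuclideanSpace.proj (𝕜 := ℝ) j : Plane →L[ℝ] ℝ))).congr
    EventuallyEq.rfl (Eventually.of_forall fun x => ?_)
  simp
  rfl

/-- The covariant derivative of Dⱼψ is part of the jet of ψ; the product rule differentiates αⱼψ. -/
theorem hasWeakPartial_fullCov (ψ : H2psi n τ) (α : H2alpha τ) (j : Fin 2) :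
    HasWeakPartial j (fullCov ψ α j) fun x => fullCov₂ ψ α j x +
      Complex.I * ((bgPotential n x + alphaFun α x) j : ℂ) * fullCov ψ α j x := by
  have h1 := (hasWeakPartial_alphaFun α j j).mul (isL2Loc_alphaFun α j) (isL2Loc_D_alpha α j j)
    (isL2Loc_psiFun ψ) (isL2Loc_partial_psiFun ψ) (hasCovPartials_psiFun ψ)
  refine ((hasCovPartials_D j ψ.1 j).sub (h1.const_smul Complex.I)).congr
    (Eventually.of_forall fun x => ?_) (Eventually.of_forall fun x => ?_)
  · simp only [fullCov, covFun, Pi.smul_apply, smul_eq_mul]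
    ring
  · simp only [fullCov, fullCov₂, covFun, Pi.smul_apply, smul_eq_mul, PiLp.add_apply,
      Complex.ofReal_add]
    ring_nf
    simp only [Complex.I_sq]
    ring

/-- The potential `aⁿ` as a linear map. -/
def bgLinear (n : ℕ) : Plane →L[ℝ] Plane :=
  LinearMap.toContinuousLinearMap
    { toFun := bgPotential n
      map_add' := fun x y => by
        ext i
        fin_cases i <;> simp [bgPotential, J] <;> ring
      map_smul' := fun c x => by
        ext i
        fin_cases i <;> simp [bgPotential, J] <;> ring }

/-- The weak derivatives of the potential `aⁿ + α`. -/
def potentialGrad (n : ℕ) (α : H2alpha τ) (j : Fin 2) (x : Plane) : Plane :=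
  bgPotential n (coordVec j) + (Sobolev2.D j α.1).1 x

theorem hasWeakPartial_potential (α : H2alpha τ) (j : Fin 2) :
    HasWeakPartial j (fun x => bgPotential n x + alphaFun α x) (potentialGrad n α j) := by
  refine ((hasWeakPartial_of_contDiff (bgLinear n).contDiff j).add (α.1.2.1 j)).congr
    EventuallyEq.rfl (Eventually.of_forall fun x => ?_)
  simp only [Pi.add_apply, ContinuousLinearMap.fderiv, zero_smul, add_zero]
  rfl

theorem hasWeakPartial_curl (α : H2alpha τ) (k : Fin 2) :
    HasWeakPartial k (fun x => potentialGrad n α 0 x 1 - potentialGrad n α 1 x 0)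
      fun x => (Sobolev2.DD k 0 α.1).1 x 1 - (Sobolev2.DD k 1 α.1).1 x 0 := by
  have hc : ∀ j i, HasWeakPartial k (fun x => potentialGrad n α j x i)
      fun x => (Sobolev2.DD k j α.1).1 x i := by
    intro j i
    have h1 := (α.1.2.2 k j).clm_comp (EuclideanSpace.proj (𝕜 := ℝ) i : Plane →L[ℝ] ℝ)
    have h2 := hasWeakPartial_of_contDiff (f := fun _ : Plane => bgPotential n (coordVec j) i)
      contDiff_const k
    refine (h2.add h1).congr EventuallyEq.rfl (Eventually.of_forall fun x => ?_)
    simp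
    rfl
  exact (hc 0 1).sub (hc 1 0)

theorem landau_ae (ψ : H2psi n τ) : ∀ᵐ x : Plane, (landau n τ ψ).1 x =
    -((Sobolev2.DD 0 0 ψ.1).1 x + (Sobolev2.DD 1 1 ψ.1).1 x) := by
  filter_upwards [QP.coeFn_neg (Sobolev2.DD 0 0 ψ.1 + Sobolev2.DD 1 1 ψ.1),
    QP.coeFn_add (Sobolev2.DD 0 0 ψ.1) (Sobolev2.DD 1 1 ψ.1)] with x h1 h2
  rw [← h2, ← h1]
  rfl

theorem div_alpha (α : H2alpha τ) : ∀ᵐ x : Plane,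
    (Sobolev2.D 0 α.1).1 x 0 + (Sobolev2.D 1 α.1).1 x 1 = 0 := by
  filter_upwards [div_comp_eq_zero α, component_spec (Sobolev2.D 0 α.1) 0,
    component_spec (Sobolev2.D 1 α.1) 1] with x h1 h2 h3
  rw [← h2, ← h3, h1]

theorem norm_sq_plane (v : Plane) : ((‖v‖ ^ 2 : ℝ) : ℂ) = (v 0 : ℂ) ^ 2 + (v 1 : ℂ) ^ 2 := by
  rw [EuclideanSpace.real_norm_sq_eq, Fin.sum_univ_two]
  push_cast
  rfl

/-- The first equation, for `ψ` and `α` of class `H²`. -/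
def FirstEq (κ lam : ℝ) (ψ : H2psi n τ) (α : H2alpha τ) : Prop :=
  ∀ᵐ x : Plane, (landau n τ ψ).1 x - (lam : ℂ) * psiFun ψ x + hTerm κ ψ α x = 0

/-- Expanding the squares of the covariant derivatives for aⁿ + α yields the α terms of h(ψ, α) and
a multiple of (div α) ψ, which vanishes. -/
theorem firstEq_iff {κ lam : ℝ} {ψ : H2psi n τ} {α : H2alpha τ} : FirstEq κ lam ψ α ↔
    ∀ᵐ x : Plane, -(fullCov₂ ψ α 0 x + fullCov₂ ψ α 1 x) - (lam : ℂ) * psiFun ψ x =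
      -((κ ^ 2 * ‖psiFun ψ x‖ ^ 2 : ℝ) : ℂ) * psiFun ψ x := by
  have key : ∀ᵐ x : Plane, (landau n τ ψ).1 x - (lam : ℂ) * psiFun ψ x + hTerm κ ψ α x =
      -(fullCov₂ ψ α 0 x + fullCov₂ ψ α 1 x) - (lam : ℂ) * psiFun ψ x -
        (-((κ ^ 2 * ‖psiFun ψ x‖ ^ 2 : ℝ) : ℂ) * psiFun ψ x) := by
    filter_upwards [landau_ae ψ, div_alpha α] with x h1 h2
    have h3 : ((Sobolev2.D 0 α.1).1 x 0 : ℂ) + ((Sobolev2.D 1 α.1).1 x 1 : ℂ) = 0 := by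
      rw [← Complex.ofReal_add, h2, Complex.ofReal_zero]
    rw [h1, hTerm, norm_sq_plane, Fin.sum_univ_two]
    simp only [fullCov₂]
    linear_combination -Complex.I * psiFun ψ x * h3
  constructor
  · intro h
    filter_upwards [h, key] with x h1 h2
    rw [h2] at h1
    exact sub_eq_zero.1 h1
  · intro h
    filter_upwards [h, key] with x h1 h2
    rw [h2, h1, sub_self]

/-- The Ginzburg-Landau equations in terms of the given derivatives. -/
theorem solvesGL_iff {κ lam : ℝ} {ψ : H2psi n τ} {α : H2alpha τ} :
    SolvesGL κ lam ψ α ↔ FirstEq κ lam ψ α ∧ curlCurl α =ᵐ[volume] current ψ α := by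
  rw [firstEq_iff]
  constructor
  · rintro ⟨d, dd, G, h1, h2, h3, h4, h5, h6⟩
    -- Weak derivatives are unique, so the ones postulated in the equations agree with those carried
    -- by the Sobolev spaces.
    have hd : ∀ j, d j =ᵐ[volume] fullCov ψ α j := fun j => by
      filter_upwards [(h1 j).unique (hasWeakPartial_psiFun ψ α j)] with x hx
      exact add_right_cancel hx
    have hdd : ∀ j, dd j =ᵐ[volume] fullCov₂ ψ α j := fun j => by
      have := ((h2 j).congr (hd j) EventuallyEq.rfl).unique (hasWeakPartial_fullCov ψ α j)
      filter_upwards [this, hd j] with x hx hx2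
      rw [hx2] at hx
      exact add_right_cancel hx
    have hG : ∀ j, G j =ᵐ[volume] potentialGrad n α j := fun j =>
      (h3 j).unique (hasWeakPartial_potential α j)
    have hcurl : (fun x => G 0 x 1 - G 1 x 0) =ᵐ[volume]
        fun x => potentialGrad n α 0 x 1 - potentialGrad n α 1 x 0 := by
      filter_upwards [hG 0, hG 1] with x h7 h8
      rw [h7, h8]
    refine ⟨?_, ?_⟩
    · filter_upwards [h4, hdd 0, hdd 1] with x h7 h8 h9
      rw [← h8, ← h9, h7]
    · filter_upwards [(h5.congr hcurl EventuallyEq.rfl).unique (hasWeakPartial_curl α 1),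
        (h6.congr hcurl EventuallyEq.rfl).unique (hasWeakPartial_curl α 0), hd 0, hd 1]
        with x h7 h8 h9 h10
      rw [h9] at h7
      rw [h10] at h8
      ext i
      fin_cases i
      · exact h7.symm
      · change -((Sobolev2.DD 0 0 α.1).1 x 1 - (Sobolev2.DD 0 1 α.1).1 x 0) =
          (conj (psiFun ψ x) * fullCov ψ α 1 x).im
        rw [← h8, neg_neg]
  · rintro ⟨h1, h2⟩
    refine ⟨fullCov ψ α, fullCov₂ ψ α, potentialGrad n α, hasWeakPartial_psiFun ψ α,
      hasWeakPartial_fullCov ψ α, hasWeakPartial_potential α, h1, ?_, ?_⟩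
    · refine (hasWeakPartial_curl α 1).congr EventuallyEq.rfl ?_
      filter_upwards [h2] with x hx
      exact congrArg (fun v : Plane => v 0) hx
    · refine (hasWeakPartial_curl α 0).congr EventuallyEq.rfl ?_
      filter_upwards [h2] with x hx
      have h3 := congrArg (fun v : Plane => v 1) hx
      exact neg_eq_iff_eq_neg.1 h3

theorem psiFun_neg (ψ : H2psi n τ) : ∀ᵐ x : Plane, psiFun ψ (-x) = psiFun ψ x := ψ.2

theorem alphaFun_neg (α : H2alpha τ) : ∀ᵐ x : Plane, alphaFun α (-x) = -alphaFun α x := α.2.2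

theorem bgPotential_neg (n : ℕ) (x : Plane) : bgPotential n (-x) = -bgPotential n x :=
  map_neg (bgLinear n) x

/-- Both ∂ⱼ and multiplication by the odd potential aⁿ reverse parity. -/
theorem covFun_neg (ψ : H2psi n τ) (j : Fin 2) :
    ∀ᵐ x : Plane, covFun ψ j (-x) = -covFun ψ j x := by
  have h1 := (hasCovPartials_psiFun ψ j).comp_neg.congr (psiFun_neg ψ) EventuallyEq.rfl
  filter_upwards [h1.unique (hasCovPartials_psiFun ψ j), psiFun_neg ψ] with x hx h2
  rw [h2, bgPotential_neg] at hx
  simp only [PiLp.neg_apply, Complex.ofReal_neg] at hx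
  linear_combination -hx

theorem current_neg (ψ : H2psi n τ) (α : H2alpha τ) :
    ∀ᵐ x : Plane, current ψ α (-x) = -current ψ α x := by
  filter_upwards [psiFun_neg ψ, covFun_neg ψ 0, covFun_neg ψ 1, alphaFun_neg α] with x h1 h2 h3 h4
  ext i
  have h5 : covFun ψ i (-x) = -covFun ψ i x := by
    fin_cases i
    exacts [h2, h3]
  simp only [current, h1, h5, h4, PiLp.neg_apply, Complex.ofReal_neg]
  rw [← Complex.neg_im]
  congr 1
  ring

theorem psiFun_add (ψ : H2psi n τ) (p q : ℤ) :
    ∀ᵐ x : Plane, psiFun ψ (x + latticeVec τ p q) = phase n τ p q x * psiFun ψ x :=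
  (Sobolev2.val ψ.1).2.1 p q

theorem covFun_add (ψ : H2psi n τ) (j : Fin 2) (p q : ℤ) :
    ∀ᵐ x : Plane, covFun ψ j (x + latticeVec τ p q) = phase n τ p q x * covFun ψ j x :=
  (Sobolev2.D j ψ.1).2.1 p q

theorem alphaFun_add (α : H2alpha τ) (p q : ℤ) :
    ∀ᵐ x : Plane, alphaFun α (x + latticeVec τ p q) = alphaFun α x := by
  filter_upwards [(Sobolev2.val α.1).2.1 p q] with x hx
  rw [one_smul] at hx
  exact hx

theorem current_add (ψ : H2psi n τ) (α : H2alpha τ) (p q : ℤ) :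
    ∀ᵐ x : Plane, current ψ α (x + latticeVec τ p q) = current ψ α x := by
  filter_upwards [psiFun_add ψ p q, covFun_add ψ 0 p q, covFun_add ψ 1 p q, alphaFun_add α p q]
    with x h1 h2 h3 h4
  have hm : conj (phase n τ p q x) * phase n τ p q x = 1 := by
    rw [mul_comm, Complex.mul_conj, Complex.normSq_eq_norm_sq, norm_phase]
    simp
  ext i
  have h5 : covFun ψ i (x + latticeVec τ p q) = phase n τ p q x * covFun ψ i x := by
    fin_cases i
    exacts [h2, h3]
  simp only [current, h1, h5, h4, map_mul]
  congr 1
  linear_combination (conj (psiFun ψ x) * (covFun ψ i x -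
    Complex.I * (alphaFun α x i : ℂ) * psiFun ψ x)) * hm

theorem aestronglyMeasurable_current (ψ : H2psi n τ) (α : H2alpha τ) :
    AEStronglyMeasurable (current ψ α) volume := by
  have h : ∀ j, AEStronglyMeasurable (fun x => (conj (psiFun ψ x) *
      (covFun ψ j x - Complex.I * (alphaFun α x j : ℂ) * psiFun ψ x)).im) volume := by
    intro j
    have h1 := (isL2Loc_psiFun ψ).aestronglyMeasurable
    have h2 := (isL2Loc_covFun ψ j).aestronglyMeasurable
    have h3 := (isL2Loc_alphaFun α j).aestronglyMeasurable
    exact Complex.continuous_im.comp_aestronglyMeasurable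
      ((Complex.continuous_conj.comp_aestronglyMeasurable h1).mul
        (h2.sub ((h3.const_mul Complex.I).mul h1)))
  have h4 : AEStronglyMeasurable (fun x => fun j => (conj (psiFun ψ x) *
      (covFun ψ j x - Complex.I * (alphaFun α x j : ℂ) * psiFun ψ x)).im) volume :=
    (aemeasurable_pi_iff.2 fun j => (h j).aemeasurable).aestronglyMeasurable
  exact (PiLp.continuous_toLp 2 (fun _ : Fin 2 => ℝ)).comp_aestronglyMeasurable h4

/-- The current of a solution of the first equation is conserved. -/
theorem hasWeakDiv_current {κ lam : ℝ} {ψ : H2psi n τ} {α : H2alpha τ} (h : FirstEq κ lam ψ α)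
    (l1 : ∀ j, IsL2Loc fun x => (alphaFun α x j : ℂ) * psiFun ψ x)
    (l2 : IsL2Loc fun x => ∑ j, (alphaFun α x j : ℂ) * covFun ψ j x)
    (l3 : IsL2Loc fun x => ((‖alphaFun α x‖ ^ 2 : ℝ) : ℂ) * psiFun ψ x)
    (l4 : IsL2Loc fun x => ((κ ^ 2 * ‖psiFun ψ x‖ ^ 2 : ℝ) : ℂ) * psiFun ψ x) :
    HasWeakDiv (fun j x => fullCov ψ α j x * conj (psiFun ψ x))
      fun x => ((∑ j, ‖fullCov ψ α j x‖ ^ 2 + (κ ^ 2 * ‖psiFun ψ x‖ ^ 2 - lam) *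
        ‖psiFun ψ x‖ ^ 2 : ℝ) : ℂ) := by
  rw [firstEq_iff] at h
  -- W is the sum over j of (∂ⱼ - i aⁿⱼ) applied to the full covariant derivatives, evaluated by the
  -- first equation. The contribution of α is put into W because `HasWeakDiv.mul_conj` needs a
  -- continuous potential.
  set W : Plane → ℂ := fun x => ((κ ^ 2 * ‖psiFun ψ x‖ ^ 2 : ℝ) : ℂ) * psiFun ψ x -
    (lam : ℂ) * psiFun ψ x + (Complex.I * ∑ j, (alphaFun α x j : ℂ) * covFun ψ j x +
      ((‖alphaFun α x‖ ^ 2 : ℝ) : ℂ) * psiFun ψ x) with hW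
  have hd : ∀ j, IsL2Loc (fullCov ψ α j) := fun j => by
    refine ((isL2Loc_covFun ψ j).sub ((l1 j).const_mul Complex.I)).congr
      (Eventually.of_forall fun x => ?_)
    simp only [fullCov]
    ring
  have hWl : IsL2Loc W := (l4.sub ((isL2Loc_psiFun ψ).const_mul _)).add ((l2.const_mul _).add l3)
  have h1 : HasWeakDiv (fullCov ψ α) fun x => W x +
      ∑ j, Complex.I * (bgPotential n x j : ℂ) * fullCov ψ α j x := by
    refine (HasWeakDiv.of_partial (hasWeakPartial_fullCov ψ α)).congr (fun j => EventuallyEq.rfl) ?_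
    filter_upwards [h] with x hx
    simp only [hW, norm_sq_plane (alphaFun α x), Fin.sum_univ_two, PiLp.add_apply,
      Complex.ofReal_add]
    have e : ∀ j, Complex.I * (alphaFun α x j : ℂ) * fullCov ψ α j x =
        Complex.I * ((alphaFun α x j : ℂ) * covFun ψ j x) +
          (alphaFun α x j : ℂ) ^ 2 * psiFun ψ x := fun j => by
      simp only [fullCov]
      linear_combination (-(alphaFun α x j : ℂ) ^ 2 * psiFun ψ x) * Complex.I_sq
    linear_combination -hx + e 0 + e 1
  refine (h1.mul_conj (a := fun j x => bgPotential n x j) (continuous_bgPotential n) hd hWl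
    (isL2Loc_psiFun ψ) (isL2Loc_covFun ψ) (hasCovPartials_psiFun ψ)).congr
    (fun j => EventuallyEq.rfl) (Eventually.of_forall fun x => ?_)
  have e1 : ∀ j, fullCov ψ α j x * conj (covFun ψ j x) = ((‖fullCov ψ α j x‖ ^ 2 : ℝ) : ℂ) -
      Complex.I * (alphaFun α x j : ℂ) * fullCov ψ α j x * conj (psiFun ψ x) := fun j => by
    have : covFun ψ j x = fullCov ψ α j x + Complex.I * (alphaFun α x j : ℂ) * psiFun ψ x := by
      simp only [fullCov]
      ring
    rw [this, ← Complex.normSq_eq_norm_sq, ← Complex.mul_conj]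
    simp only [map_add, map_mul, Complex.conj_I, Complex.conj_ofReal]
    ring
  have e2 : psiFun ψ x * conj (psiFun ψ x) = ((‖psiFun ψ x‖ ^ 2 : ℝ) : ℂ) := by
    rw [Complex.mul_conj, Complex.normSq_eq_norm_sq]
  have e3 : ∀ j, Complex.I * (alphaFun α x j : ℂ) * fullCov ψ α j x =
      Complex.I * ((alphaFun α x j : ℂ) * covFun ψ j x) +
        (alphaFun α x j : ℂ) ^ 2 * psiFun ψ x := fun j => by
    simp only [fullCov]
    linear_combination (-(alphaFun α x j : ℂ) ^ 2 * psiFun ψ x) * Complex.I_sq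
  simp only [Fin.sum_univ_two, e1, hW, norm_sq_plane (alphaFun α x), e3]
  push_cast at e2 ⊢
  linear_combination ((κ : ℂ) ^ 2 * (‖psiFun ψ x‖ : ℂ) ^ 2 - (lam : ℂ)) * e2

/-- On solutions of the first equation the projection acts trivially on the current. -/
theorem current_eq_projection {κ lam : ℝ} {ψ : H2psi n τ} {α : H2alpha τ} {P : PerL2 τ}
    (h : FirstEq κ lam ψ α)
    (l1 : ∀ j, IsL2Loc fun x => (alphaFun α x j : ℂ) * psiFun ψ x)
    (l2 : IsL2Loc fun x => ∑ j, (alphaFun α x j : ℂ) * covFun ψ j x)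
    (l3 : IsL2Loc fun x => ((‖alphaFun α x‖ ^ 2 : ℝ) : ℂ) * psiFun ψ x)
    (l4 : IsL2Loc fun x => ((κ ^ 2 * ‖psiFun ψ x‖ ^ 2 : ℝ) : ℂ) * psiFun ψ x)
    (hP : IsProjection (current ψ α) P) : P.1 =ᵐ[volume] current ψ α := by
  obtain ⟨g, hg⟩ := QP.exists_coe_eq (𝕜 := ℝ) (τ := τ) (m := fun _ _ _ => 1)
    (fun _ _ _ => by simp) (aestronglyMeasurable_current ψ α) (fun p q => by
      filter_upwards [current_add ψ α p q] with x hx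
      rw [hx, one_smul]) hP.1
  -- The divergence found in `hasWeakDiv_current` is real, so its imaginary part, the divergence of
  -- the current, is zero. The mean vanishes because the current is odd.
  have hgs : g ∈ solenoidal τ := by
    constructor
    · intro φ h1 h2
      have hdiv := hasWeakDiv_current h l1 l2 l3 l4
      have e := congrArg Complex.im (hdiv.integral_eq φ h1 h2)
      have i1 : ∀ j, Integrable fun x => fderiv ℝ φ x (coordVec j) •
          (fullCov ψ α j x * conj (psiFun ψ x)) := fun j =>
        integrable_test_smul (hdiv.left j) (continuous_test_fderiv h1 _) (h2.fderiv_apply ℝ _)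
      have i2 := integrable_test_smul hdiv.right h1.continuous h2
      have e1 : ∀ f : Plane → ℂ, Integrable f → (∫ x, f x).im = ∫ x, (f x).im := fun f hf =>
        (Complex.imCLM.integral_comp_comm hf).symm
      have i3 : ∀ j, Integrable fun x => fderiv ℝ φ x (coordVec j) * g.1 x j := fun j =>
        (EuclideanSpace.proj (𝕜 := ℝ) j : Plane →L[ℝ] ℝ).integrable_comp
          (integrable_test_smul g.locallyIntegrable (continuous_test_fderiv h1 (coordVec j))
            (h2.fderiv_apply ℝ _))
      have e2 : ∀ j, ∫ x, fderiv ℝ φ x (coordVec j) * g.1 x j =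
          (∫ x, fderiv ℝ φ x (coordVec j) • (fullCov ψ α j x * conj (psiFun ψ x))).im := fun j => by
        rw [e1 _ (i1 j)]
        refine integral_congr_ae ?_
        filter_upwards [hg] with x hx
        rw [hx, Complex.smul_im, smul_eq_mul]
        congr 1
        change (conj (psiFun ψ x) * fullCov ψ α j x).im = _
        rw [mul_comm]
      rw [integral_finsetSum _ fun j _ => i3 j]
      simp only [e2]
      rw [Fin.sum_univ_two] at e ⊢
      rw [← Complex.add_im, e, Complex.neg_im, e1 _ i2]
      simp only [Complex.smul_im, Complex.ofReal_im, smul_zero, integral_zero, neg_zero]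
    · have h1 : ∀ᵐ x : Plane, g.1 (-x) = -g.1 x := by
        have h2 := (Measure.measurePreserving_neg
          (volume : Measure Plane)).quasiMeasurePreserving.ae hg
        filter_upwards [hg, h2, current_neg ψ α] with x h3 h4 h5
        rw [h3, h4, h5]
      have h2 : IsPeriodic τ g.1 := fun p q => by
        filter_upwards [g.2.1 p q] with x hx
        rw [hx, one_smul]
      have h3 := h2.setIntegral_neg
      have h4 : ∫ x in cell τ, g.1 (-x) = ∫ x in cell τ, -g.1 x :=
        integral_congr_ae (ae_restrict_of_ae h1)
      rw [h4, integral_neg] at h3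
      have h5 : (2 : ℝ) • ∫ x in cell τ, g.1 x = 0 := by
        rw [two_smul]
        nth_rw 1 [← h3]
        exact neg_add_cancel _
      exact (smul_eq_zero.1 h5).resolve_left two_ne_zero
  have h1 := hP.2.2 (g - P) ((solenoidal τ).sub_mem hgs hP.2.1)
  have h2 : inner ℝ (g - P) (g - P) = 0 := by
    rw [QP.inner_eq]
    refine Eq.trans (integral_congr_ae (ae_restrict_of_ae ?_)) h1
    filter_upwards [hg, QP.coeFn_sub g P] with x h3 h4
    rw [h4, h3]
  have h3 : g = P := sub_eq_zero.1 (inner_self_eq_zero.1 h2)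
  rw [← h3]
  exact hg

end Equations

/-! ### The projection onto solenoidal fields. -/

section Projection

variable {τ : UpperHalfPlane} {v v' : Plane → Plane} {P P' : PerL2 τ}

theorem IsProjection.integrable (h : IsProjection v P) (w : PerL2 τ) :
    Integrable (fun x => inner ℝ (v x - P.1 x) (w.1 x)) (volume.restrict (cell τ)) := by
  have h1 : MemLp (fun x => v x - P.1 x) 2 (volume.restrict (cell τ)) := h.1.sub P.memLp_cell
  exact (MemLp.integrable_mul h1.norm w.memLp_cell.norm).mono'
    (h1.1.inner w.memLp_cell.1) (Eventually.of_forall fun x => by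
      simpa using norm_inner_le_norm (𝕜 := ℝ) (v x - P.1 x) (w.1 x))

theorem IsProjection.sub (h : IsProjection v P) (h' : IsProjection v' P') :
    IsProjection (fun x => v x - v' x) (P - P') := by
  refine ⟨h.1.sub h'.1, (solenoidal τ).sub_mem h.2.1 h'.2.1, fun w hw => ?_⟩
  have e : ∫ x in cell τ, inner ℝ (v x - v' x - (P - P').1 x) (w.1 x) =
      ∫ x in cell τ, (inner ℝ (v x - P.1 x) (w.1 x) - inner ℝ (v' x - P'.1 x) (w.1 x)) := by
    refine integral_congr_ae (ae_restrict_of_ae ?_)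
    filter_upwards [QP.coeFn_sub P P'] with x hx
    rw [hx, ← inner_sub_left]
    congr 1
    abel
  rw [e, integral_sub (h.integrable w) (h'.integrable w), h.2.2 w hw, h'.2.2 w hw, sub_zero]

theorem IsProjection.const_smul (c : ℝ) (h : IsProjection v P) :
    IsProjection (fun x => c • v x) (c • P) := by
  refine ⟨h.1.const_smul c, (solenoidal τ).smul_mem c h.2.1, fun w hw => ?_⟩
  have e : ∫ x in cell τ, inner ℝ (c • v x - (c • P).1 x) (w.1 x) =
      ∫ x in cell τ, c * inner ℝ (v x - P.1 x) (w.1 x) := by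
    refine integral_congr_ae (ae_restrict_of_ae ?_)
    filter_upwards [QP.coeFn_smul c P] with x hx
    rw [hx, ← smul_sub, real_inner_smul_left]
  rw [e, integral_const_mul, h.2.2 w hw, mul_zero]

theorem IsProjection.eq_zero (h : IsProjection v P) (hv : ∀ᵐ x : Plane, v x = 0) : P = 0 := by
  have h1 := h.2.2 P h.2.1
  have h2 : inner ℝ P P = 0 := by
    rw [QP.inner_eq, ← neg_eq_zero, ← integral_neg]
    refine Eq.trans (integral_congr_ae (ae_restrict_of_ae ?_)) h1
    filter_upwards [hv] with x hx
    rw [hx, zero_sub, inner_neg_left]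
  exact inner_self_eq_zero.1 h2

theorem IsProjection.unique (h : IsProjection v P) (h' : IsProjection v' P')
    (hv : v =ᵐ[volume] v') : P = P' :=
  sub_eq_zero.1 ((h.sub h').eq_zero (by
    filter_upwards [hv] with x hx
    rw [hx, sub_self]))

/-- Differences of `P` are the projections of the differences of v, and projections are unique. The
degree is measured on classes of measurable functions, so the individual monomials of v need not be
square integrable. -/
theorem IsPolyDeg.projection {E : Type*} [AddCommGroup E] : ∀ {k : ℕ} {v : E → Plane → Plane}
    {P : E → PerL2 τ} {w : Fin 2 → E → (Plane →ₘ[(volume : Measure Plane)] ℝ)},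
    (∀ j e, ∀ᵐ x : Plane, w j e x = v e x j) → (∀ e, IsProjection (v e) (P e)) →
    (∀ j, IsPolyDeg k (w j)) → IsPolyDeg k P
  | 0, v, P, w, hw, hP, h => fun e e' => by
    refine (hP e).unique (hP e') ?_
    filter_upwards [hw 0 e, hw 1 e, hw 0 e', hw 1 e'] with x h1 h2 h3 h4
    ext i
    fin_cases i
    · exact h1.symm.trans ((congrArg (fun f : Plane →ₘ[(volume : Measure Plane)] ℝ => f x)
        (h 0 e e')).trans h3)
    · exact h2.symm.trans ((congrArg (fun f : Plane →ₘ[(volume : Measure Plane)] ℝ => f x)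
        (h 1 e e')).trans h4)
  | k + 1, v, P, w, hw, hP, h => fun z => by
    refine IsPolyDeg.projection (v := fun e x => v (e + z) x - v e x)
      (w := fun j e => w j (e + z) - w j e) (fun j e => ?_) (fun e => (hP _).sub (hP _))
      fun j => h j z
    filter_upwards [hw j (e + z), hw j e, AEEqFun.coeFn_sub (w j (e + z)) (w j e)] with x h1 h2 h3
    rw [h3, Pi.sub_apply, h1, h2, PiLp.sub_apply]

end Projection

/-! ### Splitting F into its homogeneous parts. -/

section Structure

variable {n : ℕ} {τ : UpperHalfPlane}

theorem psiFun_smul (c : ℂ) (ψ : H2psi n τ) :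
    ∀ᵐ x : Plane, psiFun (c • ψ) x = c * psiFun ψ x :=
  QP.coeFn_smul c (Sobolev2.val ψ.1)

theorem covFun_smul (c : ℂ) (ψ : H2psi n τ) (j : Fin 2) :
    ∀ᵐ x : Plane, covFun (c • ψ) j x = c * covFun ψ j x :=
  QP.coeFn_smul c (Sobolev2.D j ψ.1)

theorem landau_smul_ae (c : ℂ) (ψ : H2psi n τ) :
    ∀ᵐ x : Plane, (landau n τ (c • ψ)).1 x = c * (landau n τ ψ).1 x := by
  rw [map_smul]
  exact QP.coeFn_smul c (landau n τ ψ)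

theorem alphaFun_smul (c : ℝ) (α : H2alpha τ) :
    ∀ᵐ x : Plane, alphaFun (c • α) x = c • alphaFun α x :=
  QP.coeFn_smul c (Sobolev2.val α.1)

theorem alphaFun_zero : ∀ᵐ x : Plane, alphaFun (0 : H2alpha τ) x = 0 :=
  QP.coeFn_zero (𝕜 := ℝ) (m := fun _ _ _ => 1) (τ := τ)

theorem psiFun_zero : ∀ᵐ x : Plane, psiFun (0 : H2psi n τ) x = 0 :=
  QP.coeFn_zero (𝕜 := ℂ) (m := phase n τ) (τ := τ)

/-- The quadratic and cubic terms of the first equation that contain `α`. -/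
def mixedTerm (ψ : H2psi n τ) (α : H2alpha τ) (x : Plane) : ℂ :=
  2 * Complex.I * ∑ j : Fin 2, (alphaFun α x j : ℂ) * covFun ψ j x
    + ((‖alphaFun α x‖ ^ 2 : ℝ) : ℂ) * psiFun ψ x

/-- The cubic term of the first equation. -/
def cubicTerm (κ : ℝ) (ψ : H2psi n τ) (x : Plane) : ℂ :=
  ((κ ^ 2 * ‖psiFun ψ x‖ ^ 2 : ℝ) : ℂ) * psiFun ψ x

theorem hTerm_eq (κ : ℝ) (ψ : H2psi n τ) (α : H2alpha τ) (x : Plane) :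
    hTerm κ ψ α x = mixedTerm ψ α x + cubicTerm κ ψ x := rfl

theorem mixedTerm_zero (ψ : H2psi n τ) : ∀ᵐ x : Plane, mixedTerm ψ (0 : H2alpha τ) x = 0 := by
  filter_upwards [alphaFun_zero (τ := τ)] with x hx
  simp [mixedTerm, hx]

theorem mixedTerm_smul (c : ℂ) (ψ : H2psi n τ) (α : H2alpha τ) :
    ∀ᵐ x : Plane, mixedTerm (c • ψ) α x = c * mixedTerm ψ α x := by
  filter_upwards [psiFun_smul c ψ, covFun_smul c ψ 0, covFun_smul c ψ 1] with x h1 h2 h3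
  simp only [mixedTerm, Fin.sum_univ_two, h1, h2, h3]
  ring

theorem cubicTerm_smul (κ : ℝ) (c : ℂ) (ψ : H2psi n τ) : ∀ᵐ x : Plane,
    cubicTerm κ (c • ψ) x = (((‖c‖ ^ 2 : ℝ) : ℂ) * c) * cubicTerm κ ψ x := by
  filter_upwards [psiFun_smul c ψ] with x h1
  simp only [cubicTerm, h1, norm_mul]
  push_cast
  ring

theorem current_smul (c : ℂ) (ψ : H2psi n τ) (α : H2alpha τ) :
    ∀ᵐ x : Plane, current (c • ψ) α x = (‖c‖ ^ 2) • current ψ α x := by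
  filter_upwards [psiFun_smul c ψ, covFun_smul c ψ 0, covFun_smul c ψ 1] with x h1 h2 h3
  ext i
  have h5 : covFun (c • ψ) i x = c * covFun ψ i x := by
    fin_cases i
    exacts [h2, h3]
  have hc : conj c * c = ((‖c‖ ^ 2 : ℝ) : ℂ) := by
    rw [mul_comm, Complex.mul_conj, Complex.normSq_eq_norm_sq]
  simp only [current, h1, h5, map_mul, PiLp.smul_apply, smul_eq_mul]
  rw [← Complex.im_ofReal_mul]
  congr 1
  linear_combination (conj (psiFun ψ x) * (covFun ψ i x -
    Complex.I * (alphaFun α x i : ℂ) * psiFun ψ x)) * hc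

variable {κ : ℝ} {X' : Submodule ℂ (H2psi n τ)} {X'' : Submodule ℝ (H2alpha τ)}
  {Y' : Submodule ℂ (L2psi n τ)} {Y'' : Submodule ℝ (L2alpha τ)}

/-- The linear and nonlinear parts of the map `F` on `X`. -/
structure IsDecomposition (κ : ℝ) (X' : Submodule ℂ (H2psi n τ)) (X'' : Submodule ℝ (H2alpha τ))
    (Y' : Submodule ℂ (L2psi n τ)) (Y'' : Submodule ℝ (L2alpha τ)) (ι A : X' →L[ℂ] Y')
    (M : X'' →L[ℝ] Y'') (H : X' × X'' → Y') (C : X' → Y') (K : X' × X'' → Y'') : Prop where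
  ι_coe : ∀ ψ, (ι ψ).1 = inclPsi ψ.1
  A_coe : ∀ ψ, (A ψ).1.1 = landau n τ ψ.1 - (n : ℂ) • Sobolev2.val ψ.1.1
  M_coe : ∀ α, (M α).1.1 = (-(Sobolev2.DD 0 0 α.1.1 + Sobolev2.DD 1 1 α.1.1) : PerL2 τ)
  H_ae : ∀ p, ∀ᵐ x : Plane, (H p).1.1.1 x = mixedTerm p.1.1 p.2.1 x
  C_ae : ∀ ψ, ∀ᵐ x : Plane, (C ψ).1.1.1 x = cubicTerm κ ψ.1 x
  K_proj : ∀ p, IsProjection (current p.1.1 p.2.1) (K p).1.1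
  continuous_H : Continuous H
  continuous_C : Continuous C
  continuous_K : Continuous K

/-- The inclusion of `X'` in `Y'`. -/
def inclX (h : ∀ ψ ∈ X', inclPsi ψ ∈ Y') : X' →L[ℂ] Y' :=
  LinearMap.mkContinuous (LinearMap.codRestrict Y' (inclPsi ∘ₗ X'.subtype) fun ψ => h ψ.1 ψ.2)
    ‖(⟨Sobolev2.val, Sobolev2.continuous_val⟩ : GaugeH2 n τ →L[ℂ] GaugeL2 n τ)‖
    fun ψ => (⟨Sobolev2.val, Sobolev2.continuous_val⟩ : GaugeH2 n τ →L[ℂ] GaugeL2 n τ).le_opNorm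
      ψ.1.1

theorem Y'_ext {y z : Y'} (h : y.1.1 = z.1.1) : y = z := Subtype.ext (Subtype.ext h)

theorem Y''_ext {y z : Y''} (h : y.1.1 = z.1.1) : y = z := Subtype.ext (Subtype.ext h)

/-- By homogeneity each nonlinear part, and each of A and M, is a linear combination of values of F
at rescaled or zero arguments. Continuity, and values in `Y'` and `Y''`, are thus inherited from F.
-/
theorem exists_decomposition (hXY : XYCondition κ n τ X' X'' Y' Y'') :
    ∃ (ι A : X' →L[ℂ] Y') (M : X'' →L[ℝ] Y'') (H : X' × X'' → Y') (C : X' → Y')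
      (K : X' × X'' → Y''), IsDecomposition κ X' X'' Y' Y'' ι A M H C K := by
  obtain ⟨F, hF2, hF⟩ := hXY.map_C2
  have hFc : Continuous F := hF2.continuous
  have hF1 : ∀ (lam : ℝ) (ψ : X') (α : X''), ∀ᵐ x : Plane, (F (lam, ψ, α)).1.1.1.1 x =
      (landau n τ ψ.1).1 x - (lam : ℂ) * psiFun ψ.1 x + (mixedTerm ψ.1 α.1 x + cubicTerm κ ψ.1 x) :=
    fun lam ψ α => (hF lam ψ α).1
  have hF2 : ∀ (ψ : X') (α : X''), ∃ P : PerL2 τ, IsProjection (current ψ.1 α.1) P ∧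
      (F (0, ψ, α)).2.1.1 = (-(Sobolev2.DD 0 0 α.1.1 + Sobolev2.DD 1 1 α.1.1) : PerL2 τ) - P := by
    intro ψ α
    obtain ⟨P, hP, h⟩ := (hF 0 ψ α).2
    refine ⟨P, hP, QP.ext_ae ?_⟩
    filter_upwards [h, curlCurl_eq α.1, QP.coeFn_sub
      (-(Sobolev2.DD 0 0 α.1.1 + Sobolev2.DD 1 1 α.1.1) : PerL2 τ) P] with x h1 h2 h3
    rw [h1, h3, h2]
  -- At α = 0, doubling ψ multiplies the linear part by 2 and the cubic part by 8, so this
  -- difference is 6 times the cubic part.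
  set C : X' → Y' := fun ψ =>
    (6 : ℂ)⁻¹ • ((F (0, (2 : ℂ) • ψ, 0)).1 - (2 : ℂ) • (F (0, ψ, 0)).1) with hC
  have hCae : ∀ ψ, ∀ᵐ x : Plane, (C ψ).1.1.1 x = cubicTerm κ ψ.1 x := by
    intro ψ
    filter_upwards [QP.coeFn_smul (6 : ℂ)⁻¹
        ((F (0, (2 : ℂ) • ψ, 0)).1.1.1 - (2 : ℂ) • (F (0, ψ, 0)).1.1.1),
      QP.coeFn_sub (F (0, (2 : ℂ) • ψ, 0)).1.1.1 ((2 : ℂ) • (F (0, ψ, 0)).1.1.1),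
      QP.coeFn_smul (2 : ℂ) (F (0, ψ, 0)).1.1.1, hF1 0 ((2 : ℂ) • ψ) 0, hF1 0 ψ 0,
      mixedTerm_zero (τ := τ) ψ.1, mixedTerm_zero (τ := τ) ((2 : ℂ) • ψ.1),
      cubicTerm_smul κ 2 ψ.1, landau_smul_ae 2 ψ.1] with x h1 h2 h3 h4 h5 h6 h7 h8 h9
    refine h1.trans ?_
    rw [h2, h3, h4, h5]
    change _ • ((landau n τ ((2 : ℂ) • ψ.1)).1 x - ((0 : ℝ) : ℂ) * _ +
      (mixedTerm ((2 : ℂ) • ψ.1) 0 x + cubicTerm κ ((2 : ℂ) • ψ.1) x) - (2 : ℂ) • (_ - _ +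
      (mixedTerm ψ.1 0 x + _))) = _
    rw [h6, h7, h8, h9]
    simp only [smul_eq_mul, Complex.ofReal_zero, Complex.norm_ofNat]
    push_cast
    ring
  have hCc : Continuous C := by
    have c1 : Continuous fun ψ : X' => F (0, (2 : ℂ) • ψ, 0) :=
      hFc.comp (continuous_const.prodMk ((continuous_const_smul (2 : ℂ)).prodMk continuous_const))
    have c2 : Continuous fun ψ : X' => F (0, ψ, 0) :=
      hFc.comp (continuous_const.prodMk (continuous_id.prodMk continuous_const))
    exact (c1.fst.sub (c2.fst.const_smul (2 : ℂ))).const_smul (6 : ℂ)⁻¹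
  have hA : ∀ ψ : X', ((F ((n : ℝ), ψ, 0)).1 - C ψ).1.1 =
      landau n τ ψ.1 - (n : ℂ) • Sobolev2.val ψ.1.1 := by
    intro ψ
    refine QP.ext_ae ?_
    filter_upwards [QP.coeFn_sub (F ((n : ℝ), ψ, 0)).1.1.1 (C ψ).1.1, hF1 n ψ 0, hCae ψ,
      mixedTerm_zero (τ := τ) ψ.1, QP.coeFn_sub (landau n τ ψ.1) ((n : ℂ) • Sobolev2.val ψ.1.1),
      QP.coeFn_smul (n : ℂ) (Sobolev2.val ψ.1.1)] with x h1 h2 h3 h4 h5 h6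
    refine h1.trans ?_
    rw [h2, h3, h5, h6]
    change _ - _ + (mixedTerm ψ.1 0 x + _) - _ = _
    rw [h4]
    simp only [smul_eq_mul, Complex.ofReal_natCast]
    change _ - _ * psiFun ψ.1 x + _ - _ = _ - _ * psiFun ψ.1 x
    ring
  have hAc : Continuous fun ψ : X' => (F ((n : ℝ), ψ, 0)).1 - C ψ := by
    have c1 : Continuous fun ψ : X' => F ((n : ℝ), ψ, 0) :=
      hFc.comp (continuous_const.prodMk (continuous_id.prodMk continuous_const))
    exact c1.fst.sub hCc
  let A : X' →L[ℂ] Y' :=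
    { toFun := fun ψ => (F ((n : ℝ), ψ, 0)).1 - C ψ
      map_add' := fun ψ φ => Y'_ext (by
        change ((F ((n : ℝ), ψ + φ, 0)).1 - C (ψ + φ)).1.1 =
          ((F ((n : ℝ), ψ, 0)).1 - C ψ).1.1 + ((F ((n : ℝ), φ, 0)).1 - C φ).1.1
        rw [hA, hA, hA]
        change landau n τ (ψ.1 + φ.1) - (n : ℂ) • (Sobolev2.val ψ.1.1 + Sobolev2.val φ.1.1) = _
        rw [map_add, smul_add]
        abel)
      map_smul' := fun c ψ => Y'_ext (by
        change ((F ((n : ℝ), c • ψ, 0)).1 - C (c • ψ)).1.1 =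
          c • ((F ((n : ℝ), ψ, 0)).1 - C ψ).1.1
        rw [hA, hA]
        change landau n τ (c • ψ.1) - (n : ℂ) • (c • Sobolev2.val ψ.1.1) = _
        rw [map_smul, smul_sub, smul_comm c])
      cont := hAc }
  have hM : ∀ α : X'', (F (0, 0, α)).2.1.1 =
      (-(Sobolev2.DD 0 0 α.1.1 + Sobolev2.DD 1 1 α.1.1) : PerL2 τ) := by
    intro α
    obtain ⟨P, hP, h⟩ := hF2 0 α
    rw [h, hP.eq_zero, sub_zero]
    filter_upwards [psiFun_zero (n := n) (τ := τ)] with x hx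
    change current (0 : H2psi n τ) α.1 x = 0
    ext i
    simp [current, hx]
  have hMc : Continuous fun α : X'' => (F (0, 0, α)).2 :=
    (hFc.comp (continuous_const.prodMk (continuous_const.prodMk continuous_id))).snd
  let M : X'' →L[ℝ] Y'' :=
    { toFun := fun α => (F (0, 0, α)).2
      map_add' := fun α β => Y''_ext (by
        change (F (0, 0, α + β)).2.1.1 = (F (0, 0, α)).2.1.1 + (F (0, 0, β)).2.1.1
        rw [hM, hM, hM]
        change -((Sobolev2.DD 0 0 α.1.1 + Sobolev2.DD 0 0 β.1.1) +
          (Sobolev2.DD 1 1 α.1.1 + Sobolev2.DD 1 1 β.1.1)) = _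
        abel)
      map_smul' := fun c α => Y''_ext (by
        change (F (0, 0, c • α)).2.1.1 = c • (F (0, 0, α)).2.1.1
        rw [hM, hM]
        change -(c • Sobolev2.DD 0 0 α.1.1 + c • Sobolev2.DD 1 1 α.1.1) = _
        rw [smul_neg, smul_add])
      cont := hMc }
  -- Subtracting the value at α = 0 leaves the mixed terms. K is minus the change of the second
  -- component from ψ = 0, where the current vanishes, since F contains the projected current with a
  -- minus sign.
  refine ⟨inclX hXY.subset', A, M, fun p => (F (0, p.1, p.2)).1 - (F (0, p.1, 0)).1, C,
    fun p => (F (0, 0, p.2)).2 - (F (0, p.1, p.2)).2, fun ψ => rfl, hA, hM, fun p => ?_, hCae,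
    fun p => ?_, ?_, hCc, ?_⟩
  · filter_upwards [QP.coeFn_sub (F (0, p.1, p.2)).1.1.1 (F (0, p.1, 0)).1.1.1, hF1 0 p.1 p.2,
      hF1 0 p.1 0, mixedTerm_zero (τ := τ) p.1.1] with x h1 h2 h3 h4
    refine h1.trans ?_
    rw [h2, h3]
    change _ - (_ - _ + (mixedTerm p.1.1 0 x + _)) = _
    rw [h4]
    ring
  · obtain ⟨P, hP, h⟩ := hF2 p.1 p.2
    have e : ((F (0, 0, p.2)).2 - (F (0, p.1, p.2)).2).1.1 = P := by
      change (F (0, 0, p.2)).2.1.1 - (F (0, p.1, p.2)).2.1.1 = P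
      rw [hM, h, sub_sub_cancel]
    rw [e]
    exact hP
  · have c1 : Continuous fun p : X' × X'' => F (0, p.1, p.2) :=
      hFc.comp (continuous_const.prodMk (continuous_fst.prodMk continuous_snd))
    have c2 : Continuous fun p : X' × X'' => F (0, p.1, 0) :=
      hFc.comp (continuous_const.prodMk (continuous_fst.prodMk continuous_const))
    exact c1.fst.sub c2.fst
  · have c1 : Continuous fun p : X' × X'' => F (0, p.1, p.2) :=
      hFc.comp (continuous_const.prodMk (continuous_fst.prodMk continuous_snd))
    have c2 : Continuous fun p : X' × X'' => F (0, 0, p.2) :=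
      hFc.comp (continuous_const.prodMk (continuous_const.prodMk continuous_snd))
    exact c2.snd.sub c1.snd

end Structure

/-! ### Polynomial degree of the nonlinear terms. -/

section Analytic

variable {n : ℕ} {τ : UpperHalfPlane} {κ : ℝ} {X' : Submodule ℂ (H2psi n τ)}
  {X'' : Submodule ℝ (H2alpha τ)} {Y' : Submodule ℂ (L2psi n τ)} {Y'' : Submodule ℝ (L2alpha τ)}
  {ι A : X' →L[ℂ] Y'} {M : X'' →L[ℝ] Y''} {H : X' × X'' → Y'} {C : X' → Y'} {K : X' × X'' → Y''}

theorem IsDecomposition.H_smul (d : IsDecomposition κ X' X'' Y' Y'' ι A M H C K) (c : ℂ) (ψ : X')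
    (α : X'') : H (c • ψ, α) = c • H (ψ, α) := by
  refine Y'_ext (QP.ext_ae ?_)
  filter_upwards [d.H_ae (c • ψ, α), d.H_ae (ψ, α), mixedTerm_smul c ψ.1 α.1,
    QP.coeFn_smul c (H (ψ, α)).1.1] with x h1 h2 h3 h4
  refine h1.trans (h3.trans (Eq.trans ?_ h4.symm))
  rw [h2, smul_eq_mul]

theorem IsDecomposition.H_zero (d : IsDecomposition κ X' X'' Y' Y'' ι A M H C K) (ψ : X') :
    H (ψ, 0) = 0 := by
  refine Y'_ext (QP.ext_ae ?_)
  filter_upwards [d.H_ae (ψ, 0), mixedTerm_zero (τ := τ) ψ.1,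
    QP.coeFn_zero (𝕜 := ℂ) (E := ℂ) (m := phase n τ) (τ := τ)] with x h1 h2 h3
  exact h1.trans (h2.trans h3.symm)

theorem IsDecomposition.C_smul (d : IsDecomposition κ X' X'' Y' Y'' ι A M H C K) (c : ℂ) (ψ : X') :
    C (c • ψ) = (((‖c‖ ^ 2 : ℝ) : ℂ) * c) • C ψ := by
  refine Y'_ext (QP.ext_ae ?_)
  filter_upwards [d.C_ae (c • ψ), d.C_ae ψ, cubicTerm_smul κ c ψ.1,
    QP.coeFn_smul (((‖c‖ ^ 2 : ℝ) : ℂ) * c) (C ψ).1.1] with x h1 h2 h3 h4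
  refine h1.trans (h3.trans (Eq.trans ?_ h4.symm))
  rw [h2, smul_eq_mul]

theorem IsDecomposition.K_smul (d : IsDecomposition κ X' X'' Y' Y'' ι A M H C K) (c : ℂ) (ψ : X')
    (α : X'') : K (c • ψ, α) = (‖c‖ ^ 2) • K (ψ, α) :=
  Y''_ext ((d.K_proj (c • ψ, α)).unique ((d.K_proj (ψ, α)).const_smul (‖c‖ ^ 2))
    (current_smul c ψ.1 α.1))

/-- Complex valued classes of measurable functions on the plane. -/
abbrev PlaneFun := Plane →ₘ[(volume : Measure Plane)] ℂ

/-- The class of `ψ`. -/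
def psiClass (ψ : H2psi n τ) : PlaneFun := (Sobolev2.val ψ.1).1

/-- The class of a covariant derivative of `ψ`. -/
def covClass (j : Fin 2) (ψ : H2psi n τ) : PlaneFun := (Sobolev2.D j ψ.1).1

/-- The class of a component of `α`. -/
def alphaClass (j : Fin 2) (α : H2alpha τ) : PlaneFun :=
  AEEqFun.comp (fun v : Plane => (v j : ℂ)) (by fun_prop) (Sobolev2.val α.1).1

theorem coeFn_alphaClass (j : Fin 2) (α : H2alpha τ) :
    ∀ᵐ x : Plane, alphaClass j α x = (alphaFun α x j : ℂ) :=
  AEEqFun.coeFn_comp _ _ _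

theorem alphaFun_add_apply (α β : H2alpha τ) :
    ∀ᵐ x : Plane, alphaFun (α + β) x = alphaFun α x + alphaFun β x :=
  QP.coeFn_add (Sobolev2.val α.1) (Sobolev2.val β.1)

theorem alphaClass_add (j : Fin 2) (α β : H2alpha τ) :
    alphaClass j (α + β) = alphaClass j α + alphaClass j β := by
  refine AEEqFun.ext ?_
  filter_upwards [coeFn_alphaClass j (α + β), coeFn_alphaClass j α, coeFn_alphaClass j β,
    AEEqFun.coeFn_add (alphaClass j α) (alphaClass j β), alphaFun_add_apply α β] with x h1 h2 h3 h4 h5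
  rw [h1, h4, Pi.add_apply, h2, h3, h5, PiLp.add_apply, Complex.ofReal_add]

/-- Composition with a continuous additive map. -/
def compAddHom {G : Type} [TopologicalSpace G] [AddCommGroup G] [IsTopologicalAddGroup G]
    (g : ℂ →+ G) (hg : Continuous g) : PlaneFun →+ (Plane →ₘ[(volume : Measure Plane)] G) :=
  AddMonoidHom.mk' (fun f => AEEqFun.comp g hg f) fun f f' => by
    refine AEEqFun.ext ?_
    filter_upwards [AEEqFun.coeFn_comp g hg (f + f'), AEEqFun.coeFn_comp g hg f,
      AEEqFun.coeFn_comp g hg f', AEEqFun.coeFn_add (AEEqFun.comp g hg f) (AEEqFun.comp g hg f'),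
      AEEqFun.coeFn_add f f'] with x h1 h2 h3 h4 h5
    rw [h1, h4, Pi.add_apply, h2, h3, Function.comp_apply, h5, Pi.add_apply, map_add]
    rfl

theorem coeFn_compAddHom {G : Type} [TopologicalSpace G] [AddCommGroup G] [IsTopologicalAddGroup G]
    (g : ℂ →+ G) (hg : Continuous g) (f : PlaneFun) :
    ∀ᵐ x : Plane, compAddHom g hg f x = g (f x) :=
  AEEqFun.coeFn_comp g hg f

/-- Complex conjugation of classes. -/
def conjHom : PlaneFun →+ PlaneFun :=
  compAddHom (starRingEnd ℂ : ℂ →+* ℂ).toAddMonoidHom Complex.continuous_conj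

theorem coeFn_conjHom (f : PlaneFun) : ∀ᵐ x : Plane, conjHom f x = conj (f x) :=
  coeFn_compAddHom _ _ f

/-- The imaginary part of classes. -/
def imHom : PlaneFun →+ (Plane →ₘ[(volume : Measure Plane)] ℝ) :=
  compAddHom Complex.imAddGroupHom Complex.continuous_im

theorem coeFn_imHom (f : PlaneFun) : ∀ᵐ x : Plane, imHom f x = (f x).im :=
  coeFn_compAddHom _ _ f

/-- The elements of `Y'` as classes of functions. -/
def classHom (Y' : Submodule ℂ (L2psi n τ)) : Y' →+ PlaneFun where
  toFun y := y.1.1.1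
  map_zero' := rfl
  map_add' _ _ := rfl

theorem classHom_injective : Function.Injective (classHom Y') := fun _ _ h =>
  Y'_ext (Subtype.ext h)

/-- The elements of `Y''` as periodic fields. -/
def fieldHom (Y'' : Submodule ℝ (L2alpha τ)) : Y'' →+ PerL2 τ where
  toFun y := y.1.1
  map_zero' := rfl
  map_add' _ _ := rfl

theorem fieldHom_injective : Function.Injective (fieldHom Y'') := fun _ _ h => Y''_ext h

theorem PlaneFun.add_mul (f g h : PlaneFun) : (f + g) * h = f * h + g * h := by
  refine AEEqFun.ext ?_
  filter_upwards [AEEqFun.coeFn_mul (f + g) h, AEEqFun.coeFn_add f g,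
    AEEqFun.coeFn_add (f * h) (g * h), AEEqFun.coeFn_mul f h, AEEqFun.coeFn_mul g h]
    with x h1 h2 h3 h4 h5
  rw [h1, h3, Pi.mul_apply, Pi.add_apply, h2, h4, h5]
  exact _root_.add_mul _ _ _

theorem PlaneFun.mul_add (f g h : PlaneFun) : f * (g + h) = f * g + f * h := by
  rw [mul_comm f, PlaneFun.add_mul, mul_comm g, mul_comm h]

/-- The multiplication of classes. -/
def mulHom : PlaneFun →+ PlaneFun →+ PlaneFun :=
  AddMonoidHom.mk' (fun f => AddMonoidHom.mk' (fun g => f * g) (PlaneFun.mul_add f))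
    fun f g => AddMonoidHom.ext fun h => PlaneFun.add_mul f g h

theorem IsPolyDeg.mul_class {E : Type*} [AddCommGroup E] {k l : ℕ} {f g : E → PlaneFun}
    (hf : IsPolyDeg k f) (hg : IsPolyDeg l g) : IsPolyDeg (k + l) fun x => f x * g x :=
  IsPolyDeg.bilin mulHom hf hg

theorem IsPolyDeg.const_mul_class {E : Type*} [AddCommGroup E] {k : ℕ} {f : E → PlaneFun}
    (hf : IsPolyDeg k f) (c : PlaneFun) : IsPolyDeg k fun x => c * f x :=
  hf.map (mulHom c)

theorem isPolyDeg_psiClass : IsPolyDeg 1 fun p : X' × X'' => psiClass p.1.1 :=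
  IsPolyDeg.of_add fun _ _ => rfl

theorem isPolyDeg_covClass (j : Fin 2) : IsPolyDeg 1 fun p : X' × X'' => covClass j p.1.1 :=
  IsPolyDeg.of_add fun _ _ => rfl

theorem isPolyDeg_alphaClass (j : Fin 2) : IsPolyDeg 1 fun p : X' × X'' => alphaClass j p.2.1 :=
  IsPolyDeg.of_add fun p q => alphaClass_add j p.2.1 q.2.1

/-- Among classes of measurable functions H is a cubic polynomial in αⱼ, Dⱼψ and ψ, each of which is
additive in (ψ, α). The degree is pulled back along the injection of `Y'` into such classes. -/
theorem isPolyDeg_H (d : IsDecomposition κ X' X'' Y' Y'' ι A M H C K) : IsPolyDeg 3 H := by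
  refine IsPolyDeg.of_map (L := classHom Y') classHom_injective ?_
  have e : (fun p => classHom Y' (H p)) = fun p =>
      (AEEqFun.const Plane (2 * Complex.I) : PlaneFun) *
        (alphaClass 0 p.2.1 * covClass 0 p.1.1 + alphaClass 1 p.2.1 * covClass 1 p.1.1) +
      (alphaClass 0 p.2.1 * alphaClass 0 p.2.1 + alphaClass 1 p.2.1 * alphaClass 1 p.2.1) *
        psiClass p.1.1 := by
    funext p
    set a0 := alphaClass 0 p.2.1
    set a1 := alphaClass 1 p.2.1
    set c0 := covClass 0 p.1.1
    set c1 := covClass 1 p.1.1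
    set f := psiClass p.1.1
    set k : PlaneFun := AEEqFun.const Plane (2 * Complex.I)
    refine AEEqFun.ext ?_
    filter_upwards [d.H_ae p, coeFn_alphaClass 0 p.2.1, coeFn_alphaClass 1 p.2.1,
      AEEqFun.coeFn_add (k * (a0 * c0 + a1 * c1)) ((a0 * a0 + a1 * a1) * f),
      AEEqFun.coeFn_mul k (a0 * c0 + a1 * c1), AEEqFun.coeFn_mul (a0 * a0 + a1 * a1) f,
      AEEqFun.coeFn_add (a0 * c0) (a1 * c1), AEEqFun.coeFn_add (a0 * a0) (a1 * a1),
      AEEqFun.coeFn_mul a0 c0, AEEqFun.coeFn_mul a1 c1, AEEqFun.coeFn_mul a0 a0,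
      AEEqFun.coeFn_mul a1 a1, AEEqFun.coeFn_const Plane (μ := volume) (2 * Complex.I)]
      with x h1 h2 h3 h4 h5 h6 h7 h8 h9 h10 h11 h12 h13
    refine h1.trans ?_
    rw [h4, Pi.add_apply, h5, h6, Pi.mul_apply, Pi.mul_apply, h7, h8, Pi.add_apply, Pi.add_apply,
      h9, h10, h11, h12, h13]
    simp only [Pi.mul_apply, h2, h3, a0, a1]
    rw [mixedTerm, norm_sq_plane, Fin.sum_univ_two, sq, sq]
    rfl
  rw [e]
  exact (((((isPolyDeg_alphaClass 0).mul_class (isPolyDeg_covClass 0)).add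
    ((isPolyDeg_alphaClass 1).mul_class (isPolyDeg_covClass 1))).const_mul_class _).succ).add
    ((((isPolyDeg_alphaClass 0).mul_class (isPolyDeg_alphaClass 0)).add
      ((isPolyDeg_alphaClass 1).mul_class (isPolyDeg_alphaClass 1))).mul_class isPolyDeg_psiClass)

theorem isPolyDeg_C (d : IsDecomposition κ X' X'' Y' Y'' ι A M H C K) : IsPolyDeg 3 C := by
  refine IsPolyDeg.of_map (L := classHom Y') classHom_injective ?_
  have e : (fun ψ => classHom Y' (C ψ)) = fun ψ =>
      (AEEqFun.const Plane ((κ : ℂ) ^ 2) : PlaneFun) *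
        (psiClass ψ.1 * conjHom (psiClass ψ.1) * psiClass ψ.1) := by
    funext ψ
    set f := psiClass ψ.1
    set k : PlaneFun := AEEqFun.const Plane ((κ : ℂ) ^ 2)
    refine AEEqFun.ext ?_
    filter_upwards [d.C_ae ψ, AEEqFun.coeFn_mul k (f * conjHom f * f),
      AEEqFun.coeFn_mul (f * conjHom f) f, AEEqFun.coeFn_mul f (conjHom f), coeFn_conjHom f,
      AEEqFun.coeFn_const Plane (μ := volume) ((κ : ℂ) ^ 2)] with x h1 h2 h3 h4 h5 h6
    refine h1.trans ?_
    rw [h2, Pi.mul_apply, h3, Pi.mul_apply, h4, Pi.mul_apply, h5, h6, Complex.mul_conj,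
      Complex.normSq_eq_norm_sq, cubicTerm, Function.const_apply, ← mul_assoc]
    push_cast
    rfl
  rw [e]
  have hp : IsPolyDeg 1 fun ψ : X' => psiClass ψ.1 := IsPolyDeg.of_add fun _ _ => rfl
  exact ((hp.mul_class (hp.map conjHom)).mul_class hp).const_mul_class _

/-- The components of the current are cubic polynomials in classes, and the projection does not
raise the degree. -/
theorem isPolyDeg_K (d : IsDecomposition κ X' X'' Y' Y'' ι A M H C K) : IsPolyDeg 3 K := by
  refine IsPolyDeg.of_map (L := fieldHom Y'') fieldHom_injective ?_
  refine IsPolyDeg.projection (v := fun p : X' × X'' => current p.1.1 p.2.1)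
    (w := fun j p => imHom (conjHom (psiClass p.1.1) * (covClass j p.1.1 -
      (AEEqFun.const Plane Complex.I : PlaneFun) * alphaClass j p.2.1 * psiClass p.1.1)))
    (fun j p => ?_) d.K_proj fun j => ?_
  · set f := psiClass p.1.1
    set c := covClass j p.1.1
    set a := alphaClass j p.2.1
    set k : PlaneFun := AEEqFun.const Plane Complex.I
    filter_upwards [coeFn_imHom (conjHom f * (c - k * a * f)),
      AEEqFun.coeFn_mul (conjHom f) (c - k * a * f), coeFn_conjHom f,
      AEEqFun.coeFn_sub c (k * a * f), AEEqFun.coeFn_mul (k * a) f, AEEqFun.coeFn_mul k a,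
      coeFn_alphaClass j p.2.1, AEEqFun.coeFn_const Plane (μ := volume) Complex.I]
      with x h1 h2 h3 h4 h5 h6 h7 h8
    rw [h1, h2, Pi.mul_apply, h3, h4, Pi.sub_apply, h5, Pi.mul_apply, h6, Pi.mul_apply, h7, h8]
    rfl
  · have h2 : IsPolyDeg 2 fun p : X' × X'' => covClass j p.1.1 -
        (AEEqFun.const Plane Complex.I : PlaneFun) * alphaClass j p.2.1 * psiClass p.1.1 :=
      (isPolyDeg_covClass j).succ.sub
        (((isPolyDeg_alphaClass j).const_mul_class _).mul_class isPolyDeg_psiClass)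
    exact ((isPolyDeg_psiClass.map conjHom).mul_class h2).map imHom

end Analytic

/-! ### Local square integrability of the separate nonlinear terms. -/

section SquareIntegrable

variable {n : ℕ} {τ : UpperHalfPlane} {κ : ℝ} {X' : Submodule ℂ (H2psi n τ)}
  {X'' : Submodule ℝ (H2alpha τ)} {Y' : Submodule ℂ (L2psi n τ)} {Y'' : Submodule ℝ (L2alpha τ)}
  {ι A : X' →L[ℂ] Y'} {M : X'' →L[ℝ] Y''} {H : X' × X'' → Y'} {C : X' → Y'} {K : X' × X'' → Y''}

theorem isL2Loc_cubicTerm (d : IsDecomposition κ X' X'' Y' Y'' ι A M H C K) (ψ : X') :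
    IsL2Loc (cubicTerm κ ψ.1) :=
  (QP.isL2Loc (C ψ).1.1).congr (d.C_ae ψ)

/-- H(ψ, 2α) - 2H(ψ, α) is twice the part of H that is quadratic in α, and values of H are square
integrable. -/
theorem isL2Loc_norm_sq_mul (d : IsDecomposition κ X' X'' Y' Y'' ι A M H C K) (ψ : X') (α : X'') :
    IsL2Loc fun x => ((‖alphaFun α.1 x‖ ^ 2 : ℝ) : ℂ) * psiFun ψ.1 x := by
  have h1 := (QP.isL2Loc (H (ψ, (2 : ℝ) • α)).1.1).sub
    ((QP.isL2Loc (H (ψ, α)).1.1).const_mul 2)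
  refine (h1.const_mul 2⁻¹).congr ?_
  filter_upwards [d.H_ae (ψ, (2 : ℝ) • α), d.H_ae (ψ, α), alphaFun_smul 2 α.1] with x h2 h3 h4
  rw [h2, h3]
  change 2⁻¹ * (mixedTerm ψ.1 ((2 : ℝ) • α.1) x - 2 * mixedTerm ψ.1 α.1 x) = _
  simp only [mixedTerm, h4, norm_smul, Fin.sum_univ_two, PiLp.smul_apply, smul_eq_mul]
  push_cast
  simp only [Real.norm_ofNat]
  push_cast
  ring

theorem isL2Loc_alpha_cov (d : IsDecomposition κ X' X'' Y' Y'' ι A M H C K) (ψ : X') (α : X'') :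
    IsL2Loc fun x => ∑ j, (alphaFun α.1 x j : ℂ) * covFun ψ.1 j x := by
  refine (((QP.isL2Loc (H (ψ, α)).1.1).sub (isL2Loc_norm_sq_mul d ψ α)).const_mul
    (2 * Complex.I)⁻¹).congr ?_
  filter_upwards [d.H_ae (ψ, α)] with x h1
  rw [h1]
  simp only [mixedTerm, add_sub_cancel_right]
  rw [inv_mul_cancel_left₀ (by simp)]

/-- |αⱼ| ≤ |α|² + 1 reduces the product to |α|²ψ and ψ. -/
theorem isL2Loc_alpha_psi (d : IsDecomposition κ X' X'' Y' Y'' ι A M H C K) (ψ : X') (α : X'')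
    (j : Fin 2) : IsL2Loc fun x => (alphaFun α.1 x j : ℂ) * psiFun ψ.1 x := by
  have h1 : IsL2Loc fun x => ‖((‖alphaFun α.1 x‖ ^ 2 : ℝ) : ℂ) * psiFun ψ.1 x‖ + ‖psiFun ψ.1 x‖ :=
    IsL2Loc.add (fun K hK => (isL2Loc_norm_sq_mul d ψ α K hK).norm)
      fun K hK => (isL2Loc_psiFun ψ.1 K hK).norm
  refine h1.of_le ((isL2Loc_alphaFun α.1 j).aestronglyMeasurable.mul
    (isL2Loc_psiFun ψ.1).aestronglyMeasurable) (Eventually.of_forall fun x => ?_)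
  have h2 : ‖alphaFun α.1 x j‖ ≤ ‖alphaFun α.1 x‖ := PiLp.norm_apply_le _ j
  have h3 : ‖alphaFun α.1 x j‖ ≤ ‖alphaFun α.1 x‖ ^ 2 + 1 := by
    nlinarith [sq_nonneg (‖alphaFun α.1 x‖ - 1), norm_nonneg (alphaFun α.1 x)]
  calc ‖(alphaFun α.1 x j : ℂ) * psiFun ψ.1 x‖
      ≤ (‖alphaFun α.1 x‖ ^ 2 + 1) * ‖psiFun ψ.1 x‖ := by
        rw [norm_mul, Complex.norm_real]
        exact mul_le_mul_of_nonneg_right h3 (norm_nonneg _)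
    _ = ‖((‖alphaFun α.1 x‖ ^ 2 : ℝ) : ℂ) * psiFun ψ.1 x‖ + ‖psiFun ψ.1 x‖ := by
        rw [norm_mul, Complex.norm_real, norm_pow, norm_norm]
        ring
    _ ≤ _ := Real.le_norm_self _

end SquareIntegrable

/-! ### Reality of the pairings and vanishing of the imaginary parameter. -/

section Gauge

variable {n : ℕ} {τ : UpperHalfPlane} {κ : ℝ} {X' : Submodule ℂ (H2psi n τ)}
  {X'' : Submodule ℝ (H2alpha τ)} {Y' : Submodule ℂ (L2psi n τ)} {Y'' : Submodule ℝ (L2alpha τ)}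
  {ι A : X' →L[ℂ] Y'} {M : X'' →L[ℝ] Y''} {H : X' × X'' → Y'} {C : X' → Y'} {K : X' × X'' → Y''}

/-- Transport by a divergence free field is antisymmetric. -/
theorem re_inner_transport (u : H2psi n τ) (α : H2alpha τ)
    (l1 : ∀ j, IsL2Loc fun x => (alphaFun α x j : ℂ) * psiFun u x) {S : GaugeL2 n τ}
    (hS : ∀ᵐ x : Plane, S.1 x = ∑ j, (alphaFun α x j : ℂ) * covFun u j x) :
    (inner ℂ (Sobolev2.val u.1) S).re = 0 := by
  have hV : ∀ j, ∃ V : GaugeL2 n τ, V.1 =ᵐ[volume] fun x => (alphaFun α x j : ℂ) * psiFun u x := by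
    intro j
    obtain ⟨B, hB, hsub⟩ := cell_subset_ball τ
    refine QP.exists_coe_eq (norm_phase n τ) (l1 j).aestronglyMeasurable (fun p q => ?_)
      ((l1 j B hB).mono_measure (Measure.restrict_mono hsub le_rfl))
    filter_upwards [psiFun_add u p q, alphaFun_add α p q] with x h1 h2
    rw [h1, h2, smul_eq_mul]
    ring
  choose V hV using hV
  -- Since div α = 0, the transport term S is the covariant divergence of α u. Integrating by parts
  -- gives ⟨u, S⟩ = -conj ⟨u, S⟩.
  have h0 : HasWeakDiv (fun j x => (alphaFun α x j : ℂ)) fun _ => 0 := by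
    refine (HasWeakDiv.of_partial fun j => hasWeakPartial_alphaFun α j j).congr
      (fun _ => EventuallyEq.rfl) ?_
    filter_upwards [div_alpha α] with x hx
    rw [Fin.sum_univ_two, ← Complex.ofReal_add, hx, Complex.ofReal_zero]
  have h1 := h0.mul (isL2Loc_alphaFun α) (isL2Loc_of_continuous continuous_const)
    (isL2Loc_psiFun u) (isL2Loc_partial_psiFun u) (hasCovPartials_psiFun u)
  have h2 : HasWeakDiv (fun j => (V j).1)
      fun x => S.1 x + ∑ j, Complex.I * (bgPotential n x j : ℂ) * (V j).1 x := by
    refine h1.congr (fun j => (hV j).symm) ?_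
    filter_upwards [hS, hV 0, hV 1] with x h3 h4 h5
    simp only [Fin.sum_univ_two] at h3 ⊢
    rw [h3, h4, h5]
    ring
  have h3 := GaugeL2.pairing h2 (hasCovPartials_val u.1)
  have h4 : ∑ j, inner ℂ (Sobolev2.D j u.1) (V j) = conj (inner ℂ (Sobolev2.val u.1) S) := by
    rw [Fin.sum_univ_two, GaugeL2.inner_eq, GaugeL2.inner_eq, GaugeL2.inner_eq,
      ← integral_add (GaugeL2.integrable_mul_conj _ _) (GaugeL2.integrable_mul_conj _ _),
      ← integral_conj]
    refine integral_congr_ae (ae_restrict_of_ae ?_)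
    filter_upwards [hS, hV 0, hV 1] with x h3 h4 h5
    rw [h3, h4, h5, Fin.sum_univ_two]
    simp only [map_mul, map_add, Complex.conj_conj, Complex.conj_ofReal]
    change _ * psiFun u x * conj (covFun u 0 x) + _ * psiFun u x * conj (covFun u 1 x) =
      _ * psiFun u x
    ring
  rw [h4] at h3
  have h5 := congrArg Complex.re h3
  simp only [Complex.add_re, Complex.conj_re, Complex.zero_re] at h5
  linarith

/-- The inner product of a function with its multiple by a real function is real. -/
theorem im_inner_real_mul (f g : GaugeL2 n τ) {r : Plane → ℝ}
    (hg : ∀ᵐ x : Plane, g.1 x = (r x : ℂ) * f.1 x) : (inner ℂ f g).im = 0 := by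
  rw [← Complex.conj_eq_iff_im, GaugeL2.inner_eq, ← integral_conj]
  refine integral_congr_ae (ae_restrict_of_ae ?_)
  filter_upwards [hg] with x hx
  rw [hx]
  simp only [map_mul, Complex.conj_conj, Complex.conj_ofReal]
  ring

/-- H(u, α) = 2iS + |α|²u, where ⟨u, S⟩ is purely imaginary by `re_inner_transport` and |α|² is a
real multiplier. -/
theorem im_inner_H (d : IsDecomposition κ X' X'' Y' Y'' ι A M H C K) (u : X') (α : X'') :
    (inner ℂ (ι u) (H (u, α))).im = 0 := by
  set h : GaugeL2 n τ := (H (u, α)).1.1 with hh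
  obtain ⟨T, hT⟩ : ∃ T : GaugeL2 n τ, T.1 =ᵐ[volume]
      fun x => ((‖alphaFun α.1 x‖ ^ 2 : ℝ) : ℂ) * psiFun u.1 x := by
    obtain ⟨B, hB, hsub⟩ := cell_subset_ball τ
    have l3 := isL2Loc_norm_sq_mul d u α
    refine QP.exists_coe_eq (norm_phase n τ) l3.aestronglyMeasurable (fun p q => ?_)
      ((l3 B hB).mono_measure (Measure.restrict_mono hsub le_rfl))
    filter_upwards [psiFun_add u.1 p q, alphaFun_add α.1 p q] with x h1 h2
    rw [h1, h2, smul_eq_mul]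
    ring
  set S : GaugeL2 n τ := (2 * Complex.I)⁻¹ • (h - T) with hS
  have hSae : ∀ᵐ x : Plane, S.1 x = ∑ j, (alphaFun α.1 x j : ℂ) * covFun u.1 j x := by
    filter_upwards [QP.coeFn_smul (2 * Complex.I)⁻¹ (h - T), QP.coeFn_sub h T, hT, d.H_ae (u, α)]
      with x h1 h2 h3 h4
    refine h1.trans ?_
    rw [h2, h3]
    refine (congrArg (fun z => (2 * Complex.I)⁻¹ • (z - _)) h4).trans ?_
    simp only [mixedTerm, add_sub_cancel_right, smul_eq_mul]
    rw [inv_mul_cancel_left₀ (by simp)]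
  have e : h = (2 * Complex.I) • S + T := by
    rw [hS, smul_smul, mul_inv_cancel₀ (by simp), one_smul, sub_add_cancel]
  have h1 := re_inner_transport u.1 α.1 (isL2Loc_alpha_psi d u α) hSae
  have h2 := im_inner_real_mul (Sobolev2.val u.1.1) T (r := fun x => ‖alphaFun α.1 x‖ ^ 2) hT
  have h3 : inner ℂ (ι u) (H (u, α)) = inner ℂ (Sobolev2.val u.1.1) h := by
    change inner ℂ (ι u).1 (H (u, α)).1 = _
    rw [d.ι_coe]
    rfl
  rw [h3, e, inner_add_right, inner_smul_right, Complex.add_im, h2, Complex.mul_im, h1]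
  simp

theorem im_inner_C (d : IsDecomposition κ X' X'' Y' Y'' ι A M H C K) (u : X') :
    (inner ℂ (ι u) (C u)).im = 0 := by
  have h3 : inner ℂ (ι u) (C u) = inner ℂ (Sobolev2.val u.1.1) (C u).1.1 := by
    change inner ℂ (ι u).1 (C u).1 = _
    rw [d.ι_coe]
    rfl
  rw [h3]
  exact im_inner_real_mul _ _ (r := fun x => κ ^ 2 * ‖psiFun u.1 x‖ ^ 2) (d.C_ae u)

theorem inner_A (d : IsDecomposition κ X' X'' Y' Y'' ι A M H C K) (v u : X') :
    inner ℂ (ι v) (A u) = ∑ j, inner ℂ (Sobolev2.D j v.1.1) (Sobolev2.D j u.1.1) -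
      n * inner ℂ (Sobolev2.val v.1.1) (Sobolev2.val u.1.1) := by
  have h3 : inner ℂ (ι v) (A u) = inner ℂ (Sobolev2.val v.1.1)
      (-(Sobolev2.DD 0 0 u.1.1 + Sobolev2.DD 1 1 u.1.1) - (n : ℂ) • Sobolev2.val u.1.1) := by
    change inner ℂ (ι v).1.1 (A u).1.1 = _
    rw [d.A_coe, d.ι_coe]
    rfl
  rw [h3, inner_sub_right, inner_laplacian, inner_smul_right]

theorem im_inner_A (d : IsDecomposition κ X' X'' Y' Y'' ι A M H C K) (u : X') :
    (inner ℂ (ι u) (A u)).im = 0 := by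
  have h : ∀ f : GaugeL2 n τ, (inner ℂ f f).im = 0 := fun f => inner_self_im (𝕜 := ℂ) f
  rw [inner_A d, Fin.sum_univ_two, Complex.sub_im, Complex.add_im, h, h, Complex.mul_im, h]
  simp

/-- After pairing with ι u, every term on the left is real, whereas the right side becomes iν‖ι
x₀‖², because u has the same component along x₀ as x₀ itself. -/
theorem gauge_condition (d : IsDecomposition κ X' X'' Y' Y'' ι A M H C K) {x₀ : X'}
    (hx₀ : ι x₀ ≠ 0) (t μ ν : ℝ) (u : X') (α : X'')
    (hu : inner ℂ (ι x₀) (ι u) = inner ℂ (ι x₀) (ι x₀))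
    (h : A u - μ • ι u + H (u, α) + t • C u = ν • Complex.I • ι x₀) : ν = 0 := by
  have h1 := congrArg (fun y => (inner ℂ (ι u) y).im) h
  have e1 : ∀ (r : ℝ) (y : Y'), (inner ℂ (ι u) (r • y)).im = r * (inner ℂ (ι u) y).im := by
    intro r y
    have : r • y = (r : ℂ) • y := rfl
    rw [this, inner_smul_right, Complex.im_ofReal_mul]
  have hs : (inner ℂ (ι u) (ι u)).im = 0 := inner_self_im (𝕜 := ℂ) (ι u)
  have hu' : inner ℂ (ι u) (ι x₀) = inner ℂ (ι x₀) (ι x₀) := by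
    rw [← inner_conj_symm, hu, inner_conj_symm]
  have hr : (inner ℂ (ι x₀) (ι x₀)).re = ‖ι x₀‖ ^ 2 := inner_self_eq_norm_sq (𝕜 := ℂ) (ι x₀)
  simp only [inner_add_right, inner_sub_right, Complex.add_im, Complex.sub_im, e1, im_inner_A d,
    im_inner_H d, im_inner_C d, hs, inner_smul_right, hu', Complex.mul_im, hr, Complex.I_re,
    Complex.I_im] at h1
  have h3 : ν * ‖ι x₀‖ ^ 2 = 0 := by linarith
  exact (mul_eq_zero.1 h3).resolve_right (pow_ne_zero 2 (norm_ne_zero_iff.2 hx₀))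

end Gauge

/-! ### The linear operators satisfy the abstract hypotheses. -/

section Linear

variable {n : ℕ} {τ : UpperHalfPlane} {κ : ℝ} {X' : Submodule ℂ (H2psi n τ)}
  {X'' : Submodule ℝ (H2alpha τ)} {Y' : Submodule ℂ (L2psi n τ)} {Y'' : Submodule ℝ (L2alpha τ)}
  {ι A : X' →L[ℂ] Y'} {M : X'' →L[ℝ] Y''} {H : X' × X'' → Y'} {C : X' → Y'} {K : X' × X'' → Y''}

/-- A is a shift of Lⁿ by a real number. -/
theorem isGraphSelfAdjoint_A (d : IsDecomposition κ X' X'' Y' Y'' ι A M H C K)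
    (hL : LandauSelfAdjoint X' Y') :
    IsGraphSelfAdjoint (𝕜 := ℂ) (ι : X' →ₗ[ℂ] Y') (A : X' →ₗ[ℂ] Y') := by
  have hA : ∀ ψ : X', (A ψ + (n : ℂ) • ι ψ).1.1 = landau n τ ψ.1 := by
    intro ψ
    change (A ψ).1.1 + (n : ℂ) • (ι ψ).1.1 = _
    rw [d.A_coe, d.ι_coe]
    exact sub_add_cancel _ _
  have h : IsGraphSelfAdjoint (𝕜 := ℂ) (ι : X' →ₗ[ℂ] Y')
      ((A : X' →ₗ[ℂ] Y') + (n : ℂ) • (ι : X' →ₗ[ℂ] Y')) := by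
    intro y w
    have h1 := hL y.1 y.2 w.1 w.2
    constructor
    · intro h2
      obtain ⟨ψ, hψ, h3, h4⟩ := h1.1 fun ψ hψ => by
        have h5 := h2 ⟨ψ, hψ⟩
        have e1 : landau n τ ψ = ((A ⟨ψ, hψ⟩ + (n : ℂ) • ι ⟨ψ, hψ⟩).1.1 : GaugeL2 n τ) :=
          (hA ⟨ψ, hψ⟩).symm
        have e2 : inclPsi ψ = (ι ⟨ψ, hψ⟩).1 := (d.ι_coe ⟨ψ, hψ⟩).symm
        rw [e1, e2]
        exact h5
      refine ⟨⟨ψ, hψ⟩, Subtype.ext ((d.ι_coe ⟨ψ, hψ⟩).trans h3), Y'_ext ?_⟩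
      exact (hA ⟨ψ, hψ⟩).trans h4
    · rintro ⟨ψ, h3, h4⟩ φ
      have h5 := h1.2 ⟨ψ.1, ψ.2, (d.ι_coe ψ).symm.trans (congrArg Subtype.val h3),
        (hA ψ).symm.trans (congrArg (fun y : Y' => y.1.1) h4)⟩ φ.1 φ.2
      rw [← hA φ, ← d.ι_coe φ] at h5
      exact h5
  have h2 := h.add_real (-n)
  have e : (A : X' →ₗ[ℂ] Y') + (n : ℂ) • (ι : X' →ₗ[ℂ] Y') +
      (((-n : ℝ) : ℂ)) • (ι : X' →ₗ[ℂ] Y') = (A : X' →ₗ[ℂ] Y') := by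
    refine LinearMap.ext fun ψ => ?_
    change A ψ + (n : ℂ) • ι ψ + ((-n : ℝ) : ℂ) • ι ψ = A ψ
    rw [Complex.ofReal_neg, Complex.ofReal_natCast, neg_smul, add_neg_cancel_right]
  rw [← e]
  exact h2

theorem isGraphSelfAdjoint_M (d : IsDecomposition κ X' X'' Y' Y'' ι A M H C K)
    (ι' : X'' →ₗ[ℝ] Y'') (hι' : ∀ α, (ι' α).1 = inclAlpha α.1)
    (hM : CurlCurlSelfAdjoint X'' Y'') :
    IsGraphSelfAdjoint (𝕜 := ℝ) ι' (M : X'' →ₗ[ℝ] Y'') := by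
  have hae : ∀ α : X'', curlCurl α.1 =ᵐ[volume] (M α).1.1.1 := by
    intro α
    rw [d.M_coe]
    exact curlCurl_eq α.1
  have hin : ∀ (α : X'') (y : Y''),
      ∫ x in cell τ, inner ℝ (curlCurl α.1 x) (y.1.1.1 x) = inner ℝ (M α) y := by
    intro α y
    refine Eq.trans ?_ (QP.inner_eq (M α).1.1 y.1.1).symm
    refine integral_congr_ae (ae_restrict_of_ae ?_)
    filter_upwards [hae α] with x hx
    rw [hx]
  intro y w
  have h1 := hM y.1 y.2 w.1 w.2
  constructor
  · intro h2
    obtain ⟨α, hα, h3, h4⟩ := h1.1 fun α hα => by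
      have e2 : inclAlpha α = (ι' ⟨α, hα⟩).1 := (hι' ⟨α, hα⟩).symm
      refine (hin ⟨α, hα⟩ y).trans ((h2 ⟨α, hα⟩).trans ?_)
      rw [e2]
      rfl
    refine ⟨⟨α, hα⟩, Subtype.ext ((hι' ⟨α, hα⟩).trans h3), Y''_ext (QP.ext_ae ?_)⟩
    exact (hae ⟨α, hα⟩).symm.trans h4
  · rintro ⟨α, h3, h4⟩ β
    have h5 := h1.2 ⟨α.1, α.2, (hι' α).symm.trans (congrArg Subtype.val h3), by
      rw [← h4]
      exact hae α⟩ β.1 β.2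
    rw [← hι' β] at h5
    exact (hin β y).symm.trans h5

/-- The remaining entries of a jet are weak covariant derivatives, which are unique. -/
theorem Sobolev2.val_injective {𝕜 E : Type} [RCLike 𝕜] [NormedAddCommGroup E]
    [InnerProductSpace 𝕜 E] [NormedSpace ℝ E] [SMulCommClass ℝ 𝕜 E] [CompleteSpace E]
    {τ : UpperHalfPlane} {m : ℤ → ℤ → Plane → 𝕜} {c : Fin 2 → Plane → 𝕜} :
    Function.Injective (Sobolev2.val : Sobolev2 𝕜 E τ m c →ₗ[𝕜] QP 𝕜 E τ m) := by
  have key : ∀ (j : Fin 2) (b : Plane → 𝕜) (f g : QP 𝕜 E τ m), f = 0 →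
      (HasWeakPartial j f.1 fun x => g.1 x + b x • f.1 x) → g = 0 := by
    rintro j b f g rfl h
    refine QP.ext_ae ?_
    have h0 : HasWeakPartial j (0 : QP 𝕜 E τ m).1 (0 : Plane → E) :=
      HasWeakPartial.zero.congr
        (AEEqFun.coeFn_zero (α := Plane) (β := E) (μ := volume)).symm EventuallyEq.rfl
    filter_upwards [h.unique h0, QP.coeFn_zero (𝕜 := 𝕜) (E := E) (τ := τ) (m := m)] with x h1 h2
    rw [h2] at h1 ⊢
    simpa using h1
  rw [injective_iff_map_eq_zero]
  intro u hu
  have h1 : ∀ j, Sobolev2.D j u = 0 := fun j => key j _ _ _ hu (u.2.1 j)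
  have h2 : ∀ k j, Sobolev2.DD k j u = 0 := fun k j => key k _ _ _ (h1 j) (u.2.2 k j)
  refine Subtype.ext (PiLp.ext fun i => ?_)
  rcases i with _ | j | ⟨k, j⟩
  exacts [hu, h1 j, h2 k j]

/-- The lower bound for curl* curl gives injectivity and, with self-adjointness, surjectivity. -/
theorem bijective_M (d : IsDecomposition κ X' X'' Y' Y'' ι A M H C K) [CompleteSpace Y'']
    (hXY : ∀ α ∈ X'', inclAlpha α ∈ Y'') (hM : CurlCurlSelfAdjoint X'' Y'') :
    Function.Bijective M := by
  let ι' : X'' →ₗ[ℝ] Y'' :=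
    LinearMap.codRestrict Y'' (inclAlpha ∘ₗ X''.subtype) fun α => hXY α.1 α.2
  obtain ⟨c, hc, hb⟩ := exists_curlCurl_bound τ
  have hb' : ∀ α : X'', c * ‖ι' α‖ ≤ ‖M α‖ := fun α => hb α.1 (M α).1.1 (by
    rw [d.M_coe]
    exact curlCurl_eq α.1)
  refine ⟨?_, (isGraphSelfAdjoint_M d ι' (fun _ => rfl) hM).surjective_of_bound hc hb'⟩
  rw [injective_iff_map_eq_zero]
  intro α hα
  have h1 := hb' α
  rw [hα, norm_zero] at h1
  have h2 : ι' α = 0 := norm_le_zero_iff.1 (by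
    by_contra! h
    exact absurd h1 (not_le.2 (mul_pos hc h)))
  have h3 : Sobolev2.val α.1.1 = 0 := congrArg (fun y : Y'' => y.1.1) h2
  exact Subtype.ext (Subtype.ext (Sobolev2.val_injective (h3.trans (map_zero _).symm)))

theorem ι_ne_zero (d : IsDecomposition κ X' X'' Y' Y'' ι A M H C K) {x₀ : X'}
    (hnorm : ⨍ x in cell τ, ‖psiFun x₀.1 x‖ ^ 2 = 1) : ι x₀ ≠ 0 := by
  intro h
  have h1 : Sobolev2.val x₀.1.1 = 0 := by
    have := congrArg (fun y : Y' => y.1.1) h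
    change (ι x₀).1.1 = 0 at this
    rw [d.ι_coe] at this
    exact this
  have h2 : ∫ x in cell τ, ‖psiFun x₀.1 x‖ ^ 2 = 0 := by
    refine integral_eq_zero_of_ae (ae_restrict_of_ae ?_)
    filter_upwards [QP.coeFn_zero (𝕜 := ℂ) (E := ℂ) (m := phase n τ) (τ := τ)] with x hx
    have : psiFun x₀.1 x = 0 := by
      unfold psiFun
      rw [h1]
      exact hx
    rw [this]
    simp
  rw [setAverage_eq, h2, smul_zero] at hnorm
  exact zero_ne_one hnorm

theorem mem_landauNull_iff {ψ : H2psi n τ} :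
    ψ ∈ landauNull n τ ↔ landau n τ ψ - (n : ℂ) • Sobolev2.val ψ.1 = 0 :=
  LinearMap.mem_ker

theorem A_eq_zero_iff (d : IsDecomposition κ X' X'' Y' Y'' ι A M H C K) {ψ : X'} :
    A ψ = 0 ↔ ψ.1 ∈ landauNull n τ := by
  rw [mem_landauNull_iff, ← d.A_coe]
  exact ⟨fun h => congrArg (fun y : Y' => y.1.1) h, fun h => Y'_ext h⟩

theorem exists_smul_of_mem_null (hdim : Module.finrank ℂ ↥(X' ⊓ landauNull n τ) = 1) {x₀ : X'}
    (hx₀ : x₀.1 ∈ landauNull n τ) (hne : x₀ ≠ 0) (x : X') (hx : x.1 ∈ landauNull n τ) :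
    ∃ c : ℂ, x = c • x₀ := by
  obtain ⟨c, hc⟩ := (finrank_eq_one_iff_of_nonzero' (⟨x₀.1, x₀.2, hx₀⟩ : ↥(X' ⊓ landauNull n τ))
    (fun h => hne (Subtype.ext
      (congrArg (fun z : ↥(X' ⊓ landauNull n τ) => (z : H2psi n τ)) h)))).1 hdim ⟨x.1, x.2, hx⟩
  exact ⟨c, Subtype.ext
    (congrArg (fun z : ↥(X' ⊓ landauNull n τ) => (z : H2psi n τ)) hc).symm⟩

/-- ℓ is the inner product with ι x₀: it kills the range of A by symmetry, and every y with ℓ(y) = 0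
is attained because of the gap 2n, which is positive as n ≥ 1. -/
theorem bifurcationData [CompleteSpace Y'] [CompleteSpace Y''] (hn : 1 ≤ n)
    (d : IsDecomposition κ X' X'' Y' Y'' ι A M H C K)
    (hXY : ∀ α ∈ X'', inclAlpha α ∈ Y'')
    (hL : LandauSelfAdjoint X' Y') (hM : CurlCurlSelfAdjoint X'' Y'')
    (hdim : Module.finrank ℂ ↥(X' ⊓ landauNull n τ) = 1)
    {x₀ : X'} (hx₀ : x₀.1 ∈ landauNull n τ) (hne : ι x₀ ≠ 0) :
    BifurcationData ι A M H C K x₀ (innerSL ℂ (ι x₀)) := by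
  have hA₀ : A x₀ = 0 := (A_eq_zero_iff d).2 hx₀
  have hsa := isGraphSelfAdjoint_A d hL
  have hne' : x₀ ≠ 0 := fun h => hne (by rw [h, map_zero])
  have hker : ∀ x, A x = 0 → ∃ c : ℂ, x = c • x₀ := fun x hx =>
    exists_smul_of_mem_null hdim hx₀ hne' x ((A_eq_zero_iff d).1 hx)
  have hgap : ∀ x, 0 ≤ (inner ℂ (A x) (ι x)).re ∧
      2 * n * (inner ℂ (A x) (ι x)).re ≤ ‖A x‖ ^ 2 := fun x => by
    have h1 := laplacian_gap x.1.1 (A x).1.1 (d.A_coe x)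
    have h2 : inner ℂ (A x) (ι x) = inner ℂ (A x).1.1 (Sobolev2.val x.1.1) := by
      change inner ℂ (A x).1 (ι x).1 = _
      rw [d.ι_coe]
      rfl
    rw [h2]
    exact h1
  exact
  { analytic_H := fun p => (isPolyDeg_H d).analyticAt_three d.continuous_H p
    analytic_C := fun p => (isPolyDeg_C d).analyticAt_three d.continuous_C p
    analytic_K := fun p => (isPolyDeg_K d).analyticAt_three d.continuous_K p
    H_smul := d.H_smul
    H_zero := d.H_zero
    C_smul := d.C_smul
    K_smul := d.K_smul
    A_x₀ := hA₀
    ℓ_x₀ := inner_self_ne_zero.2 hne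
    ℓ_A := fun x => by
      have h1 := hsa.symm x₀ x
      simp only [ContinuousLinearMap.coe_coe] at h1
      rw [innerSL_apply_apply, ← h1, hA₀, inner_zero_left]
    ker_A := hker
    range_A := fun y hy => hsa.exists_of_gap (c := 2 * n) (by positivity) (fun x => (hgap x).1)
      (fun x => (hgap x).2) hA₀ hne hker hy
    bijective_M := bijective_M d hXY hM
    gauge := fun t μ ν u α hu h => gauge_condition d hne t μ ν u α hu h }

end Linear

/-! ### Solutions of the Ginzburg–Landau equations and of the abstract problem. -/

section Solutions

variable {n : ℕ} {τ : UpperHalfPlane} {κ : ℝ} {X' : Submodule ℂ (H2psi n τ)}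
  {X'' : Submodule ℝ (H2alpha τ)} {Y' : Submodule ℂ (L2psi n τ)} {Y'' : Submodule ℝ (L2alpha τ)}
  {ι A : X' →L[ℂ] Y'} {M : X'' →L[ℝ] Y''} {H : X' × X'' → Y'} {C : X' → Y'} {K : X' × X'' → Y''}

theorem firstEq_iff_eq_zero (d : IsDecomposition κ X' X'' Y' Y'' ι A M H C K) (μ : ℝ) (ψ : X')
    (α : X'') : FirstEq κ (n + μ) ψ.1 α.1 ↔ A ψ - μ • ι ψ + H (ψ, α) + C ψ = 0 := by
  have key : ∀ᵐ x : Plane, (A ψ - μ • ι ψ + H (ψ, α) + C ψ).1.1.1 x =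
      (landau n τ ψ.1).1 x - ((n + μ : ℝ) : ℂ) * psiFun ψ.1 x + hTerm κ ψ.1 α.1 x := by
    have e : (A ψ - μ • ι ψ + H (ψ, α) + C ψ).1.1 =
        landau n τ ψ.1 - (n : ℂ) • Sobolev2.val ψ.1.1 - (μ : ℂ) • Sobolev2.val ψ.1.1 +
          (H (ψ, α)).1.1 + (C ψ).1.1 := by
      change (A ψ).1.1 - (μ : ℂ) • (ι ψ).1.1 + (H (ψ, α)).1.1 + (C ψ).1.1 = _
      rw [d.A_coe, d.ι_coe]
      rfl
    rw [e]
    set a := landau n τ ψ.1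
    set f : GaugeL2 n τ := Sobolev2.val ψ.1.1 with hf
    set h : GaugeL2 n τ := (H (ψ, α)).1.1
    set c : GaugeL2 n τ := (C ψ).1.1
    filter_upwards [QP.coeFn_add (a - (n : ℂ) • f - (μ : ℂ) • f + h) c,
      QP.coeFn_add (a - (n : ℂ) • f - (μ : ℂ) • f) h,
      QP.coeFn_sub (a - (n : ℂ) • f) ((μ : ℂ) • f), QP.coeFn_sub a ((n : ℂ) • f),
      QP.coeFn_smul (n : ℂ) f, QP.coeFn_smul (μ : ℂ) f, d.H_ae (ψ, α), d.C_ae ψ]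
      with x h1 h2 h3 h4 h5 h6 h7 h8
    have h7' : h.1 x = mixedTerm ψ.1 α.1 x := h7
    have h8' : c.1 x = cubicTerm κ ψ.1 x := h8
    have h9 : psiFun ψ.1 x = f.1 x := rfl
    rw [h1, h2, h3, h4, h5, h6, h7', h8', hTerm_eq, h9]
    push_cast
    simp only [smul_eq_mul]
    ring
  constructor
  · intro h
    refine Y'_ext (QP.ext_ae ?_)
    filter_upwards [key, h, QP.coeFn_zero (𝕜 := ℂ) (E := ℂ) (m := phase n τ) (τ := τ)]
      with x h1 h2 h3
    exact h1.trans (h2.trans h3.symm)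
  · intro h
    rw [h] at key
    filter_upwards [key, QP.coeFn_zero (𝕜 := ℂ) (E := ℂ) (m := phase n τ) (τ := τ)] with x h1 h2
    exact h1.symm.trans h2

/-- Once the first equation holds, `current_eq_projection` identifies K(ψ, α) with the current
itself, so the projection loses nothing. -/
theorem solvesGL_iff_isSol (d : IsDecomposition κ X' X'' Y' Y'' ι A M H C K) (μ : ℝ) (ψ : X')
    (α : X'') : SolvesGL κ (n + μ) ψ.1 α.1 ↔ BifurcationData.IsSol ι A M H C K μ ψ α := by
  rw [solvesGL_iff, BifurcationData.IsSol, ← firstEq_iff_eq_zero d]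
  refine and_congr_right fun h => ?_
  have h1 : curlCurl α.1 =ᵐ[volume] (M α).1.1.1 := by
    rw [d.M_coe]
    exact curlCurl_eq α.1
  have h2 : (K (ψ, α)).1.1.1 =ᵐ[volume] current ψ.1 α.1 :=
    current_eq_projection h (isL2Loc_alpha_psi d ψ α) (isL2Loc_alpha_cov d ψ α)
      (isL2Loc_norm_sq_mul d ψ α) (isL2Loc_cubicTerm d ψ) (d.K_proj (ψ, α))
  constructor
  · intro h3
    exact Y''_ext (QP.ext_ae (h1.symm.trans (h3.trans h2.symm)))
  · intro h3
    rw [h3] at h1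
    exact h1.trans h2

theorem inner_landau_sub (v u : H2psi n τ) :
    inner ℂ (Sobolev2.val v.1) (landau n τ u - (n : ℂ) • Sobolev2.val u.1) =
      inner ℂ (landau n τ v - (n : ℂ) • Sobolev2.val v.1) (Sobolev2.val u.1) := by
  have h : ∀ v u : H2psi n τ, inner ℂ (Sobolev2.val v.1) (landau n τ u - (n : ℂ) •
      Sobolev2.val u.1) = ∑ j, inner ℂ (Sobolev2.D j v.1) (Sobolev2.D j u.1) -
      n * inner ℂ (Sobolev2.val v.1) (Sobolev2.val u.1) := fun v u => by
    rw [inner_sub_right, inner_smul_right]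
    exact congrArg (· - _) (inner_laplacian v.1 u.1)
  rw [← inner_conj_symm (landau n τ v - (n : ℂ) • Sobolev2.val v.1), h, h]
  simp only [map_sub, map_sum, map_mul, inner_conj_symm, Complex.conj_natCast]

/-- Orthogonality to the null space in `X'` is orthogonality to the full null space. -/
theorem inner_null_eq_zero [CompleteSpace Y'] (d : IsDecomposition κ X' X'' Y' Y'' ι A M H C K)
    (hL : LandauSelfAdjoint X' Y') {x₀ : X'} (hker : ∀ x, A x = 0 → ∃ c : ℂ, x = c • x₀)
    {w : X'} (hw : inner ℂ (ι x₀) (ι w) = 0) {φ : H2psi n τ} (hφ : φ ∈ landauNull n τ) :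
    inner ℂ (inclPsi φ) (inclPsi w.1) = 0 := by
  -- φ need not lie in `X'`. Its projection y onto `Y'` is orthogonal to the range of A, because φ
  -- is a null vector and Lⁿ is symmetric on all of `H2psi`. Self-adjointness then places y in the
  -- kernel of A, so y is a multiple of ι x₀ and orthogonal to w.
  set y : Y' := Y'.orthogonalProjectionOnto (inclPsi φ) with hy
  have hy1 : ∀ z : Y', inner ℂ z y = inner ℂ z.1 (inclPsi φ) := fun z =>
    Submodule.inner_orthogonalProjectionOnto_eq_of_mem_left z (inclPsi φ)
  obtain ⟨x, hx1, hx2⟩ := (isGraphSelfAdjoint_A d hL y 0).1 fun x => by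
    rw [inner_zero_right]
    refine (hy1 (A x)).trans ?_
    change inner ℂ (A x).1.1 (Sobolev2.val φ.1) = 0
    rw [d.A_coe, ← inner_landau_sub, mem_landauNull_iff.1 hφ, inner_zero_right]
  obtain ⟨c, rfl⟩ := hker x hx2
  have h1 : y = c • ι x₀ := by
    rw [← hx1]
    exact map_smul ι c x₀
  have h2 : inner ℂ (ι w) y = 0 := by
    rw [h1, inner_smul_right, ← inner_conj_symm, hw, map_zero, mul_zero]
  rw [← inner_conj_symm, ← d.ι_coe w, ← hy1, h2, map_zero]

end Solutions

end GinzburgLandau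

end

/-! ### Assembly of the main theorem. -/

theorem mainTheorem2 (κ : ℝ) (hκ : 0 < κ) (n : ℕ) (hn : 1 ≤ n) (τ : UpperHalfPlane)
    (X' : Submodule ℂ (GinzburgLandau.H2psi n τ)) (X'' : Submodule ℝ (GinzburgLandau.H2alpha τ))
    (Y' : Submodule ℂ (GinzburgLandau.L2psi n τ)) (Y'' : Submodule ℝ (GinzburgLandau.L2alpha τ))
    (hXY : GinzburgLandau.XYCondition κ n τ X' X'' Y' Y'')
    (hL : GinzburgLandau.LandauSelfAdjoint X' Y') (hM : GinzburgLandau.CurlCurlSelfAdjoint X'' Y'')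
    (hdim : Module.finrank ℂ ↥(X' ⊓ GinzburgLandau.landauNull n τ) = 1)
    (ψ₀ : X') (hψ₀ : (ψ₀ : GinzburgLandau.H2psi n τ) ∈ GinzburgLandau.landauNull n τ)
    (hnorm : ⨍ x in GinzburgLandau.cell τ, ‖GinzburgLandau.psiFun (ψ₀ : GinzburgLandau.H2psi n τ) x‖ ^ 2 = 1) :
    ∃ ε > (0 : ℝ), ∃ (gl : ℝ → ℝ) (gψ : ℝ → X') (gα : ℝ → X''),
      AnalyticOnNhd ℝ gl (Set.Ico 0 ε) ∧ AnalyticOnNhd ℝ gψ (Set.Ico 0 ε) ∧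
      AnalyticOnNhd ℝ gα (Set.Ico 0 ε) ∧
      gl 0 = 0 ∧ gψ 0 = 0 ∧ gα 0 = 0 ∧
      (∀ t ∈ Set.Ico 0 ε, ∀ φ ∈ GinzburgLandau.landauNull n τ,
        inner ℂ (GinzburgLandau.inclPsi φ) (GinzburgLandau.inclPsi (gψ t : GinzburgLandau.H2psi n τ)) = 0) ∧
      (∀ s ∈ Set.Ico 0 (√ε), GinzburgLandau.SolvesGL κ (n + gl (s ^ 2))
        (s • ψ₀ + s • gψ (s ^ 2) : X').1 (gα (s ^ 2)).1) ∧
      (∀ s ∈ Set.Ioo 0 (√ε), s • ψ₀ + s • gψ (s ^ 2) ≠ 0) ∧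
      ∃ U ∈ nhds ((n : ℝ), (0 : X'), (0 : X'')), ∀ (lam : ℝ) (ψ : X') (α : X''),
        (lam, ψ, α) ∈ U → GinzburgLandau.SolvesGL κ lam ψ.1 α.1 →
          (ψ = 0 ∧ α = 0) ∨
          ∃ s ∈ Set.Ioo 0 (√ε), ∃ δ : ℝ, lam = n + gl (s ^ 2) ∧
            ψ = Complex.exp (Complex.I * δ) • (s • ψ₀ + s • gψ (s ^ 2)) ∧ α = gα (s ^ 2) := by
  have _ : CompleteSpace X' := hXY.closed_X'.completeSpace_coe
  have _ : CompleteSpace X'' := hXY.closed_X''.completeSpace_coe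
  have _ : CompleteSpace Y' := hXY.closed_Y'.completeSpace_coe
  have _ : CompleteSpace Y'' := hXY.closed_Y''.completeSpace_coe
  obtain ⟨ι, A, M, H, C, K, d⟩ := GinzburgLandau.exists_decomposition hXY
  have hdata := GinzburgLandau.bifurcationData hn d hXY.subset'' hL hM hdim hψ₀
    (GinzburgLandau.ι_ne_zero d hnorm)
  obtain ⟨ε, hε, gl, gψ, gα, h1, h2, h3, h4, h5, h6, horth, hsol, hne, hnhd⟩ := hdata.bifurcation
  refine ⟨ε, hε, gl, gψ, gα, h1, h2, h3, h4, h5, h6, fun t ht φ hφ => ?_, fun s hs => ?_, hne, ?_⟩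
  · exact GinzburgLandau.inner_null_eq_zero d hL hdata.ker_A (horth t ht) hφ
  · exact (GinzburgLandau.solvesGL_iff_isSol d _ _ _).2 (hsol s hs)
  -- The abstract problem is centred at μ = λ - n = 0, so the neighbourhood is pulled back under
  -- this shift.
  · have ht : Tendsto (fun p : ℝ × X' × X'' => (p.1 - n, p.2)) (𝓝 ((n : ℝ), 0, 0)) (𝓝 0) := by
      have hc : Continuous fun p : ℝ × X' × X'' => (p.1 - (n : ℝ), p.2) := by fun_prop
      have h := hc.tendsto ((n : ℝ), 0, 0)
      rwa [sub_self] at h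
    refine ⟨_, ht.eventually hnhd, fun lam ψ α hU hGL => ?_⟩
    have e : lam = n + (lam - n) := (add_sub_cancel _ _).symm
    rw [e, GinzburgLandau.solvesGL_iff_isSol d] at hGL
    rcases hU hGL with h | ⟨s, hs, δ, h7, h8, h9⟩
    · exact Or.inl h
    · exact Or.inr ⟨s, hs, δ, by rw [← h7]; exact e, h8, h9⟩
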